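/- Let $n\ge 1$, let $(M,g)$ be a smooth Riemannian manifold of dimension $n+1$, and let $i:\Sigma_0\to M$ be a smooth immersion of a compact smooth $n$-manifold with (possibly empty) boundary. Let $N_0$ be a smooth unit normal field along $i$ (the outward one when $\Sigma_0$ is convex), $g_0=i^*g$ the induced metric, and $A_0(v,w)=g(\nabla_vN_0,di(w))$ the second fundamental form. Let $W\subseteq\Sigma_0\times\mathbb R$ be an open neighbourhood of $\Sigma_0\times\{0\}$ whose fibres $\{t:(x,t)\in W\}$ are intervals, and suppose that the normal exponential map $\mathcal E(x,t)=\mathrm{Exp}(-tN_0(x))$ is defined on $W$ and gives coordinates there, i.e. it is a smooth immersion $W\to M$. For a function $f:\Sigma_0\to\mathbb R$ with $(x,f(x))\in W$ for all $x$, the graph of $f$ is the hypersurface $x\mapsto\mathcal E(x,f(x))$. Then there exist functions $\psi(x,t,p)\in\mathbb R$ and bilinear forms $\Psi(x,t,p)$, $\Psi_0(x,t,p)$ on $T_x\Sigma_0$, depending smoothly on $(x,t)\in W$, $p\in T_x\Sigma_0$ and not depending on $f$, such that: (i) $\psi>0$, and for every $R>0$ there is $\epsilon>0$ such that, for all $(x,t)\in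 W$ with $|t|<\epsilon$, the function $p\mapsto\psi(x,t,p)$ is convex on $\{p\in T_x\Sigma_0:\|p\|_{g_0}\le R\}$; (ii) $\Psi$ is symmetric and, for all $(x,t)\in W$ and $p,v,w\in T_x\Sigma_0$, $$\Psi(x,t,p)(v,w)=A_0(v,w)+g_0(p,v)A_0(p,w)+g_0(p,w)A_0(p,v)+t\,\Psi_0(x,t,p)(v,w);$$ in particular, in index notation (with respect to $g_0$), $\Psi(x,f,\nabla f)_{ij}=A_{0,ij}+f_{;i}f_{;k}A_0{}^k{}_j+f_{;j}f_{;k}A_0{}^k{}_i+f\,\Psi_0(x,f,\nabla f)_{ij}$; (iii) for every smooth $f:\Sigma_0\to\mathbb R$ whose graph lies in $W$ (in particular for every such $f\le 0$), the graph of $f$ is a smooth immersed hypersurface with a smooth unit normal field $\nu$ pointing downwards (that is, $g(\nu,\partial_t\mathcal E)<0$). Let $A_f$ denote its second fundamental form, $A_f(v,w)=g(\nabla_v\nu,d\varphi(w))$ with $\varphi(x)=\mathcal E(x,f(x))$, and let the (normalised) Gaussian curvature be $K=\det(\text{shape operator})^{1/n}$. With $\nabla f$ and $\mathrm{Hess}(f)$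 taken with respect to $g_0$, and $\det$ of a bilinear form on $T_x\Sigma_0$ taken with respect to $g_0$, $$K^n=\psi(x,f,\nabla f)^{-n}\det\bigl(\mathrm{Hess}(f)+\Psi(x,f,\nabla f)\bigr),\qquad K=\psi(x,f,\nabla f)^{-1}\det\bigl(\mathrm{Hess}(f)+\Psi(x,f,\nabla f)\bigr)^{1/n},$$ where $K^n$ in the first identity denotes the determinant of the shape operator; (iv) for every such $f$ and every point $x$, $A_f$ is positive definite at $x$ if and only if $\mathrm{Hess}(f)+\Psi(x,f,\nabla f)$ is positive definite at $x$; in particular the graph of $f$ is (locally strictly) convex, i.e. $A_f$ is everywhere positive definite, if and only if $\mathrm{Hess}(f)+\Psi(x,f,\nabla f)$ is everywhere positive definite. -/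

import Mathlib

open Set Bundle
open scoped Manifold ContDiff

set_option maxSynthPendingDepth 3

noncomputable section

namespace GaussGraph

/-! ### Levi-Civita calculus in charts

A tangent vector at `x` is identified with its coordinates in the preferred chart `extChartAt I x`
(in Mathlib `TangentSpace I x` is by definition the model space `E`, read in that chart), so that
all the coordinate expressions below are evaluated at the centre of the chart. -/

section Calculus

variable {E : Type*} [NormedAddCommGroup E] [NormedSpace ℝ E]
  {H : Type*} [TopologicalSpace H] (I : ModelWithCorners ℝ E H)
  {X : Type*} [TopologicalSpace X] [ChartedSpace H X]
  {E' : Type*} [NormedAddCommGroup E'] [NormedSpace ℝ E']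
  {H' : Type*} [TopologicalSpace H'] (J : ModelWithCorners ℝ E' H')
  {Y : Type*} [TopologicalSpace Y] [ChartedSpace H' Y]

/-- A field of bilinear forms on the tangent spaces of `X` (for instance a Riemannian metric). -/
abbrev FormField : Type _ :=
  (x : X) → TangentSpace I x →L[ℝ] TangentSpace I x →L[ℝ] ℝ

/-- The pull-back `(v, w) ↦ B (L v, L w)` of a bilinear form by a linear map. -/
def pullForm {V W : Type*} [AddCommGroup V] [Module ℝ V] [TopologicalSpace V]
    [AddCommGroup W] [Module ℝ W] [TopologicalSpace W]
    (B : W →L[ℝ] W →L[ℝ] ℝ) (L : V →L[ℝ] W) : V →L[ℝ] V →L[ℝ] ℝ :=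
  (L.precomp ℝ) ∘L B ∘L L

/-- The form field `h` in the chart centred at `x₀`: at `z` in the range of the chart it is the
bilinear form on `E` with coefficients `h_ij = h(∂_i, ∂_j)` at the point with coordinates `z`. -/
def coordForm (h : FormField I (X := X)) (x₀ : X) (z : E) : E →L[ℝ] E →L[ℝ] ℝ :=
  pullForm (h ((extChartAt I x₀).symm z))
    (mfderivWithin 𝓘(ℝ, E) I (extChartAt I x₀).symm (range I) z)

/-- The derivative at `x₀` of the coefficients of `h` in the chart centred at `x₀`:
`dCoord I h x₀ u v w = u^k v^i w^j ∂_k h_ij`. -/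
def dCoord (h : FormField I (X := X)) (x₀ : X) : E →L[ℝ] E →L[ℝ] E →L[ℝ] ℝ :=
  (fderivWithin ℝ (coordForm I h x₀) (range I) (extChartAt I x₀ x₀) :)

/-- Christoffel symbols of the first kind of the metric `h` at `x₀`:
`Γ(u, v; w) = (∂_u h(v, w) + ∂_v h(u, w) - ∂_w h(u, v)) / 2`. -/
def christoffelFirst (h : FormField I (X := X)) (x₀ : X) : E →L[ℝ] E →L[ℝ] E →L[ℝ] ℝ :=
  let D : E →L[ℝ] E →L[ℝ] E →L[ℝ] ℝ := dCoord I h x₀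
  let D' : E →L[ℝ] E →L[ℝ] E →L[ℝ] ℝ :=
    ((ContinuousLinearMap.flipₗᵢ ℝ E E ℝ).toContinuousLinearEquiv :
        (E →L[ℝ] E →L[ℝ] ℝ) →L[ℝ] (E →L[ℝ] E →L[ℝ] ℝ)) ∘L D.flip
  ((2⁻¹ : ℝ) • (D + D.flip - D') :)

theorem christoffelFirst_apply (h : FormField I (X := X)) (x₀ : X) (u v w : E) :
    christoffelFirst I h x₀ u v w =
      (dCoord I h x₀ u v w + dCoord I h x₀ v u w - dCoord I h x₀ w u v) / 2 := by
  change 2⁻¹ * (dCoord I h x₀ u v w + dCoord I h x₀ v u w - dCoord I h x₀ w u v) = _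
  ring

/-- Raising an index with the metric `h`: the linear form `ℓ` on `T_x X` is sent to the vector `p`
with `h(p, ·) = ℓ`. -/
def raise (h : FormField I (X := X)) (x : X) :
    (TangentSpace I x →L[ℝ] ℝ) →L[ℝ] TangentSpace I x :=
  (h x).inverse

/-- Christoffel symbols of the second kind: the Levi-Civita connection of `h` is
`D + Γ` in the chart centred at `x₀`. -/
def christoffel (h : FormField I (X := X)) (x₀ : X) : E →L[ℝ] E →L[ℝ] E :=
  (ContinuousLinearMap.postcomp E (raise I h x₀ : (E →L[ℝ] ℝ) →L[ℝ] E)) ∘L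
    christoffelFirst I h x₀

/-- The gradient of `f` with respect to the metric `h`. -/
def gradient (h : FormField I (X := X)) (f : X → ℝ) (x : X) : TangentSpace I x :=
  raise I h x (mfderiv I 𝓘(ℝ, ℝ) f x)

/-- The Hessian of `f` for the Levi-Civita connection of the metric `h`:
`(Hess f)(v, w) = D²f(v, w) - df(Γ(v, w))`. -/
def hessian (h : FormField I (X := X)) (f : X → ℝ) (x : X) :
    TangentSpace I x →L[ℝ] TangentSpace I x →L[ℝ] ℝ :=
  let D2f : E →L[ℝ] E →L[ℝ] ℝ :=
    (fderivWithin ℝ (fderivWithin ℝ (f ∘ (extChartAt I x).symm) (range I)) (range I)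
      (extChartAt I x x) :)
  let df : E →L[ℝ] ℝ := mfderiv I 𝓘(ℝ, ℝ) f x
  let dfΓ : E →L[ℝ] E →L[ℝ] ℝ := ContinuousLinearMap.postcomp E df ∘L christoffel I h x
  show E →L[ℝ] E →L[ℝ] ℝ from D2f - dfΓ

/-- The covariant derivative `v ↦ ∇_v V` at `x` of a vector field `V` along the map `φ : X → Y`,
for the Levi-Civita connection of the metric `g` of `Y`: in the chart of `Y` centred at `φ x`,
`∇_v V = D_v V + Γ(dφ(v), V)`. -/
def covDerivAlong (g : FormField J (X := Y)) (φ : X → Y)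
    (V : (x : X) → TangentSpace J (φ x)) (x : X) :
    TangentSpace I x →L[ℝ] TangentSpace J (φ x) :=
  let Vc : X → E' := fun y => mfderiv J 𝓘(ℝ, E') (extChartAt J (φ x)) (φ y) (V y)
  let DV : E →L[ℝ] E' := mfderiv I 𝓘(ℝ, E') Vc x
  let dφ : E →L[ℝ] E' := mfderiv I J φ x
  show E →L[ℝ] E' from DV + ((christoffel J g (φ x)).flip (V x)) ∘L dφ

/-- The first fundamental form (induced metric) of the map `φ : X → Y`. -/
def firstForm (g : FormField J (X := Y)) (φ : X → Y) : FormField I (X := X) :=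
  fun x => pullForm (g (φ x)) (mfderiv I J φ x)

/-- The second fundamental form of `φ` with respect to the normal field `ν`:
`A(v, w) = g(∇_v ν, dφ(w))`. -/
def secondForm (g : FormField J (X := Y)) (φ : X → Y)
    (ν : (x : X) → TangentSpace J (φ x)) : FormField I (X := X) :=
  fun x => ((mfderiv I J φ x).precomp ℝ) ∘L g (φ x) ∘L covDerivAlong I J g φ ν x

/-- The endomorphism of `T_x X` that corresponds to the bilinear form `B` under the metric `h`:
`h(L v, w) = B(v, w)`, i.e. `L^k_i = h^{kj} B_ij`. -/
def toEndo (h : FormField I (X := X)) (x : X)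
    (B : TangentSpace I x →L[ℝ] TangentSpace I x →L[ℝ] ℝ) :
    TangentSpace I x →L[ℝ] TangentSpace I x :=
  raise I h x ∘L B

/-- The shape operator of `φ` with respect to the normal field `ν`. -/
def shapeOperator (g : FormField J (X := Y)) (φ : X → Y)
    (ν : (x : X) → TangentSpace J (φ x)) (x : X) :
    TangentSpace I x →L[ℝ] TangentSpace I x :=
  toEndo I (firstForm I J g φ) x (secondForm I J g φ ν x)

/-- Smooth immersions: smooth maps with everywhere injective derivative. -/
structure IsSmoothImmersion (φ : X → Y) : Prop where
  smooth : ContMDiff I J ∞ φ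
  injective : ∀ x, Function.Injective (mfderiv I J φ x)

/-- `ν` is a smooth unit normal vector field along `φ`. -/
structure IsUnitNormal [IsManifold J ∞ Y] (g : FormField J (X := Y)) (φ : X → Y)
    (ν : (x : X) → TangentSpace J (φ x)) : Prop where
  smooth : ContMDiff I J.tangent ∞ (fun x => (⟨φ x, ν x⟩ : TangentBundle J Y))
  unit : ∀ x, g (φ x) (ν x) (ν x) = 1
  normal : ∀ x (v : TangentSpace I x), g (φ x) (ν x) (mfderiv I J φ x v) = 0

/-- The velocity of a curve. -/
def velocity (γ : ℝ → Y) (t : ℝ) : TangentSpace J (γ t) :=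
  mfderiv 𝓘(ℝ, ℝ) J γ t (1 : ℝ)

/-- The normal exponential map `𝓔(x, t) = Exp(-t N(x))` of the hypersurface `φ` with unit normal
field `N` furnishes coordinates on `W ⊆ X × ℝ`. Here `W` is an open neighbourhood of `X × {0}` whose
vertical fibres are intervals; `t ↦ 𝓔(x, t)` is the geodesic that leaves `φ x` with velocity
`-N x`, which determines `𝓔` on `W`; and `𝓔` is a smooth immersion of `W`. -/
structure IsNormalExp (g : FormField J (X := Y)) (φ : X → Y)
    (N : (x : X) → TangentSpace J (φ x)) (W : Set (X × ℝ)) (𝓔 : X × ℝ → Y) : Prop where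
  isOpen : IsOpen W
  zero_mem : ∀ x, (x, (0 : ℝ)) ∈ W
  ordConnected : ∀ x, OrdConnected {t : ℝ | (x, t) ∈ W}
  smooth : ContMDiffOn (I.prod 𝓘(ℝ, ℝ)) J ∞ 𝓔 W
  initial : ∀ x, (⟨𝓔 (x, 0), velocity J (fun t => 𝓔 (x, t)) 0⟩ : TangentBundle J Y) = ⟨φ x, -N x⟩
  geodesic : ∀ x t, (x, t) ∈ W →
    covDerivAlong 𝓘(ℝ, ℝ) J g (fun s => 𝓔 (x, s)) (velocity J (fun s => 𝓔 (x, s))) t (1 : ℝ) = 0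
  immersive : ∀ q ∈ W, Function.Injective (mfderiv (I.prod 𝓘(ℝ, ℝ)) J 𝓔 q)

/-- The graph of `f`, parametrised by `x ↦ 𝓔(x, f(x))`. -/
def graph (𝓔 : X × ℝ → Y) (f : X → ℝ) (x : X) : Y := 𝓔 (x, f x)

/-- `ν` is the smooth unit normal field of the graph of `f` that points downwards, i.e. to the side
of decreasing `t` (for `f = 0` it is `N`). -/
structure IsDownwardNormal [IsManifold J ∞ Y] (g : FormField J (X := Y)) (𝓔 : X × ℝ → Y) (f : X → ℝ)
    (ν : (x : X) → TangentSpace J (graph 𝓔 f x)) : Prop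
    extends IsUnitNormal I J g (graph 𝓔 f) ν where
  downward : ∀ x, g (graph 𝓔 f x) (ν x) (velocity J (fun t => 𝓔 (x, t)) (f x)) < 0

end Calculus

/-- Positive definite bilinear forms. -/
def PosDefForm {V : Type*} [AddCommGroup V] [Module ℝ V] [TopologicalSpace V]
    (B : V →L[ℝ] V →L[ℝ] ℝ) : Prop :=
  (∀ v w, B v w = B w v) ∧ ∀ v, v ≠ 0 → 0 < B v v

/-- The normalised Gaussian curvature `K = Det(A)^{1/n}`, for `A` the shape operator of a
hypersurface of dimension `n`. -/
def gaussCurvature {n m : ℕ} {H : Type*} [TopologicalSpace H]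
    (I : ModelWithCorners ℝ (EuclideanSpace ℝ (Fin n)) H)
    {X : Type*} [TopologicalSpace X] [ChartedSpace H X]
    {H' : Type*} [TopologicalSpace H']
    (J : ModelWithCorners ℝ (EuclideanSpace ℝ (Fin m)) H')
    {Y : Type*} [TopologicalSpace Y] [ChartedSpace H' Y]
    (g : FormField J (X := Y)) (φ : X → Y) (ν : (x : X) → TangentSpace J (φ x)) (x : X) : ℝ :=
  (shapeOperator I J g φ ν x).det ^ ((1 : ℝ) / n)

/-- A hypersurface with unit normal `ν` is (locally strictly) convex if its second fundamental form
with respect to `ν` is positive definite at every point. -/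
def IsConvexHypersurface {E : Type*} [NormedAddCommGroup E] [NormedSpace ℝ E]
    {H : Type*} [TopologicalSpace H] (I : ModelWithCorners ℝ E H)
    {X : Type*} [TopologicalSpace X] [ChartedSpace H X]
    {E' : Type*} [NormedAddCommGroup E'] [NormedSpace ℝ E']
    {H' : Type*} [TopologicalSpace H'] (J : ModelWithCorners ℝ E' H')
    {Y : Type*} [TopologicalSpace Y] [ChartedSpace H' Y]
    (g : FormField J (X := Y)) (φ : X → Y) (ν : (x : X) → TangentSpace J (φ x)) : Prop :=
  ∀ x, PosDefForm (secondForm I J g φ ν x)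

/-- A smooth family of bilinear forms `Ψ(x, t, p)` on `T_x X`, with `p ∈ T_x X` and `(x, t) ∈ W`. -/
def SmoothFormFamily {E : Type*} [NormedAddCommGroup E] [NormedSpace ℝ E]
    {H : Type*} [TopologicalSpace H] (I : ModelWithCorners ℝ E H)
    {X : Type*} [TopologicalSpace X] [ChartedSpace H X] [IsManifold I ∞ X] (W : Set (X × ℝ))
    (Ψ : (x : X) → ℝ → TangentSpace I x →
      (TangentSpace I x →L[ℝ] TangentSpace I x →L[ℝ] ℝ)) : Prop :=
  haveI : IsManifold I 1 X := .of_le (n := ∞) (by simp)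
  ContMDiffOn (I.tangent.prod 𝓘(ℝ, ℝ)) (I.prod 𝓘(ℝ, E →L[ℝ] E →L[ℝ] ℝ)) ∞
    (fun q : TangentBundle I X × ℝ =>
      TotalSpace.mk' (E →L[ℝ] E →L[ℝ] ℝ)
        (E := fun x : X => TangentSpace I x →L[ℝ] TangentSpace I x →L[ℝ] ℝ)
        q.1.proj (Ψ q.1.proj q.2 q.1.2))
    {q | (q.1.proj, q.2) ∈ W}

/-- A smooth family of functions `ψ(x, t, p)`, with `p ∈ T_x X` and `(x, t) ∈ W`. -/
def SmoothFunFamily {E : Type*} [NormedAddCommGroup E] [NormedSpace ℝ E]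
    {H : Type*} [TopologicalSpace H] (I : ModelWithCorners ℝ E H)
    {X : Type*} [TopologicalSpace X] [ChartedSpace H X] [IsManifold I ∞ X] (W : Set (X × ℝ))
    (ψ : (x : X) → ℝ → TangentSpace I x → ℝ) : Prop :=
  haveI : IsManifold I 1 X := .of_le (n := ∞) (by simp)
  ContMDiffOn (I.tangent.prod 𝓘(ℝ, ℝ)) 𝓘(ℝ, ℝ) ∞
    (fun q : TangentBundle I X × ℝ => ψ q.1.proj q.2 q.1.2)
    {q | (q.1.proj, q.2) ∈ W}

end GaussGraph

end

noncomputable section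

namespace GaussGraph

/-!
By the Gauss lemma `𝓔` pulls `g` back to `g_t + dt²`, with `g_t` the metric of the slice
`x ↦ 𝓔(x, t)`. Write `a = 1 + |df|²` with the norm taken in `g_t` at `t = f`. The graph of `f` has
first fundamental form `g_f + df ⊗ df` and, in a chart, second fundamental form `a^(-1/2)` times

  `∂²f - Γ_f(df) + (∂_t g_f terms)`,

where `Γ_f(df)` contracts `df` with the Christoffel symbols of `g_f`. Comparison with
`Hess f = ∂²f - Γ₀(df)` leaves an expression `Ψ(x, f, ∇f)` in which `∂²f` no longer occurs; being
the difference of `a^(1/2) A_f` and `Hess f`, it is a tensor. At `t = 0` the two Christoffel terms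
cancel, and what remains is the part of `Ψ` built from `A₀`; the remainder is divisible by `t` by
Hadamard's lemma.

The matrix determinant lemma gives `det(g_f + df ⊗ df) = a det g_f`. Hence the curvature formula
holds with `ψ = det(g₀⁻¹ g_t)^(1/n) a^((n + 2) / (2n))`, where `a` is `1` plus a positive
semidefinite quadratic form in `p = ∇f`. Since the exponent is at least `1/2`, `ψ` is convex in `p`.
-/

/-! ### Positive definite forms -/

section Forms

variable {V W : Type*} [AddCommGroup V] [Module ℝ V] [TopologicalSpace V]
  [AddCommGroup W] [Module ℝ W] [TopologicalSpace W]

theorem pullForm_apply (B : W →L[ℝ] W →L[ℝ] ℝ) (L : V →L[ℝ] W) (v w : V) :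
    pullForm B L v w = B (L v) (L w) := rfl

theorem PosDefForm.pullForm {B : W →L[ℝ] W →L[ℝ] ℝ} (hB : PosDefForm B) {L : V →L[ℝ] W}
    (hL : Function.Injective L) : PosDefForm (pullForm B L) :=
  ⟨fun _ _ => hB.1 _ _, fun _ hv => hB.2 _ fun h => hv (hL (h.trans (map_zero L).symm))⟩

theorem PosDefForm.nonneg {B : V →L[ℝ] V →L[ℝ] ℝ} (hB : PosDefForm B) (v : V) : 0 ≤ B v v := by
  rcases eq_or_ne v 0 with rfl | hv
  · simp
  · exact (hB.2 v hv).le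

theorem posDefForm_smul_iff {B : V →L[ℝ] V →L[ℝ] ℝ} {c : ℝ} (hc : 0 < c) :
    PosDefForm (c • B) ↔ PosDefForm B := by
  simp only [PosDefForm, smul_apply, smul_eq_mul, mul_right_inj' hc.ne', mul_pos_iff_of_pos_left hc]

theorem PosDefForm.isSymm {B : V →L[ℝ] V →L[ℝ] ℝ} (hB : PosDefForm B) : B.toBilinForm.IsSymm :=
  ⟨hB.1⟩

theorem PosDefForm.toMatrix_posDef {ι : Type*} [Fintype ι] [DecidableEq ι]
    {B : V →L[ℝ] V →L[ℝ] ℝ} (hB : PosDefForm B) (b : Module.Basis ι ℝ V) :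
    (LinearMap.BilinForm.toMatrix b B.toBilinForm).PosDef :=
  (LinearMap.BilinForm.posDef_toQuadraticMap_iff_matrix b _ hB.isSymm).1 hB.2

theorem PosDefForm.add_smulRight {B : V →L[ℝ] V →L[ℝ] ℝ} (hB : PosDefForm B) (ℓ : V →L[ℝ] ℝ) :
    PosDefForm (B + ℓ.smulRight ℓ) := by
  refine ⟨fun v w => ?_, fun v hv => ?_⟩ <;>
    simp only [add_apply, ContinuousLinearMap.smulRight_apply, smul_apply, smul_eq_mul]
  · rw [hB.1 v w, mul_comm]
  · exact add_pos_of_pos_of_nonneg (hB.2 v hv) (mul_self_nonneg _)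

end Forms

section FiniteDimensional

variable {V : Type*} [NormedAddCommGroup V] [NormedSpace ℝ V] [FiniteDimensional ℝ V]
  {A B C : V →L[ℝ] V →L[ℝ] ℝ}

theorem PosDefForm.isInvertible (hB : PosDefForm B) : B.IsInvertible := by
  have hinj : Function.Injective B.toBilinForm :=
    (injective_iff_map_eq_zero _).2 fun v hv => by
      by_contra hne
      exact (hB.2 v hne).ne' (LinearMap.congr_fun hv v)
  exact ⟨((B.toBilinForm.linearEquivOfInjective hinj Subspace.dual_finrank_eq.symm).trans
    LinearMap.toContinuousLinearMap).toContinuousLinearEquiv, rfl⟩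

theorem PosDefForm.eq_inverse (hB : PosDefForm B) {ℓ : V →L[ℝ] ℝ} {v : V}
    (h : ∀ w, B v w = ℓ w) : v = B.inverse ℓ :=
  (hB.isInvertible.inverse_apply_eq.2 (ContinuousLinearMap.ext fun w => (h w).symm)).symm

theorem PosDefForm.inverse_symm (hB : PosDefForm B) (ℓ m : V →L[ℝ] ℝ) :
    ℓ (B.inverse m) = m (B.inverse ℓ) := by
  rw [← hB.isInvertible.self_apply_inverse ℓ, hB.1, hB.isInvertible.self_apply_inverse,
    hB.isInvertible.self_apply_inverse]

theorem det_inverse_comp_pos (hB : PosDefForm B) (hC : PosDefForm C) :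
    0 < (B.inverse ∘L C).det := by
  classical
  let b := Module.finBasis ℝ V
  have hcomp : B.toBilinForm.compLeft (B.inverse ∘L C : V →L[ℝ] V) = C.toBilinForm := by
    ext v w
    exact DFunLike.congr_fun (hB.isInvertible.self_apply_inverse (C v)) w
  have hdetC := (hC.toMatrix_posDef b).det_pos
  rw [← hcomp, LinearMap.BilinForm.toMatrix_compLeft, Matrix.det_mul, Matrix.det_transpose,
    LinearMap.det_toMatrix] at hdetC
  exact pos_of_mul_pos_left hdetC (hB.toMatrix_posDef b).det_pos.le

theorem det_inverse_comp_add_smulRight (hB : PosDefForm B) (ℓ : V →L[ℝ] ℝ) :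
    (B.inverse ∘L (B + ℓ.smulRight ℓ)).det = 1 + ℓ (B.inverse ℓ) := by
  have htransvection : ((B.inverse ∘L (B + ℓ.smulRight ℓ) : V →L[ℝ] V) : V →ₗ[ℝ] V)
      = LinearMap.transvection (ℓ : V →ₗ[ℝ] ℝ) (B.inverse ℓ) := by
    ext v
    simp [LinearMap.transvection, hB.isInvertible.inverse_apply_self]
  rw [ContinuousLinearMap.det, htransvection, LinearMap.transvection.det]
  rfl

theorem det_inverse_comp_mul_det (hB : PosDefForm B) :
    (A.inverse ∘L B).det * (B.inverse ∘L C).det = (A.inverse ∘L C).det := by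
  have hcomp : A.inverse ∘L C = (A.inverse ∘L B) ∘L (B.inverse ∘L C) := by
    ext v
    simp [hB.isInvertible.self_apply_inverse]
  rw [hcomp]
  exact (LinearMap.det_comp _ _).symm

theorem det_inverse_add_smulRight_comp (hB : PosDefForm B) (ℓ : V →L[ℝ] ℝ) :
    ((B + ℓ.smulRight ℓ).inverse ∘L C).det * ((A.inverse ∘L B).det * (1 + ℓ (B.inverse ℓ)))
      = (A.inverse ∘L C).det := by
  rw [← det_inverse_comp_add_smulRight hB, det_inverse_comp_mul_det hB, mul_comm,
    det_inverse_comp_mul_det (hB.add_smulRight ℓ)]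

theorem det_inverse_comp_smul (c : ℝ) :
    (A.inverse ∘L (c • C)).det = c ^ Module.finrank ℝ V * (A.inverse ∘L C).det := by
  rw [ContinuousLinearMap.comp_smul]
  exact LinearMap.det_smul c _

theorem inverse_pullForm_comp_pullForm {E : Type*} [NormedAddCommGroup E] [NormedSpace ℝ E]
    [FiniteDimensional ℝ E] (hB : PosDefForm B) {L : E →L[ℝ] V} (hL : Function.Bijective L)
    (v : E) : L ((pullForm B L).inverse (pullForm C L v)) = B.inverse (C (L v)) := by
  refine hB.eq_inverse fun w => ?_
  obtain ⟨w, rfl⟩ := hL.2 w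
  exact DFunLike.congr_fun ((hB.pullForm hL.1).isInvertible.self_apply_inverse (pullForm C L v)) w

theorem det_inverse_pullForm_comp_pullForm {E : Type*} [NormedAddCommGroup E] [NormedSpace ℝ E]
    [FiniteDimensional ℝ E] (hB : PosDefForm B) {L : E →L[ℝ] V} (hL : Function.Bijective L) :
    ((pullForm B L).inverse ∘L pullForm C L).det = (B.inverse ∘L C).det := by
  let e : E ≃ₗ[ℝ] V := LinearEquiv.ofBijective (L : E →ₗ[ℝ] V) hL
  rw [ContinuousLinearMap.det, ContinuousLinearMap.det,
    ← LinearMap.det_conj ((B.inverse ∘L C : V →L[ℝ] V) : V →ₗ[ℝ] V) e.symm]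
  congr 1
  ext v
  exact hL.1 ((inverse_pullForm_comp_pullForm hB hL v).trans (e.apply_symm_apply _).symm)

end FiniteDimensional

section Convexity

variable {V : Type*} [AddCommGroup V] [Module ℝ V]

theorem convexOn_sqrt_apply_self {B : LinearMap.BilinForm ℝ V} (hs : B.IsSymm)
    (hB : ∀ v, 0 ≤ B v v) : ConvexOn ℝ univ fun v => √(B v v) := by
  refine ⟨convex_univ, fun x _ y _ a b ha hb _ => Real.sqrt_le_iff.2 ⟨by positivity, ?_⟩⟩
  have hcs : B x y ≤ √(B x x) * √(B y y) := by
    rw [← Real.sqrt_mul (hB x)]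
    exact Real.le_sqrt_of_sq_le (B.apply_sq_le_of_symm hB ⟨hs.eq⟩ x y)
  have hyx : B y x = B x y := hs.eq y x
  calc B (a • x + b • y) (a • x + b • y)
      = a ^ 2 * B x x + b ^ 2 * B y y + 2 * (a * b * B x y) := by
        simp only [map_add, map_smul, LinearMap.add_apply, LinearMap.smul_apply, smul_eq_mul, hyx]
        ring
    _ ≤ a ^ 2 * B x x + b ^ 2 * B y y + 2 * (a * b * (√(B x x) * √(B y y))) := by gcongr
    _ = (a • √(B x x) + b • √(B y y)) ^ 2 := by
        rw [smul_eq_mul, smul_eq_mul, add_sq, mul_pow, mul_pow, Real.sq_sqrt (hB x),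
          Real.sq_sqrt (hB y)]
        ring

-- `1 + B p p` is the value at `(p, 1)` of a positive semidefinite form on `V × ℝ`.
theorem convexOn_sqrt_one_add_apply_self {B : LinearMap.BilinForm ℝ V} (hs : B.IsSymm)
    (hB : ∀ v, 0 ≤ B v v) : ConvexOn ℝ univ fun p => √(1 + B p p) := by
  let C : LinearMap.BilinForm ℝ (V × ℝ) :=
    LinearMap.BilinForm.comp B (LinearMap.fst ℝ V ℝ) (LinearMap.fst ℝ V ℝ)
      + LinearMap.BilinForm.comp (LinearMap.mul ℝ ℝ) (LinearMap.snd ℝ V ℝ) (LinearMap.snd ℝ V ℝ)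
  have hC : ConvexOn ℝ univ fun v => √(C v v) :=
    convexOn_sqrt_apply_self
      ⟨fun v w => congrArg₂ (· + ·) (hs.eq v.1 w.1) (mul_comm v.2 w.2)⟩
      fun v => add_nonneg (hB v.1) (mul_self_nonneg v.2)
  exact (hC.comp_affineMap ((LinearMap.inl ℝ V ℝ).toAffineMap + AffineMap.const ℝ V (0, 1))).congr
    fun p _ => by simp [C, LinearMap.BilinForm.comp_apply, add_comm]

theorem convexOn_one_add_apply_self_rpow {B : LinearMap.BilinForm ℝ V} (hs : B.IsSymm)
    (hB : ∀ v, 0 ≤ B v v) {α : ℝ} (hα : 1 / 2 ≤ α) :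
    ConvexOn ℝ univ fun p => (1 + B p p) ^ α := by
  have hsqrt := convexOn_sqrt_one_add_apply_self hs hB
  have hpow := convexOn_rpow (p := 2 * α) (by linarith)
  have heq (p : V) : (1 + B p p) ^ α = √(1 + B p p) ^ (2 * α) := by
    rw [Real.sqrt_eq_rpow, ← Real.rpow_mul (add_nonneg zero_le_one (hB p))]
    congr 1
    ring
  simp only [heq]
  refine ⟨convex_univ, fun x hx y hy a b ha hb hab => ?_⟩
  calc √(1 + B (a • x + b • y) (a • x + b • y)) ^ (2 * α)
      ≤ (a • √(1 + B x x) + b • √(1 + B y y)) ^ (2 * α) :=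
        Real.rpow_le_rpow (Real.sqrt_nonneg _) (hsqrt.2 hx hy ha hb hab) (by linarith)
    _ ≤ a • √(1 + B x x) ^ (2 * α) + b • √(1 + B y y) ^ (2 * α) :=
        hpow.2 (Real.sqrt_nonneg _) (Real.sqrt_nonneg _) ha hb hab

theorem mul_rpow_of_pos {c : ℝ} (hc : 0 < c) (y r : ℝ) : (c * y) ^ r = c ^ r * y ^ r := by
  rcases lt_trichotomy y 0 with hy | rfl | hy
  · rw [Real.rpow_def_of_neg (mul_neg_of_pos_of_neg hc hy), Real.rpow_def_of_neg hy,
      Real.rpow_def_of_pos hc, Real.log_mul hc.ne' hy.ne, add_mul, Real.exp_add]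
    ring
  · rcases eq_or_ne r 0 with rfl | hr
    · simp
    · simp [Real.zero_rpow hr]
  · exact Real.mul_rpow hc.le hy.le

end Convexity

/-! ### Parametric integrals and difference quotients, up to the boundary -/

section Parametric

open MeasureTheory Topology

universe u

section Derivative

variable {P V : Type*} [NormedAddCommGroup P] [NormedAddCommGroup V] {s : Set P} {a b : ℝ} {q : P}

theorem intervalIntegrable_of_continuousOn_uncurry {K : P → ℝ → V} (hab : a ≤ b)
    (hK : ContinuousOn K.uncurry (s ×ˢ Icc a b)) (hq : q ∈ s) :
    IntervalIntegrable (K q) volume a b :=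
  ContinuousOn.intervalIntegrable <| (uIcc_of_le hab).symm ▸
    hK.comp (f := fun σ => (q, σ)) (by fun_prop) fun _ hσ => ⟨hq, hσ⟩

variable [NormedSpace ℝ P] [NormedSpace ℝ V] {K : P → ℝ → V} {K' : P → ℝ → P →L[ℝ] V}

theorem eventually_norm_sub_sub_apply_le (hs : Convex ℝ s)
    (hK' : ContinuousOn K'.uncurry (s ×ˢ Icc a b))
    (hd : ∀ q ∈ s, ∀ σ ∈ Icc a b, HasFDerivWithinAt (fun q => K q σ) (K' q σ) s q) (hq : q ∈ s)
    {ε : ℝ} (hε : 0 < ε) :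
    ∀ᶠ q' in 𝓝[s] q, ∀ σ ∈ Icc a b, ‖K q' σ - K q σ - K' q σ (q' - q)‖ ≤ ε * ‖q' - q‖ := by
  obtain ⟨v, hv, hvK⟩ := isCompact_Icc.mem_uniformity_of_prod hK' hq (Metric.dist_mem_uniformity hε)
  obtain ⟨δ, hδ, hδv⟩ := Metric.mem_nhdsWithin_iff.1 hv
  have hball : Metric.ball q δ ∩ s ∈ 𝓝[s] q :=
    Filter.inter_mem (mem_nhdsWithin_of_mem_nhds (Metric.ball_mem_nhds q hδ)) self_mem_nhdsWithin
  filter_upwards [hball] with q' hq' σ hσ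
  refine Convex.norm_image_sub_le_of_norm_hasFDerivWithin_le' (s := Metric.ball q δ ∩ s)
    (f' := fun q => K' q σ) (fun p hp => (hd p hp.2 σ hσ).mono inter_subset_right)
    (fun p hp => ?_) ((convex_ball q δ).inter hs) ⟨Metric.mem_ball_self hδ, hq⟩ hq'
  rw [← dist_eq_norm]
  exact (hvK p (hδv hp) σ hσ).le

theorem hasFDerivWithinAt_parametric_integral (hab : a ≤ b) (hs : Convex ℝ s)
    (hK : ContinuousOn K.uncurry (s ×ˢ Icc a b)) (hK' : ContinuousOn K'.uncurry (s ×ˢ Icc a b))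
    (hd : ∀ q ∈ s, ∀ σ ∈ Icc a b, HasFDerivWithinAt (fun q => K q σ) (K' q σ) s q) (hq : q ∈ s) :
    HasFDerivWithinAt (fun q => ∫ σ in a..b, K q σ) (∫ σ in a..b, K' q σ) s q := by
  have hKi (q') (hq' : q' ∈ s) := intervalIntegrable_of_continuousOn_uncurry hab hK hq'
  have hKi' : IntervalIntegrable (K' q) volume a b :=
    intervalIntegrable_of_continuousOn_uncurry hab hK' hq
  have happ (u : P) : IntervalIntegrable (fun σ => K' q σ u) volume a b :=
    intervalIntegrable_of_continuousOn_uncurry (K := fun q σ => K' q σ u) hab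
      (hK'.clm_apply continuousOn_const) hq
  rw [hasFDerivWithinAt_iff_isLittleO, Asymptotics.isLittleO_iff]
  intro ε hε
  filter_upwards [self_mem_nhdsWithin, eventually_norm_sub_sub_apply_le hs hK' hd hq
    (ε := ε / (|b - a| + 1)) (by positivity)] with q' hq' hle
  rw [ContinuousLinearMap.intervalIntegral_apply hKi',
    ← intervalIntegral.integral_sub (hKi q' hq') (hKi q hq),
    ← intervalIntegral.integral_sub ((hKi q' hq').sub (hKi q hq)) (happ _)]
  calc ‖∫ σ in a..b, K q' σ - K q σ - K' q σ (q' - q)‖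
      ≤ ε / (|b - a| + 1) * ‖q' - q‖ * |b - a| :=
        intervalIntegral.norm_integral_le_of_norm_le_const fun σ hσ =>
          hle σ (Ioc_subset_Icc_self ((uIoc_of_le hab) ▸ hσ))
    _ = ε * ‖q' - q‖ * (|b - a| / (|b - a| + 1)) := by ring
    _ ≤ ε * ‖q' - q‖ := mul_le_of_le_one_right (by positivity)
        ((div_le_one (by positivity)).2 (by linarith))

theorem exists_hasFDerivWithinAt_parametric_integral (hab : a < b) (hs : Convex ℝ s)
    (hu : UniqueDiffOn ℝ s) {K : P × ℝ → V} (hK : ContDiffOn ℝ ∞ K (s ×ˢ Icc a b)) :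
    ∃ K' : P × ℝ → P →L[ℝ] V, ContDiffOn ℝ ∞ K' (s ×ˢ Icc a b) ∧ ∀ q ∈ s,
      HasFDerivWithinAt (fun q => ∫ σ in a..b, K (q, σ)) (∫ σ in a..b, K' (q, σ)) s q := by
  let K' := fun r => fderivWithin ℝ K (s ×ˢ Icc a b) r ∘L ContinuousLinearMap.inl ℝ P ℝ
  have hK' : ContDiffOn ℝ ∞ K' (s ×ˢ Icc a b) :=
    (hK.fderivWithin (hu.prod (uniqueDiffOn_Icc hab)) (by simp)).clm_comp contDiffOn_const
  refine ⟨K', hK', fun q hq => hasFDerivWithinAt_parametric_integral hab.le hs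
    (K := fun q σ => K (q, σ)) (K' := fun q σ => K' (q, σ)) hK.continuousOn hK'.continuousOn
    (fun p hp σ hσ => ?_) hq⟩
  have hmaps : MapsTo (fun p => (p, σ)) s (s ×ˢ Icc a b) := fun _ hp' => ⟨hp', hσ⟩
  exact ((hK.differentiableOn (by simp)) (p, σ) ⟨hp, hσ⟩).hasFDerivWithinAt.comp p
    (hasFDerivAt_prodMk_left p σ).hasFDerivWithinAt hmaps

end Derivative

variable {P V : Type u} [NormedAddCommGroup P] [NormedSpace ℝ P] [NormedAddCommGroup V]
  [NormedSpace ℝ V] {s : Set P}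

theorem contDiffOn_parametric_integral (hs : Convex ℝ s) (hu : UniqueDiffOn ℝ s) {a b : ℝ}
    (hab : a < b) {K : P × ℝ → V} (hK : ContDiffOn ℝ ∞ K (s ×ˢ Icc a b)) :
    ContDiffOn ℝ ∞ (fun q => ∫ σ in a..b, K (q, σ)) s := by
  refine contDiffOn_infty.2 fun m => ?_
  induction m generalizing V with
  | zero =>
    obtain ⟨K', -, h⟩ := exists_hasFDerivWithinAt_parametric_integral hab hs hu hK
    exact contDiffOn_zero.2 fun q hq => (h q hq).continuousWithinAt
  | succ m ih =>
    obtain ⟨K', hK', h⟩ := exists_hasFDerivWithinAt_parametric_integral hab hs hu hK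
    rw [Nat.cast_succ, contDiffOn_succ_iff_hasFDerivWithinAt_of_uniqueDiffOn hu]
    exact ⟨fun h => by simp at h, _, ih hK', h⟩

variable {T : Set ℝ} {F : P × ℝ → V}

theorem hasDerivAt_slice (hT : IsOpen T) (hF : DifferentiableOn ℝ F (s ×ˢ T)) {p : P} (hp : p ∈ s)
    {t : ℝ} (ht : t ∈ T) :
    HasDerivAt (fun t => F (p, t)) (fderivWithin ℝ F (s ×ˢ T) (p, t) (0, 1)) t := by
  have hslice := (hF (p, t) ⟨hp, ht⟩).hasFDerivWithinAt.comp t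
    ((hasFDerivAt_prodMk_right p t).hasFDerivWithinAt (s := T)) fun _ ht' => ⟨hp, ht'⟩
  simpa using! (hslice.hasFDerivAt (hT.mem_nhds ht)).hasDerivAt

variable [CompleteSpace V]

theorem dslope_zero_eq_integral {f f' : ℝ → V} {t : ℝ}
    (hf' : ContinuousOn (fun σ : ℝ => f' (σ * t)) (Icc 0 1))
    (hf : ∀ σ ∈ Icc (0 : ℝ) 1, HasDerivAt f (f' (σ * t)) (σ * t)) :
    dslope f 0 t = ∫ σ in (0 : ℝ)..1, f' (σ * t) := by
  rcases eq_or_ne t 0 with rfl | ht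
  · simpa using (hf 0 (by simp)).deriv
  · have hFTC : t • ∫ σ in (0 : ℝ)..1, f' (σ * t) = f t - f 0 := by
      simpa using intervalIntegral.integral_unitInterval_deriv_eq_sub (f := f) (f' := f')
        (z₀ := 0) (z₁ := t) (by simpa using hf') (by simpa using hf)
    rw [dslope_of_ne _ ht, slope_def_module, sub_zero, ← hFTC, inv_smul_smul₀ ht]

theorem contDiffOn_dslope_zero (hs : Convex ℝ s) (hu : UniqueDiffOn ℝ s) (hT : IsOpen T)
    (hTc : Convex ℝ T) (hT₀ : 0 ∈ T) (hF : ContDiffOn ℝ ∞ F (s ×ˢ T)) :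
    ContDiffOn ℝ ∞ (fun r : P × ℝ => dslope (fun t => F (r.1, t)) 0 r.2) (s ×ˢ T) := by
  have hu' : UniqueDiffOn ℝ (s ×ˢ T) := hu.prod hT.uniqueDiffOn
  let F' : P × ℝ → V := fun r => fderivWithin ℝ F (s ×ˢ T) r (0, 1)
  have hF' : ContDiffOn ℝ ∞ F' (s ×ˢ T) :=
    (hF.fderivWithin hu' (by simp)).clm_apply contDiffOn_const
  have hmul {t : ℝ} (ht : t ∈ T) {σ : ℝ} (hσ : σ ∈ Icc (0 : ℝ) 1) : σ * t ∈ T :=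
    hTc.smul_mem_of_zero_mem hT₀ ht hσ
  have hint : ContDiffOn ℝ ∞ (fun r : P × ℝ => ∫ σ in (0 : ℝ)..1, F' (r.1, σ * r.2)) (s ×ˢ T) :=
    contDiffOn_parametric_integral (hs.prod hTc) hu' zero_lt_one
      (K := fun r : (P × ℝ) × ℝ => F' (r.1.1, r.2 * r.1.2)) <|
      hF'.comp (f := fun r : (P × ℝ) × ℝ => (r.1.1, r.2 * r.1.2)) (by fun_prop)
        fun r hr => ⟨hr.1.1, hmul hr.1.2 hr.2⟩
  refine hint.congr fun r hr => dslope_zero_eq_integral (f' := fun t => F' (r.1, t)) ?_ fun σ hσ =>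
    hasDerivAt_slice hT (hF.differentiableOn (by simp)) hr.1 (hmul hr.2 hσ)
  exact hF'.continuousOn.comp (f := fun σ : ℝ => (r.1, σ * r.2)) (by fun_prop)
    fun σ hσ => ⟨hr.1, hmul hr.2 hσ⟩

end Parametric

section Division

open Topology

universe u

variable {P V : Type u} [NormedAddCommGroup P] [NormedSpace ℝ P] [NormedAddCommGroup V]
  [NormedSpace ℝ V] {F : P × ℝ → V}

theorem contDiffWithinAt_dslope_zero_of_ne {n : WithTop ℕ∞} {D : Set (P × ℝ)} {r : P × ℝ}
    (hr : r.2 ≠ 0) (hF : ContDiffWithinAt ℝ n F D r)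
    (hF₀ : ContDiffWithinAt ℝ n (fun q => F (q.1, 0)) D r) :
    ContDiffWithinAt ℝ n (fun q : P × ℝ => dslope (fun t => F (q.1, t)) 0 q.2) D r := by
  have hslope : ∀ q : P × ℝ, q.2 ≠ 0 →
      dslope (fun t => F (q.1, t)) 0 q.2 = q.2⁻¹ • (F q - F (q.1, 0)) := fun q hq => by
    rw [dslope_of_ne _ hq, slope_def_module, sub_zero]
  have hne : ∀ᶠ q : P × ℝ in 𝓝[D] r, q.2 ≠ 0 :=
    mem_nhdsWithin_of_mem_nhds (continuousAt_snd.eventually_ne hr)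
  exact ((contDiffWithinAt_snd.inv hr).smul (hF.sub hF₀)).congr_of_eventuallyEq
    (hne.mono hslope) (hslope r hr)

theorem contDiffOn_dslope_zero_of_relOpen [CompleteSpace V] {K : Set P} (hK : Convex ℝ K)
    (hu : UniqueDiffOn ℝ K) {D : Set (P × ℝ)} (hDK : D ⊆ K ×ˢ univ)
    (hD : ∀ q ∈ D, D ∈ 𝓝[K ×ˢ univ] q) (hD₀ : ∀ q ∈ D, (q.1, 0) ∈ D) (hF : ContDiffOn ℝ ∞ F D) :
    ContDiffOn ℝ ∞ (fun q : P × ℝ => dslope (fun t => F (q.1, t)) 0 q.2) D := by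
  rintro ⟨z, t⟩ hq
  rcases eq_or_ne t 0 with rfl | ht
  · obtain ⟨ε, hε, hball⟩ := Metric.mem_nhdsWithin_iff.1 (hD _ hq)
    have hsub : (K ∩ Metric.ball z ε) ×ˢ Metric.ball (0 : ℝ) ε ⊆ D := fun q hq =>
      hball ⟨by rw [← ball_prod_same]; exact ⟨hq.1.2, hq.2⟩, hq.1.1, mem_univ _⟩
    have hdslope := contDiffOn_dslope_zero (hK.inter (convex_ball z ε))
      (hu.inter Metric.isOpen_ball) Metric.isOpen_ball (convex_ball 0 ε) (Metric.mem_ball_self hε)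
      (hF.mono hsub)
    refine (hdslope (z, 0) ⟨⟨(hDK hq).1, Metric.mem_ball_self hε⟩,
      Metric.mem_ball_self hε⟩).mono_of_mem_nhdsWithin ?_
    filter_upwards [mem_nhdsWithin_of_mem_nhds (Metric.ball_mem_nhds (z, (0 : ℝ)) hε),
      self_mem_nhdsWithin] with q hqε hqD
    rw [← ball_prod_same] at hqε
    exact ⟨⟨(hDK hqD).1, hqε.1⟩, hqε.2⟩
  · exact contDiffWithinAt_dslope_zero_of_ne ht (hF _ hq)
      (hF.comp (f := fun q : P × ℝ => (q.1, (0 : ℝ))) (by fun_prop) hD₀ _ hq)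

end Division

/-! ### Induced metrics in coordinates -/

section Pullback

variable {Z V W : Type*} [NormedAddCommGroup Z] [NormedSpace ℝ Z]
  [NormedAddCommGroup V] [NormedSpace ℝ V] [NormedAddCommGroup W] [NormedSpace ℝ W]

theorem pullForm_eq_compL (B : W →L[ℝ] W →L[ℝ] ℝ) (L : V →L[ℝ] W) :
    pullForm B L = ((ContinuousLinearMap.compL ℝ V W ℝ).flip L) ∘L (B ∘L L) := rfl

section Derivative

variable {B : Z → W →L[ℝ] W →L[ℝ] ℝ} {L : Z → V →L[ℝ] W} {s : Set Z} {a : Z}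

theorem contDiffWithinAt_pullForm {n : ℕ∞ω} (hB : ContDiffWithinAt ℝ n B s a)
    (hL : ContDiffWithinAt ℝ n L s a) :
    ContDiffWithinAt ℝ n (fun z => pullForm (B z) (L z)) s a := by
  simp only [pullForm_eq_compL]
  exact (contDiffWithinAt_const.clm_apply hL).clm_comp (hB.clm_comp hL)

theorem differentiableWithinAt_pullForm (hB : DifferentiableWithinAt ℝ B s a)
    (hL : DifferentiableWithinAt ℝ L s a) :
    DifferentiableWithinAt ℝ (fun z => pullForm (B z) (L z)) s a := by
  simp only [pullForm_eq_compL]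
  exact ((differentiableWithinAt_const _).clm_apply hL).clm_comp (hB.clm_comp hL)

theorem fderivWithin_apply_apply (hu : UniqueDiffWithinAt ℝ s a)
    (hB : DifferentiableWithinAt ℝ B s a) (u : Z) (v w : W) :
    fderivWithin ℝ (fun z => B z v w) s a u = fderivWithin ℝ B s a u v w := by
  rw [((hB.hasFDerivWithinAt.clm_apply (hasFDerivWithinAt_const v a s)).clm_apply
    (hasFDerivWithinAt_const w a s)).fderivWithin hu]
  simp

theorem fderivWithin_pullForm (hu : UniqueDiffWithinAt ℝ s a)
    {B' : Z →L[ℝ] W →L[ℝ] W →L[ℝ] ℝ} {L' : Z →L[ℝ] V →L[ℝ] W}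
    (hB : HasFDerivWithinAt B B' s a) (hL : HasFDerivWithinAt L L' s a) (u : Z) (v w : V) :
    fderivWithin ℝ (fun z => pullForm (B z) (L z)) s a u v w
      = B' u (L a v) (L a w) + B a (L' u v) (L a w) + B a (L a v) (L' u w) := by
  rw [← fderivWithin_apply_apply hu
    (differentiableWithinAt_pullForm hB.differentiableWithinAt hL.differentiableWithinAt)]
  simp only [pullForm_apply]
  rw [((hB.clm_apply (hL.clm_apply (hasFDerivWithinAt_const v a s))).clm_apply
    (hL.clm_apply (hasFDerivWithinAt_const w a s))).fderivWithin hu]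
  simp
  ring

end Derivative

/-- The Christoffel combination of a trilinear form. For the derivative of a metric it gives the
Christoffel symbols of the first kind. -/
def koszul (D : V →L[ℝ] V →L[ℝ] V →L[ℝ] ℝ) (u v w : V) : ℝ :=
  (D u v w + D v u w - D w u v) / 2

theorem koszul_pull {D : V →L[ℝ] V →L[ℝ] V →L[ℝ] ℝ} {D₀ : W →L[ℝ] W →L[ℝ] W →L[ℝ] ℝ}
    {B : W →L[ℝ] W →L[ℝ] ℝ} (hB : ∀ v w, B v w = B w v) {L : V →L[ℝ] W}
    {S : V →L[ℝ] V →L[ℝ] W} (hS : ∀ v w, S v w = S w v)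
    (hD : ∀ u v w, D u v w
      = D₀ (L u) (L v) (L w) + B (S u v) (L w) + B (L v) (S u w)) (u v w : V) :
    koszul D u v w = koszul D₀ (L u) (L v) (L w) + B (S u v) (L w) := by
  simp only [koszul, hD]
  rw [hS v u, hS w u, hS w v, hB (L v) (S u w), hB (L u) (S v w)]
  ring

theorem koszul_add_koszul {D : V →L[ℝ] V →L[ℝ] V →L[ℝ] ℝ} (hD : ∀ u v w, D u v w = D u w v)
    (u v w : V) : koszul D u v w + koszul D u w v = D u v w := by
  simp only [koszul]
  rw [hD v u w, hD w u v, hD u w v]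
  ring

end Pullback

section Induced

open Topology

variable {Z V V' : Type*} [NormedAddCommGroup Z] [NormedSpace ℝ Z]
  [NormedAddCommGroup V] [NormedSpace ℝ V] [NormedAddCommGroup V'] [NormedSpace ℝ V']
  {s : Set Z} {c : Z} {t : Set V}

theorem fderiv_symm {G : V → V →L[ℝ] V →L[ℝ] ℝ} {y : V} (hG : DifferentiableAt ℝ G y)
    (hGs : ∀ᶠ y' in 𝓝 y, ∀ v w, G y' v w = G y' w v) (u v w : V) :
    fderiv ℝ G y u v w = fderiv ℝ G y u w v := by
  have hsymm : (fun z => G z v w) =ᶠ[𝓝 y] fun z => G z w v := hGs.mono fun z hz => hz v w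
  simp only [← fderivWithin_univ]
  rw [← fderivWithin_apply_apply uniqueDiffWithinAt_univ hG.differentiableWithinAt,
    ← fderivWithin_apply_apply uniqueDiffWithinAt_univ hG.differentiableWithinAt,
    fderivWithin_univ, fderivWithin_univ, hsymm.fderiv_eq]

theorem hasFDerivWithinAt_fderivWithin {F : V → V'} (ht : UniqueDiffOn ℝ t) {y : V} (hy : y ∈ t)
    (hF : ContDiffWithinAt ℝ 2 F t y) :
    HasFDerivWithinAt (fderivWithin ℝ F t) (fderivWithin ℝ (fderivWithin ℝ F t) t y) t y :=
  ((hF.fderivWithin_right ht (m := 1) (by norm_cast) hy).differentiableWithinAt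
    (by simp)).hasFDerivWithinAt

theorem eventually_differentiableWithinAt {F : V → V'} {y : V} (hy : y ∈ t)
    (hF : ContDiffWithinAt ℝ 2 F t y) : ∀ᶠ z in 𝓝[t] y, DifferentiableWithinAt ℝ F t z := by
  have h := (hF.of_le (m := 1) (by norm_cast)).eventually (by simp)
  rw [insert_eq_of_mem hy] at h
  exact h.mono fun z hz => hz.differentiableWithinAt (by simp)

theorem fderivWithin_fderivWithin_comp (hs : UniqueDiffOn ℝ s) (ht : UniqueDiffOn ℝ t)
    (hc : c ∈ s) {γ : Z → V} (hγt : MapsTo γ s t) (hγ : ContDiffWithinAt ℝ 2 γ s c)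
    {F : V → V'} (hF : ContDiffWithinAt ℝ 2 F t (γ c)) (v w : Z) :
    fderivWithin ℝ (fderivWithin ℝ (F ∘ γ) s) s c v w
      = fderivWithin ℝ (fderivWithin ℝ F t) t (γ c) (fderivWithin ℝ γ s c v)
          (fderivWithin ℝ γ s c w)
        + fderivWithin ℝ F t (γ c) (fderivWithin ℝ (fderivWithin ℝ γ s) s c v w) := by
  have chain : ∀ᶠ z in 𝓝[s] c, fderivWithin ℝ (F ∘ γ) s z
      = fderivWithin ℝ F t (γ z) ∘L fderivWithin ℝ γ s z := by
    have hFγ := (hγ.continuousWithinAt.tendsto_nhdsWithin hγt).eventually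
      (eventually_differentiableWithinAt (hγt hc) hF)
    filter_upwards [eventually_differentiableWithinAt hc hγ, hFγ, self_mem_nhdsWithin]
      with z h1 h2 hz using fderivWithin_comp z h2 h1 hγt (hs z hz)
  rw [Filter.EventuallyEq.fderivWithin_eq chain (chain.self_of_nhdsWithin hc)]
  have hγ' := (hγ.differentiableWithinAt (by simp)).hasFDerivWithinAt
  have h := (((hasFDerivWithinAt_fderivWithin ht (hγt hc) hF).comp c hγ' hγt).clm_comp
    (hasFDerivWithinAt_fderivWithin hs hc hγ)).fderivWithin (hs c hc)
  simp only [Function.comp_def] at h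
  rw [h]
  simp [add_comm]

variable {G : V → V →L[ℝ] V →L[ℝ] ℝ} {F : Z → V} {Γ : V →L[ℝ] V →L[ℝ] V}

theorem koszul_induced (hs : UniqueDiffOn ℝ s) (hs' : s ⊆ closure (interior s)) (hc : c ∈ s)
    (hF : ContDiffWithinAt ℝ 2 F s c) (hG : DifferentiableAt ℝ G (F c))
    (hGs : ∀ v w, G (F c) v w = G (F c) w v)
    (hΓ : ∀ u v w, G (F c) (Γ u v) w = koszul (fderiv ℝ G (F c)) u v w) (u v w : Z) :
    koszul (fderivWithin ℝ (fun z => pullForm (G (F z)) (fderivWithin ℝ F s z)) s c) u v w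
      = G (F c) (fderivWithin ℝ (fderivWithin ℝ F s) s c u v
          + Γ (fderivWithin ℝ F s c u) (fderivWithin ℝ F s c v)) (fderivWithin ℝ F s c w) := by
  have hGF : HasFDerivWithinAt (fun z => G (F z))
      (fderiv ℝ G (F c) ∘L fderivWithin ℝ F s c) s c :=
    hG.hasFDerivAt.comp_hasFDerivWithinAt c
      (hF.differentiableWithinAt (by simp)).hasFDerivWithinAt
  have hsym : IsSymmSndFDerivWithinAt ℝ F s c :=
    hF.isSymmSndFDerivWithinAt (by simp) hs (hs' hc) hc
  rw [koszul_pull (D₀ := fderiv ℝ G (F c)) hGs (fun v w => hsym v w) fun u v w =>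
      fderivWithin_pullForm (hs c hc) hGF (hasFDerivWithinAt_fderivWithin hs hc hF) u v w,
    map_add, add_apply, hΓ]
  ring

/-- The Weingarten equation: differentiate `G(N, F' w) = 0`. -/
theorem weingarten (hs : UniqueDiffOn ℝ s) (hc : c ∈ s) (hF : ContDiffWithinAt ℝ 2 F s c)
    (hG : DifferentiableAt ℝ G (F c)) (hGs : ∀ᶠ y in 𝓝 (F c), ∀ v w, G y v w = G y w v)
    (hΓ : ∀ u v w, G (F c) (Γ u v) w = koszul (fderiv ℝ G (F c)) u v w)
    {N : Z → V} (hN : DifferentiableWithinAt ℝ N s c)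
    (hNormal : ∀ᶠ z in 𝓝[s] c, ∀ w, G (F z) (N z) (fderivWithin ℝ F s z w) = 0) (v w : Z) :
    G (F c) (fderivWithin ℝ N s c v + Γ (fderivWithin ℝ F s c v) (N c)) (fderivWithin ℝ F s c w)
      = -G (F c) (fderivWithin ℝ (fderivWithin ℝ F s) s c v w
          + Γ (fderivWithin ℝ F s c v) (fderivWithin ℝ F s c w)) (N c) := by
  have orthogonal : (fun z => G (F z) (N z) (fderivWithin ℝ F s z w)) =ᶠ[𝓝[s] c] fun _ => 0 :=
    hNormal.mono fun z hz => hz w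
  have hGF : HasFDerivWithinAt (fun z => G (F z))
      (fderiv ℝ G (F c) ∘L fderivWithin ℝ F s c) s c :=
    hG.hasFDerivAt.comp_hasFDerivWithinAt c
      (hF.differentiableWithinAt (by simp)).hasFDerivWithinAt
  have derivative := ((hGF.clm_apply hN.hasFDerivWithinAt).clm_apply
    ((hasFDerivWithinAt_fderivWithin hs hc hF).clm_apply
      (hasFDerivWithinAt_const w c s))).fderivWithin (hs c hc)
  rw [orthogonal.fderivWithin_eq (orthogonal.self_of_nhdsWithin hc)] at derivative
  have hv := congrArg (fun T : Z →L[ℝ] ℝ => T v) derivative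
  have compatible := koszul_add_koszul (fderiv_symm hG hGs) (fderivWithin ℝ F s c v) (N c)
    (fderivWithin ℝ F s c w)
  rw [← hΓ, ← hΓ] at compatible
  simp only [fderivWithin_fun_const, Pi.zero_apply, zero_apply, ContinuousLinearMap.comp_zero,
    zero_add, ContinuousLinearMap.flip_add, add_apply, ContinuousLinearMap.comp_apply,
    ContinuousLinearMap.flip_apply] at hv
  rw [map_add, map_add, add_apply, add_apply,
    hGs.self_of_nhds (fderivWithin ℝ (fderivWithin ℝ F s) s c v w)]
  linarith

end Induced

/-! ### Fermi coordinates -/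

section Fermi

open Topology

variable {E V : Type*} [NormedAddCommGroup E] [NormedSpace ℝ E]
  [NormedAddCommGroup V] [NormedSpace ℝ V] {D : Set E}

theorem prod_univ_subset_closure_interior {E : Type*} [TopologicalSpace E] {D : Set E}
    (hD : D ⊆ closure (interior D)) :
    D ×ˢ (univ : Set ℝ) ⊆ closure (interior (D ×ˢ (univ : Set ℝ))) := by
  rw [interior_prod_eq, closure_prod_eq]
  exact prod_mono hD (by simp)

theorem fderivWithin_fermi {s : Set (E × ℝ)} (hs : UniqueDiffOn ℝ s) {c : E × ℝ} (hc : c ∈ s)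
    {H : E × ℝ → (E × ℝ) →L[ℝ] (E × ℝ) →L[ℝ] ℝ} {Q : E × ℝ → E →L[ℝ] E →L[ℝ] ℝ}
    (hQ : DifferentiableWithinAt ℝ Q s c) (hH : DifferentiableWithinAt ℝ H s c)
    (h : ∀ᶠ q in 𝓝[s] c, ∀ V W, H q V W = Q q V.1 W.1 + V.2 * W.2) (U V W : E × ℝ) :
    fderivWithin ℝ H s c U V W = fderivWithin ℝ Q s c U V.1 W.1 := by
  have hu := hs c hc
  rw [← fderivWithin_apply_apply hu hH, ← fderivWithin_apply_apply hu hQ]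
  have ev : (fun q => H q V W) =ᶠ[𝓝[s] c] fun q => Q q V.1 W.1 + V.2 * W.2 :=
    h.mono fun q hq => hq V W
  rw [ev.fderivWithin_eq (ev.self_of_nhdsWithin hc), fderivWithin_add_const]

theorem koszul_fermi {T : (E × ℝ) →L[ℝ] (E × ℝ) →L[ℝ] (E × ℝ) →L[ℝ] ℝ}
    {DQ : (E × ℝ) →L[ℝ] E →L[ℝ] E →L[ℝ] ℝ} (h : ∀ U V W, T U V W = DQ U V.1 W.1)
    (v w p : E) (β γ α : ℝ) :
    koszul T (v, β) (w, γ) (p, α)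
      = koszul (DQ ∘L ContinuousLinearMap.inl ℝ E ℝ) v w p
        + (β * DQ (0, 1) w p + γ * DQ (0, 1) v p - α * DQ (0, 1) v w) / 2 := by
  have hsplit : ∀ (u : E) (r : ℝ), DQ (u, r) = DQ (u, 0) + r • DQ (0, 1) := fun u r => by
    rw [← map_smul, ← map_add]
    simp
  simp only [koszul, h, hsplit v β, hsplit w γ, hsplit p α, add_apply, smul_apply, smul_eq_mul,
    ContinuousLinearMap.comp_apply, ContinuousLinearMap.inl_apply]
  ring

variable {a : E} {f : E → ℝ}

theorem hasFDerivWithinAt_prodMk_self {f' : E →L[ℝ] ℝ} (hf : HasFDerivWithinAt f f' D a) :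
    HasFDerivWithinAt (fun z => (z, f z)) ((ContinuousLinearMap.id ℝ E).prod f') D a :=
  (hasFDerivWithinAt_id a D).prodMk hf

theorem fderivWithin_fderivWithin_prodMk_self (hD : UniqueDiffOn ℝ D) (ha : a ∈ D)
    (hf : ContDiffWithinAt ℝ 2 f D a) (v w : E) :
    fderivWithin ℝ (fderivWithin ℝ (fun z => (z, f z)) D) D a v w
      = (0, fderivWithin ℝ (fderivWithin ℝ f D) D a v w) := by
  let inr := ContinuousLinearMap.compL ℝ E ℝ (E × ℝ) (ContinuousLinearMap.inr ℝ E ℝ)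
  have hderiv : fderivWithin ℝ (fun z => (z, f z)) D =ᶠ[𝓝[D] a]
      fun z => ContinuousLinearMap.inl ℝ E ℝ + inr (fderivWithin ℝ f D z) := by
    filter_upwards [eventually_differentiableWithinAt ha hf, self_mem_nhdsWithin] with z h hz
    rw [(hasFDerivWithinAt_prodMk_self h.hasFDerivWithinAt).fderivWithin (hD z hz)]
    ext <;> simp [inr]
  have hinr := (inr.hasFDerivAt.comp_hasFDerivWithinAt a
    (hasFDerivWithinAt_fderivWithin hD ha hf)).const_add (ContinuousLinearMap.inl ℝ E ℝ)
  rw [hderiv.fderivWithin_eq (hderiv.self_of_nhdsWithin ha)]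
  exact congrArg (fun T => T v w) (hinr.fderivWithin (hD a ha))

theorem secondForm_fermi (hD : UniqueDiffOn ℝ D) (hD' : D ⊆ closure (interior D))
    (ha : a ∈ D) {F : E × ℝ → V} {G : V → V →L[ℝ] V →L[ℝ] ℝ} {Q : E × ℝ → E →L[ℝ] E →L[ℝ] ℝ}
    (hf : ContDiffWithinAt ℝ 2 f D a)
    (hF : ContDiffWithinAt ℝ 2 F (D ×ˢ (univ : Set ℝ)) (a, f a))
    (hG : DifferentiableAt ℝ G (F (a, f a)))
    (hGs : ∀ᶠ y in 𝓝 (F (a, f a)), ∀ v w, G y v w = G y w v) {Γ : V →L[ℝ] V →L[ℝ] V}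
    (hΓ : ∀ u v w, G (F (a, f a)) (Γ u v) w = koszul (fderiv ℝ G (F (a, f a))) u v w)
    (hQ : DifferentiableWithinAt ℝ Q (D ×ˢ univ) (a, f a))
    (hfermi : ∀ᶠ q in 𝓝[D ×ˢ univ] (a, f a), ∀ V W : E × ℝ,
      pullForm (G (F q)) (fderivWithin ℝ F (D ×ˢ univ) q) V W = Q q V.1 W.1 + V.2 * W.2)
    {N : E → V} (hN : DifferentiableWithinAt ℝ N D a)
    (hNormal : ∀ᶠ z in 𝓝[D] a, ∀ w,
      G (F (z, f z)) (N z) (fderivWithin ℝ (fun z => F (z, f z)) D z w) = 0)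
    {p : E} {α : ℝ} (hNa : N a = fderivWithin ℝ F (D ×ˢ univ) (a, f a) (α • (p, -1))) (v w : E) :
    G (F (a, f a)) (fderivWithin ℝ N D a v
        + Γ (fderivWithin ℝ (fun z => F (z, f z)) D a v) (N a))
        (fderivWithin ℝ (fun z => F (z, f z)) D a w)
      = α * (fderivWithin ℝ (fderivWithin ℝ f D) D a v w
        - koszul (fderivWithin ℝ Q (D ×ˢ univ) (a, f a) ∘L ContinuousLinearMap.inl ℝ E ℝ) v w p
        - (fderivWithin ℝ Q (D ×ˢ univ) (a, f a) (0, 1) v w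
          + fderivWithin ℝ f D a v * fderivWithin ℝ Q (D ×ˢ univ) (a, f a) (0, 1) w p
          + fderivWithin ℝ f D a w * fderivWithin ℝ Q (D ×ˢ univ) (a, f a) (0, 1) v p) / 2) := by
  set γ : E → E × ℝ := fun z => (z, f z)
  have hc : γ a ∈ D ×ˢ (univ : Set ℝ) := ⟨ha, mem_univ _⟩
  have hs := hD.prod (uniqueDiffOn_univ (𝕜 := ℝ) (E := ℝ))
  have hγt : MapsTo γ D (D ×ˢ (univ : Set ℝ)) := fun z hz => ⟨hz, mem_univ _⟩
  have hγ : ContDiffWithinAt ℝ 2 γ D a := contDiffWithinAt_id.prodMk hf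
  have hγ' := (hasFDerivWithinAt_prodMk_self
    (hf.differentiableWithinAt (by simp)).hasFDerivWithinAt).fderivWithin (hD a ha)
  have hFγ := fderivWithin_comp a (hF.differentiableWithinAt (by simp))
    (hγ.differentiableWithinAt (by simp)) hγt (hD a ha)
  have hH : DifferentiableWithinAt ℝ
      (fun q => pullForm (G (F q)) (fderivWithin ℝ F (D ×ˢ univ) q)) (D ×ˢ univ) (γ a) :=
    differentiableWithinAt_pullForm
      (hG.comp_differentiableWithinAt _ (hF.differentiableWithinAt (by simp)))
      (hasFDerivWithinAt_fderivWithin hs hc hF).differentiableWithinAt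
  have hkoszul := koszul_induced hs (prod_univ_subset_closure_interior hD') hc hF hG
    hGs.self_of_nhds hΓ (v, fderivWithin ℝ f D a v) (w, fderivWithin ℝ f D a w) (p, -1)
  rw [koszul_fermi (fderivWithin_fermi hs hc hQ hH hfermi)] at hkoszul
  have hvertical := hfermi.self_of_nhdsWithin hc
    (0, fderivWithin ℝ (fderivWithin ℝ f D) D a v w) (p, -1)
  rw [pullForm_apply, map_zero, zero_apply, zero_add] at hvertical
  change G ((F ∘ γ) a) (_ + Γ (fderivWithin ℝ (F ∘ γ) D a v) _) (fderivWithin ℝ (F ∘ γ) D a w) = _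
  rw [weingarten hD ha (hF.comp a hγ hγt) hG hGs hΓ hN hNormal,
    fderivWithin_fderivWithin_comp hD hs ha hγt hγ hF,
    fderivWithin_fderivWithin_prodMk_self hD ha hf, hFγ, hγ', hNa, map_smul, map_smul,
    add_right_comm, map_add, add_apply]
  refine (congrArg (fun r => -(α * r)) (congrArg₂ (· + ·) hkoszul.symm hvertical)).trans ?_
  ring

end Fermi

section GraphForm

variable {E : Type*} [NormedAddCommGroup E] [NormedSpace ℝ E]

/-- The bilinear form `(v, w) ↦ koszul D v w p`, assembled from continuous linear operations so that
it depends smoothly on `D` and `p`. -/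
def koszulForm (D : E →L[ℝ] E →L[ℝ] E →L[ℝ] ℝ) (p : E) : E →L[ℝ] E →L[ℝ] ℝ :=
  let T : E →L[ℝ] E →L[ℝ] ℝ :=
    (ContinuousLinearMap.compL ℝ E (E →L[ℝ] ℝ) ℝ (ContinuousLinearMap.apply ℝ ℝ p)) ∘L D
  (2⁻¹ : ℝ) • (T + T.flip - D p)

theorem koszulForm_apply (D : E →L[ℝ] E →L[ℝ] E →L[ℝ] ℝ) (p v w : E) :
    koszulForm D p v w = koszul D v w p := by
  change 2⁻¹ * (D v w p + D w v p - D p v w) = _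
  rw [koszul]
  ring

/-- Raising with `B` the index that has been lowered with `B₀`. For `p = ∇f` with respect to `g_0`
this is the gradient of `f` with respect to `g_t`. -/
def shift (B₀ B : E →L[ℝ] E →L[ℝ] ℝ) (p : E) : E := B.inverse (B₀ p)

/-- The zeroth order term `Ψ` of the second fundamental form of a graph in Fermi coordinates
`dt² + g_t`, in terms of the coefficients `B₀`, `B` of `g_0` and `g_t`, their space derivatives
`D₀`, `D` and the time derivative `B'` of `g_t`. -/
def graphForm (B₀ B : E →L[ℝ] E →L[ℝ] ℝ) (D₀ D : E →L[ℝ] E →L[ℝ] E →L[ℝ] ℝ)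
    (B' : E →L[ℝ] E →L[ℝ] ℝ) (p : E) : E →L[ℝ] E →L[ℝ] ℝ :=
  koszulForm D₀ p - koszulForm D (shift B₀ B p)
    - (2⁻¹ : ℝ) • (B' + (B'.flip (shift B₀ B p)).smulRight (B₀ p)
      + (B₀ p).smulRight (B'.flip (shift B₀ B p)))

theorem graphForm_apply (B₀ B : E →L[ℝ] E →L[ℝ] ℝ) (D₀ D : E →L[ℝ] E →L[ℝ] E →L[ℝ] ℝ)
    (B' : E →L[ℝ] E →L[ℝ] ℝ) (p v w : E) :
    graphForm B₀ B D₀ D B' p v w = koszul D₀ v w p - koszul D v w (shift B₀ B p)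
      - (B' v w + B' v (shift B₀ B p) * B₀ p w + B₀ p v * B' w (shift B₀ B p)) / 2 := by
  rw [← koszulForm_apply, ← koszulForm_apply, div_eq_inv_mul]
  rfl

/-- The factor `ψ = det(g_0⁻¹ g_t)^{1/n} (1 + |∇f|²)^{(n+2)/(2n)}` between the Gaussian curvature
of a graph and the determinant of its Hessian, the norm of the `g_t`-gradient `∇f` being taken with
respect to `g_t`. -/
def graphFactor (B₀ B : E →L[ℝ] E →L[ℝ] ℝ) (p : E) : ℝ :=
  (B₀.inverse ∘L B).det ^ (1 / (Module.finrank ℝ E : ℝ)) *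
    (1 + B₀ p (shift B₀ B p)) ^ ((Module.finrank ℝ E + 2) / (2 * Module.finrank ℝ E) : ℝ)

variable [FiniteDimensional ℝ E] {B₀ B : E →L[ℝ] E →L[ℝ] ℝ}

theorem apply_shift (hB : PosDefForm B) (p : E) : B (shift B₀ B p) = B₀ p :=
  hB.isInvertible.self_apply_inverse _

theorem shift_self (hB : PosDefForm B) (p : E) : shift B B p = p :=
  hB.isInvertible.inverse_apply_self p

theorem apply_shift_nonneg (hB : PosDefForm B) (p : E) : 0 ≤ B₀ p (shift B₀ B p) := by
  rw [← apply_shift hB p]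
  exact hB.nonneg _

theorem graphFactor_pos (hB₀ : PosDefForm B₀) (hB : PosDefForm B) (p : E) :
    0 < graphFactor B₀ B p :=
  mul_pos (Real.rpow_pos_of_pos (det_inverse_comp_pos hB₀ hB) _)
    (Real.rpow_pos_of_pos (add_pos_of_pos_of_nonneg one_pos (apply_shift_nonneg hB p)) _)

theorem convexOn_graphFactor [Nontrivial E] (hB₀ : PosDefForm B₀) (hB : PosDefForm B) :
    ConvexOn ℝ univ (graphFactor B₀ B) := by
  have hn : (0 : ℝ) < Module.finrank ℝ E := by exact_mod_cast Module.finrank_pos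
  let q : LinearMap.BilinForm ℝ E := B₀.toBilinForm.compRight (B.inverse ∘L B₀ : E →L[ℝ] E)
  have hq : q.IsSymm := ⟨fun v w => by
    change B₀ v (shift B₀ B w) = B₀ w (shift B₀ B v)
    rw [← apply_shift hB v, ← apply_shift hB w, hB.1]⟩
  have hexponent : 1 / 2 ≤ ((Module.finrank ℝ E + 2) / (2 * Module.finrank ℝ E) : ℝ) := by
    rw [div_le_div_iff₀ (by norm_num) (by positivity)]
    linarith
  exact (convexOn_one_add_apply_self_rpow hq (apply_shift_nonneg hB) hexponent).smul
    (Real.rpow_nonneg (det_inverse_comp_pos hB₀ hB).le _)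

variable {V : Type*} [NormedAddCommGroup V] [NormedSpace ℝ V] [FiniteDimensional ℝ V]

theorem map_shift (hB : PosDefForm B) {L : V →L[ℝ] E} (hL : Function.Bijective L) (p : V) :
    L (shift (pullForm B₀ L) (pullForm B L) p) = shift B₀ B (L p) :=
  inverse_pullForm_comp_pullForm hB hL p

-- The non-tensorial terms of the two Christoffel combinations cancel.
theorem graphForm_pull {D₀ D : E →L[ℝ] E →L[ℝ] E →L[ℝ] ℝ} {B' : E →L[ℝ] E →L[ℝ] ℝ}
    (hB₀ : PosDefForm B₀) (hB : PosDefForm B) {L : V →L[ℝ] E} (hL : Function.Bijective L)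
    {S : V →L[ℝ] V →L[ℝ] E} (hS : ∀ v w, S v w = S w v) {C₀ C : V →L[ℝ] V →L[ℝ] V →L[ℝ] ℝ}
    (hC₀ : ∀ u v w, C₀ u v w
      = D₀ (L u) (L v) (L w) + B₀ (S u v) (L w) + B₀ (L v) (S u w))
    (hC : ∀ u v w, C u v w
      = D (L u) (L v) (L w) + B (S u v) (L w) + B (L v) (S u w)) (p : V) :
    graphForm (pullForm B₀ L) (pullForm B L) C₀ C (pullForm B' L) p
      = pullForm (graphForm B₀ B D₀ D B' (L p)) L := by
  ext v w
  rw [pullForm_apply, graphForm_apply, graphForm_apply, koszul_pull hB₀.1 hS hC₀,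
    koszul_pull hB.1 hS hC]
  simp only [pullForm_apply, map_shift hB hL]
  rw [hB.1 (S v w) (shift B₀ B (L p)), apply_shift hB, hB₀.1 (S v w)]
  ring

theorem graphFactor_pull (hB₀ : PosDefForm B₀) (hB : PosDefForm B) {L : V →L[ℝ] E}
    (hL : Function.Bijective L) (p : V) :
    graphFactor (pullForm B₀ L) (pullForm B L) p = graphFactor B₀ B (L p) := by
  have hdim : Module.finrank ℝ V = Module.finrank ℝ E :=
    (LinearEquiv.ofBijective (L : V →ₗ[ℝ] E) hL).finrank_eq
  simp only [graphFactor, det_inverse_pullForm_comp_pullForm hB₀ hL, hdim, pullForm_apply,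
    map_shift hB hL]

theorem graphForm_self (hB : PosDefForm B) (D : E →L[ℝ] E →L[ℝ] E →L[ℝ] ℝ)
    (B' : E →L[ℝ] E →L[ℝ] ℝ) (p v w : E) :
    graphForm B B D D B' p v w = -(B' v w + B' v p * B p w + B p v * B' w p) / 2 := by
  rw [graphForm_apply, shift_self hB]
  ring

end GraphForm

section SmoothAlgebra

variable {Z E : Type*} [NormedAddCommGroup Z] [NormedSpace ℝ Z] [NormedAddCommGroup E]
  [NormedSpace ℝ E] {n : WithTop ℕ∞} {s : Set Z}

theorem contDiffOn_koszul {D : Z → E →L[ℝ] E →L[ℝ] E →L[ℝ] ℝ} {p : Z → E}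
    (hD : ContDiffOn ℝ n D s) (hp : ContDiffOn ℝ n p s) (v w : E) :
    ContDiffOn ℝ n (fun z => koszul (D z) v w (p z)) s :=
  ((((hD.clm_apply contDiffOn_const).clm_apply contDiffOn_const).clm_apply hp).add
    (((hD.clm_apply contDiffOn_const).clm_apply contDiffOn_const).clm_apply hp) |>.sub
    (((hD.clm_apply hp).clm_apply contDiffOn_const).clm_apply contDiffOn_const)).div_const 2

variable [FiniteDimensional ℝ E]

theorem contDiffOn_clm_det {T : Z → E →L[ℝ] E} (hT : ContDiffOn ℝ n T s) :
    ContDiffOn ℝ n (fun z => (T z).det) s := by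
  let b := Module.finBasis ℝ E
  have h : ∀ z, (T z).det = ∑ σ : Equiv.Perm (Fin (Module.finrank ℝ E)),
      ((Equiv.Perm.sign σ : ℤ) : ℝ) * ∏ i, LinearMap.toContinuousLinearMap (b.coord (σ i))
        (T z (b i)) := fun z => by
    rw [ContinuousLinearMap.det, ← LinearMap.det_toMatrix b, Matrix.det_apply']
    simp [LinearMap.toMatrix_apply]
  simp only [h]
  refine ContDiffOn.sum fun σ _ => contDiffOn_const.mul (contDiffOn_prod fun i _ => ?_)
  exact contDiffOn_const.clm_apply (hT.clm_apply contDiffOn_const)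

theorem PosDefForm.contDiffWithinAt_inverse {B : Z → E →L[ℝ] E →L[ℝ] ℝ} {z : Z}
    (hpos : PosDefForm (B z)) (hB : ContDiffWithinAt ℝ n B s z) :
    ContDiffWithinAt ℝ n (fun z => (B z).inverse) s z := by
  have := FiniteDimensional.complete ℝ E
  obtain ⟨e, he⟩ := hpos.isInvertible
  have h : ContDiffAt ℝ n ContinuousLinearMap.inverse (B z) := by
    rw [← he]
    exact contDiffAt_map_inverse e
  exact h.comp_contDiffWithinAt z hB

theorem contDiffOn_shift {B₀ B : Z → E →L[ℝ] E →L[ℝ] ℝ} {p : Z → E} (hB₀ : ContDiffOn ℝ n B₀ s)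
    (hB : ContDiffOn ℝ n B s) (hpos : ∀ z ∈ s, PosDefForm (B z)) (hp : ContDiffOn ℝ n p s) :
    ContDiffOn ℝ n (fun z => shift (B₀ z) (B z) (p z)) s :=
  ContDiffOn.clm_apply (fun z hz => (hpos z hz).contDiffWithinAt_inverse (hB z hz))
    (hB₀.clm_apply hp)

theorem contDiffOn_graphForm {B₀ B B' : Z → E →L[ℝ] E →L[ℝ] ℝ}
    {D₀ D : Z → E →L[ℝ] E →L[ℝ] E →L[ℝ] ℝ} {p : Z → E} (hB₀ : ContDiffOn ℝ n B₀ s)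
    (hB : ContDiffOn ℝ n B s) (hD₀ : ContDiffOn ℝ n D₀ s) (hD : ContDiffOn ℝ n D s)
    (hB' : ContDiffOn ℝ n B' s) (hpos : ∀ z ∈ s, PosDefForm (B z)) (hp : ContDiffOn ℝ n p s) :
    ContDiffOn ℝ n (fun z => graphForm (B₀ z) (B z) (D₀ z) (D z) (B' z) (p z)) s := by
  refine contDiffOn_clm_apply.2 fun v => contDiffOn_clm_apply.2 fun w => ?_
  simp only [graphForm_apply]
  have hs := contDiffOn_shift hB₀ hB hpos hp
  have h0 := fun u => (hB₀.clm_apply hp).clm_apply (contDiffOn_const (c := u))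
  have h1 := fun u => (hB'.clm_apply (contDiffOn_const (c := u))).clm_apply hs
  exact ((contDiffOn_koszul hD₀ hp v w).sub (contDiffOn_koszul hD hs v w)).sub
    (((((hB'.clm_apply contDiffOn_const).clm_apply contDiffOn_const).add
      ((h1 v).mul (h0 w))).add ((h0 v).mul (h1 w))).div_const 2)

theorem contDiffOn_graphFactor {B₀ B : Z → E →L[ℝ] E →L[ℝ] ℝ} {p : Z → E}
    (hB₀ : ContDiffOn ℝ n B₀ s) (hB : ContDiffOn ℝ n B s) (hpos₀ : ∀ z ∈ s, PosDefForm (B₀ z))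
    (hpos : ∀ z ∈ s, PosDefForm (B z)) (hp : ContDiffOn ℝ n p s) :
    ContDiffOn ℝ n (fun z => graphFactor (B₀ z) (B z) (p z)) s := by
  have hs := contDiffOn_shift hB₀ hB hpos hp
  refine ContDiffOn.mul ?_ ?_
  · have hinv : ContDiffOn ℝ n (fun z => (B₀ z).inverse) s := fun z hz =>
      (hpos₀ z hz).contDiffWithinAt_inverse (hB₀ z hz)
    exact (contDiffOn_clm_det (hinv.clm_comp hB)).rpow_const_of_ne fun z hz =>
      (det_inverse_comp_pos (hpos₀ z hz) (hpos z hz)).ne'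
  · refine (contDiffOn_const.add ((hB₀.clm_apply hp).clm_apply hs)).rpow_const_of_ne fun z hz => ?_
    have := apply_shift_nonneg (B₀ := B₀ z) (hpos z hz) (p z)
    positivity

end SmoothAlgebra

/-! ### Forms and maps in charts -/

section Charts

open Topology

variable {E : Type*} [NormedAddCommGroup E] [NormedSpace ℝ E]
  {H : Type*} [TopologicalSpace H] (I : ModelWithCorners ℝ E H)
  {X : Type*} [TopologicalSpace X] [ChartedSpace H X]
  {E' : Type*} [NormedAddCommGroup E'] [NormedSpace ℝ E']
  {H' : Type*} [TopologicalSpace H'] (J : ModelWithCorners ℝ E' H')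
  {Y : Type*} [TopologicalSpace Y] [ChartedSpace H' Y]

/-- The derivative of a map, with the tangent spaces identified with the model spaces. -/
def modelDeriv (φ : X → Y) (x : X) : E →L[ℝ] E' := mfderiv I J φ x

/-- The coordinates in the chart centred at `x₀` of tangent vectors at `x`. -/
def chartDeriv (x₀ x : X) : E →L[ℝ] E := mfderiv I 𝓘(ℝ, E) (extChartAt I x₀) x

/-- The tangent vectors at the point with coordinates `z` in the chart centred at `x₀`. -/
def chartDerivSymm (x₀ : X) (z : E) : E →L[ℝ] E :=
  mfderivWithin 𝓘(ℝ, E) I (extChartAt I x₀).symm (range I) z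

/-- A form field, with the tangent spaces identified with the model space. -/
def FormField.model (h : FormField I (X := X)) (x : X) : E →L[ℝ] E →L[ℝ] ℝ := h x

theorem coordForm_eq (h : FormField I (X := X)) (x₀ : X) (z : E) :
    coordForm I h x₀ z
      = pullForm (FormField.model I h ((extChartAt I x₀).symm z)) (chartDerivSymm I x₀ z) := rfl

theorem modelDeriv_id (x : X) : modelDeriv I I (id : X → X) x = ContinuousLinearMap.id ℝ E :=
  mfderiv_id

variable [IsManifold I 1 X] [IsManifold J 1 Y]

theorem chartDeriv_chartDerivSymm {x₀ : X} {z : E} (hz : z ∈ (extChartAt I x₀).target) (v : E) :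
    chartDeriv I x₀ ((extChartAt I x₀).symm z) (chartDerivSymm I x₀ z v) = v :=
  DFunLike.congr_fun (mfderiv_extChartAt_comp_mfderivWithin_extChartAt_symm hz) v

theorem chartDerivSymm_chartDeriv {x₀ x : X} (hx : x ∈ (extChartAt I x₀).source) (v : E) :
    chartDerivSymm I x₀ (extChartAt I x₀ x) (chartDeriv I x₀ x v) = v :=
  DFunLike.congr_fun (mfderivWithin_extChartAt_symm_comp_mfderiv_extChartAt' hx) v

theorem chartDeriv_chartDerivSymm' {x₀ x : X} (hx : x ∈ (extChartAt I x₀).source) (v : E) :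
    chartDeriv I x₀ x (chartDerivSymm I x₀ (extChartAt I x₀ x) v) = v := by
  simpa only [(extChartAt I x₀).left_inv hx] using
    chartDeriv_chartDerivSymm I ((extChartAt I x₀).map_source hx) v

theorem chartDeriv_bijective {x₀ x : X} (hx : x ∈ (extChartAt I x₀).source) :
    Function.Bijective (chartDeriv I x₀ x) :=
  ⟨(show Function.LeftInverse (chartDerivSymm I x₀ (extChartAt I x₀ x)) _ from
      chartDerivSymm_chartDeriv I hx).injective,
    (show Function.RightInverse (chartDerivSymm I x₀ (extChartAt I x₀ x)) _ from
      chartDeriv_chartDerivSymm' I hx).surjective⟩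

theorem chartDeriv_self (x : X) : chartDeriv I x x = ContinuousLinearMap.id ℝ E :=
  mfderiv_extChartAt_self

theorem form_eq_coordForm (h : FormField I (X := X)) {x₀ x : X}
    (hx : x ∈ (extChartAt I x₀).source) :
    FormField.model I h x
      = pullForm (coordForm I h x₀ (extChartAt I x₀ x)) (chartDeriv I x₀ x) := by
  ext v w
  rw [pullForm_apply, coordForm_eq, pullForm_apply, chartDerivSymm_chartDeriv I hx,
    chartDerivSymm_chartDeriv I hx, (extChartAt I x₀).left_inv hx]

theorem coordForm_chartDeriv (h : FormField I (X := X)) {x₀ x : X}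
    (hx : x ∈ (extChartAt I x₀).source) (v w : E) :
    coordForm I h x₀ (extChartAt I x₀ x) (chartDeriv I x₀ x v) (chartDeriv I x₀ x w)
      = FormField.model I h x v w := by
  rw [form_eq_coordForm I h hx, pullForm_apply]

theorem coordForm_self (h : FormField I (X := X)) (x : X) :
    coordForm I h x (extChartAt I x x) = FormField.model I h x := by
  rw [form_eq_coordForm I h (mem_extChartAt_source x), chartDeriv_self]
  rfl

theorem differentiableWithinAt_comp_chart {A : X → E'} {x₀ x : X}
    (hx : x ∈ (extChartAt I x₀).source) (hA : MDifferentiableAt I 𝓘(ℝ, E') A x) :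
    DifferentiableWithinAt ℝ (A ∘ (extChartAt I x₀).symm) (range I) (extChartAt I x₀ x) :=
  (MDifferentiableAt.comp_mdifferentiableWithinAt (I' := I) _
    (by rwa [(extChartAt I x₀).left_inv hx])
    (mdifferentiableWithinAt_extChartAt_symm
      ((extChartAt I x₀).map_source hx))).differentiableWithinAt

theorem fderivWithin_comp_chart {A : X → E'} {x₀ x : X} (hx : x ∈ (extChartAt I x₀).source)
    (hA : MDifferentiableAt I 𝓘(ℝ, E') A x) (v : E) :
    fderivWithin ℝ (A ∘ (extChartAt I x₀).symm) (range I) (extChartAt I x₀ x) v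
      = modelDeriv I 𝓘(ℝ, E') A x (chartDerivSymm I x₀ (extChartAt I x₀ x) v) := by
  have hz := (extChartAt I x₀).map_source hx
  rw [← mfderivWithin_eq_fderivWithin]
  exact DFunLike.congr_fun (mfderiv_comp_mfderivWithin_of_eq (I' := I) (g := A) (y := x) hA
    (mdifferentiableWithinAt_extChartAt_symm hz)
    (I.uniqueMDiffOn _ (extChartAt_target_subset_range x₀ hz)) ((extChartAt I x₀).left_inv hx)) v

theorem fderivWithin_inCharts {φ : X → Y} {x₀ x : X} {y₀ : Y}
    (hx : x ∈ (extChartAt I x₀).source) (hy : φ x ∈ (extChartAt J y₀).source)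
    (hφ : MDifferentiableAt I J φ x) (v : E) :
    fderivWithin ℝ (extChartAt J y₀ ∘ φ ∘ (extChartAt I x₀).symm) (range I) (extChartAt I x₀ x) v
      = chartDeriv J y₀ (φ x) (modelDeriv I J φ x
          (chartDerivSymm I x₀ (extChartAt I x₀ x) v)) := by
  have hy' : MDifferentiableAt J 𝓘(ℝ, E') (extChartAt J y₀) (φ x) :=
    mdifferentiableAt_extChartAt (by rwa [← extChartAt_source (I := J)])
  exact (fderivWithin_comp_chart I (A := extChartAt J y₀ ∘ φ) hx (hy'.comp x hφ) v).trans
    (DFunLike.congr_fun (mfderiv_comp x hy' hφ) _)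

theorem fderivWithin_inCharts_chartDeriv {φ : X → Y} {x₀ x : X} {y₀ : Y}
    (hx : x ∈ (extChartAt I x₀).source) (hy : φ x ∈ (extChartAt J y₀).source)
    (hφ : MDifferentiableAt I J φ x) (v : E) :
    fderivWithin ℝ (extChartAt J y₀ ∘ φ ∘ (extChartAt I x₀).symm) (range I) (extChartAt I x₀ x)
        (chartDeriv I x₀ x v)
      = chartDeriv J y₀ (φ x) (modelDeriv I J φ x v) := by
  rw [fderivWithin_inCharts I J hx hy hφ, chartDerivSymm_chartDeriv I hx]

theorem coordForm_firstForm (g : FormField J (X := Y)) {φ : X → Y} {x₀ : X} {y₀ : Y} {z : E}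
    (hz : z ∈ (extChartAt I x₀).target)
    (hy : φ ((extChartAt I x₀).symm z) ∈ (extChartAt J y₀).source)
    (hφ : MDifferentiableAt I J φ ((extChartAt I x₀).symm z)) :
    coordForm I (firstForm I J g φ) x₀ z
      = pullForm (coordForm J g y₀ (extChartAt J y₀ (φ ((extChartAt I x₀).symm z))))
        (fderivWithin ℝ (extChartAt J y₀ ∘ φ ∘ (extChartAt I x₀).symm) (range I) z) := by
  have h := fderivWithin_inCharts I J ((extChartAt I x₀).map_target hz) hy hφ
  rw [(extChartAt I x₀).right_inv hz] at h
  ext v w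
  rw [pullForm_apply, h, h, coordForm_chartDeriv J g hy]
  rfl

theorem fderivWithin_chart_comp_chart_symm {x₀ x₁ : X} {z : E} (hz : z ∈ (extChartAt I x₁).target)
    (hx : (extChartAt I x₁).symm z ∈ (extChartAt I x₀).source) (v : E) :
    fderivWithin ℝ (extChartAt I x₀ ∘ (extChartAt I x₁).symm) (range I) z v
      = chartDeriv I x₀ ((extChartAt I x₁).symm z) (chartDerivSymm I x₁ z v) := by
  have h := fderivWithin_inCharts I I (φ := id) ((extChartAt I x₁).map_target hz) hx
    mdifferentiableAt_id v
  rw [(extChartAt I x₁).right_inv hz, modelDeriv_id] at h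
  exact h

theorem coordForm_change (h : FormField I (X := X)) {x₀ x₁ : X} {z : E}
    (hz : z ∈ (extChartAt I x₁).target)
    (hx : (extChartAt I x₁).symm z ∈ (extChartAt I x₀).source) :
    coordForm I h x₁ z
      = pullForm (coordForm I h x₀ (extChartAt I x₀ ((extChartAt I x₁).symm z)))
        (fderivWithin ℝ (extChartAt I x₀ ∘ (extChartAt I x₁).symm) (range I) z) := by
  ext v w
  rw [pullForm_apply, fderivWithin_chart_comp_chart_symm I hz hx,
    fderivWithin_chart_comp_chart_symm I hz hx, coordForm_chartDeriv I h hx]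
  rfl

theorem fderivWithin_chart_change {x₀ x₁ : X} (hx : x₁ ∈ (extChartAt I x₀).source) :
    fderivWithin ℝ (extChartAt I x₀ ∘ (extChartAt I x₁).symm) (range I) (extChartAt I x₁ x₁)
      = chartDeriv I x₀ x₁ := by
  ext v
  have h := fderivWithin_inCharts_chartDeriv I I (φ := id) (mem_extChartAt_source x₁) hx
    mdifferentiableAt_id v
  rw [chartDeriv_self, modelDeriv_id] at h
  exact h

end Charts

/-! ### Smoothness in charts -/

section Smoothness

open Topology

variable {E : Type*} [NormedAddCommGroup E] [NormedSpace ℝ E]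
  {H : Type*} [TopologicalSpace H] (I : ModelWithCorners ℝ E H)
  {X : Type*} [TopologicalSpace X] [ChartedSpace H X]
  {E' : Type*} [NormedAddCommGroup E'] [NormedSpace ℝ E']
  {H' : Type*} [TopologicalSpace H'] (J : ModelWithCorners ℝ E' H')
  {Y : Type*} [TopologicalSpace Y] [ChartedSpace H' Y]

theorem trivializationAt_tangent [IsManifold I 1 X] {x₀ x : X}
    (hx : x ∈ (extChartAt I x₀).source) (v : TangentSpace I x) :
    (trivializationAt E (TangentSpace I) x₀ (TotalSpace.mk' E x v)).2 = chartDeriv I x₀ x v := by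
  have hx' : x ∈ (chartAt H x₀).source := by rwa [← extChartAt_source (I := I)]
  have h := DFunLike.congr_fun
    (TangentBundle.continuousLinearMapAt_trivializationAt (𝕜 := ℝ) (I := I) hx') v
  rwa [Trivialization.continuousLinearMapAt_apply, Trivialization.coe_linearMapAt_of_mem _
    (show x ∈ (trivializationAt E (TangentSpace I) x₀).baseSet from hx')] at h

theorem trivializationAt_form [IsManifold I 1 X] {x₀ x : X} (hx : x ∈ (extChartAt I x₀).source)
    (B : TangentSpace I x →L[ℝ] TangentSpace I x →L[ℝ] ℝ) :
    (trivializationAt (E →L[ℝ] E →L[ℝ] ℝ)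
      (fun x : X => TangentSpace I x →L[ℝ] TangentSpace I x →L[ℝ] ℝ) x₀
      (TotalSpace.mk' (E →L[ℝ] E →L[ℝ] ℝ) x B)).2
      = pullForm (show E →L[ℝ] E →L[ℝ] ℝ from B)
          (chartDerivSymm I x₀ (extChartAt I x₀ x)) := by
  have hx' : x ∈ (chartAt H x₀).source := by rwa [← extChartAt_source (I := I)]
  have hb : x ∈ (trivializationAt E (TangentSpace I) x₀).baseSet := hx'
  have hs : ∀ v : E, (trivializationAt E (TangentSpace I) x₀).symm x v
      = chartDerivSymm I x₀ (extChartAt I x₀ x) v := fun v =>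
    ((trivializationAt E (TangentSpace I) x₀).symmL_apply (R := ℝ) hb v).symm.trans
      (DFunLike.congr_fun (TangentBundle.symmL_trivializationAt (𝕜 := ℝ) (I := I) hx') v)
  ext v w
  rw [hom_trivializationAt_apply]
  refine (inCoordinates_apply_eq₂ (𝕜 := ℝ) (F₁ := E) (F₂ := E) (F₃ := ℝ)
    (E₁ := (TangentSpace I : X → Type _)) (E₂ := (TangentSpace I : X → Type _))
    (E₃ := Bundle.Trivial X ℝ) (x₀ := x₀) (x := x) (ϕ := B) (v := v) (w := w)
    hb hb (mem_univ _)).trans ?_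
  simp only [hs, Trivial.fiberBundle_trivializationAt', Trivial.linearMapAt_trivialization]
  rfl

/-- Smooth fields of bilinear forms. -/
abbrev IsSmoothForm [IsManifold J ∞ Y] (g : FormField J (X := Y)) : Prop :=
  ContMDiff J (J.prod 𝓘(ℝ, E' →L[ℝ] E' →L[ℝ] ℝ)) ∞
    (fun y => TotalSpace.mk' (E' →L[ℝ] E' →L[ℝ] ℝ)
      (E := fun y : Y => TangentSpace J y →L[ℝ] TangentSpace J y →L[ℝ] ℝ) y (g y))

theorem contMDiffOn_pullForm_chartDerivSymm [IsManifold J ∞ Y] {g : FormField J (X := Y)}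
    (hg : IsSmoothForm J g) (y₀ : Y) :
    ContMDiffOn J 𝓘(ℝ, E' →L[ℝ] E' →L[ℝ] ℝ) ∞
      (fun y => pullForm (FormField.model J g y) (chartDerivSymm J y₀ (extChartAt J y₀ y)))
      (extChartAt J y₀).source := by
  intro y hy
  have hy' : y ∈ (chartAt H' y₀).source := by rwa [← extChartAt_source (I := J)]
  have hb : TotalSpace.mk' (E' →L[ℝ] E' →L[ℝ] ℝ)
      (E := fun y : Y => TangentSpace J y →L[ℝ] TangentSpace J y →L[ℝ] ℝ) y (g y) ∈
      (trivializationAt (E' →L[ℝ] E' →L[ℝ] ℝ)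
        (fun y : Y => TangentSpace J y →L[ℝ] TangentSpace J y →L[ℝ] ℝ) y₀).source := by
    rw [Trivialization.mem_source, hom_trivializationAt_baseSet, hom_trivializationAt_baseSet]
    exact ⟨hy', hy', mem_univ _⟩
  exact (((trivializationAt (E' →L[ℝ] E' →L[ℝ] ℝ)
      (fun y : Y => TangentSpace J y →L[ℝ] TangentSpace J y →L[ℝ] ℝ) y₀).contMDiffAt_iff
      (n := ∞) (IB := J) (IM := J) (f := fun y => TotalSpace.mk' (E' →L[ℝ] E' →L[ℝ] ℝ)
        (E := fun y : Y => TangentSpace J y →L[ℝ] TangentSpace J y →L[ℝ] ℝ) y (g y))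
      hb).1 (hg y)).2.contMDiffWithinAt.congr
    (fun y' hy' => (trivializationAt_form J hy' _).symm) (trivializationAt_form J hy _).symm

theorem contDiffOn_coordForm [IsManifold J ∞ Y] {g : FormField J (X := Y)}
    (hg : IsSmoothForm J g) (y₀ : Y) :
    ContDiffOn ℝ ∞ (coordForm J g y₀) (extChartAt J y₀).target := by
  refine contMDiffOn_iff_contDiffOn.1 (((contMDiffOn_pullForm_chartDerivSymm J hg y₀).comp
    (contMDiffOn_extChartAt_symm y₀) fun z hz => (extChartAt J y₀).map_target hz).congr
    fun z hz => ?_)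
  rw [Function.comp_apply, coordForm_eq, (extChartAt J y₀).right_inv hz]

/-- The coordinates of `(x, t, p)`, `p ∈ T_x X`, in the chart centred at `x₀`. -/
def familyChart (x₀ : X) (q : TangentBundle I X × ℝ) : E × ℝ × E :=
  (extChartAt I x₀ q.1.proj, q.2, chartDeriv I x₀ q.1.proj q.1.2)

/-- The domain, in a chart, of the functions of `(x, t, p)` with `(x, t) ∈ W`. -/
def familyDomain (W : Set (X × ℝ)) (x₀ : X) : Set (E × ℝ × E) :=
  {r | r.1 ∈ (extChartAt I x₀).target ∧ ((extChartAt I x₀).symm r.1, r.2.1) ∈ W}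

theorem familyChart_mem_familyDomain {W : Set (X × ℝ)} {x₀ : X} {q : TangentBundle I X × ℝ}
    (hq : q.1.proj ∈ (extChartAt I x₀).source) (hW : (q.1.proj, q.2) ∈ W) :
    familyChart I x₀ q ∈ familyDomain I W x₀ := by
  refine ⟨(extChartAt I x₀).map_source hq, ?_⟩
  change ((extChartAt I x₀).symm (extChartAt I x₀ q.1.proj), q.2) ∈ W
  rwa [(extChartAt I x₀).left_inv hq]

variable [IsManifold I ∞ X]

theorem contMDiff_familyProj : ContMDiff (I.tangent.prod 𝓘(ℝ, ℝ)) I ∞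
    (fun q : TangentBundle I X × ℝ => q.1.proj) :=
  (contMDiff_proj (TangentSpace I : X → Type _)).comp contMDiff_fst

theorem eventually_familyProj_mem_source (q₀ : TangentBundle I X × ℝ) :
    ∀ᶠ q in 𝓝 q₀, q.1.proj ∈ (extChartAt I q₀.1.proj).source :=
  (contMDiff_familyProj I).continuous.continuousAt.eventually
    ((isOpen_extChartAt_source q₀.1.proj).mem_nhds (mem_extChartAt_source q₀.1.proj))

theorem contMDiffAt_familyChart (q₀ : TangentBundle I X × ℝ) :
    ContMDiffAt (I.tangent.prod 𝓘(ℝ, ℝ)) 𝓘(ℝ, E × ℝ × E) ∞ (familyChart I q₀.1.proj) q₀ := by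
  have hpoint : ContMDiffAt (I.tangent.prod 𝓘(ℝ, ℝ)) 𝓘(ℝ, E) ∞
      (fun q : TangentBundle I X × ℝ => extChartAt I q₀.1.proj q.1.proj) q₀ :=
    ContMDiffAt.comp q₀ (I' := I) (g := extChartAt I q₀.1.proj) contMDiffAt_extChartAt
      (contMDiff_familyProj I).contMDiffAt
  have hvector : ContMDiffAt (I.tangent.prod 𝓘(ℝ, ℝ)) 𝓘(ℝ, E) ∞
      (fun q : TangentBundle I X × ℝ => chartDeriv I q₀.1.proj q.1.proj q.1.2) q₀ := by
    refine (contMDiffAt_totalSpace.1 (contMDiffAt_fst (n := ∞) (I := I.tangent)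
      (J := 𝓘(ℝ, ℝ)) (M := TangentBundle I X) (N := ℝ) (p := q₀))).2.congr_of_eventuallyEq ?_
    filter_upwards [eventually_familyProj_mem_source I q₀] with q hq
    exact (trivializationAt_tangent I hq q.1.2).symm
  exact hpoint.prodMk_space (contMDiffAt_snd.prodMk_space hvector)

theorem contMDiffWithinAt_of_eq_comp_familyChart {W : Set (X × ℝ)}
    {V : Type*} [NormedAddCommGroup V] [NormedSpace ℝ V] {Φ : E × ℝ × E → V}
    {F : TangentBundle I X × ℝ → V} {q₀ : TangentBundle I X × ℝ} (hq₀ : (q₀.1.proj, q₀.2) ∈ W)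
    (hΦ : ContDiffOn ℝ ∞ Φ (familyDomain I W q₀.1.proj))
    (hF : ∀ q : TangentBundle I X × ℝ, (q.1.proj, q.2) ∈ W →
      q.1.proj ∈ (extChartAt I q₀.1.proj).source → F q = Φ (familyChart I q₀.1.proj q)) :
    ContMDiffWithinAt (I.tangent.prod 𝓘(ℝ, ℝ)) 𝓘(ℝ, V) ∞ F {q | (q.1.proj, q.2) ∈ W} q₀ := by
  have hx₀ := mem_extChartAt_source (I := I) q₀.1.proj
  rw [← contMDiffWithinAt_inter (eventually_familyProj_mem_source I q₀)]
  exact ((hΦ _ (familyChart_mem_familyDomain I hx₀ hq₀)).contMDiffWithinAt.comp q₀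
    (contMDiffAt_familyChart I q₀).contMDiffWithinAt
    fun q hq => familyChart_mem_familyDomain I hq.2 hq.1).congr
      (fun q hq => hF q hq.1 hq.2) (hF q₀ hq₀ hx₀)

theorem smoothFormFamily_of_local {W : Set (X × ℝ)}
    {Ψ : (x : X) → ℝ → E → E →L[ℝ] E →L[ℝ] ℝ}
    {Ψ' : (x₀ : X) → E × ℝ × E → E →L[ℝ] E →L[ℝ] ℝ}
    (h : ∀ x₀ x t p, (x, t) ∈ W → x ∈ (extChartAt I x₀).source →
      Ψ x t p = pullForm
        (Ψ' x₀ (extChartAt I x₀ x, t, chartDeriv I x₀ x p)) (chartDeriv I x₀ x))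
    (hs : ∀ x₀, ContDiffOn ℝ ∞ (Ψ' x₀) (familyDomain I W x₀)) :
    SmoothFormFamily I W Ψ := by
  intro q₀ hq₀
  rw [contMDiffWithinAt_totalSpace]
  refine ⟨(contMDiff_familyProj I).contMDiffAt.contMDiffWithinAt,
    contMDiffWithinAt_of_eq_comp_familyChart I hq₀ (hs _) fun q hqW hq =>
      (trivializationAt_form I hq _).trans ?_⟩
  ext v w
  change pullForm (Ψ q.1.proj q.2 q.1.2) _ v w = _
  rw [pullForm_apply, h q₀.1.proj q.1.proj q.2 q.1.2 hqW hq, pullForm_apply,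
    chartDeriv_chartDerivSymm' I hq, chartDeriv_chartDerivSymm' I hq]
  rfl

theorem smoothFunFamily_of_local {W : Set (X × ℝ)}
    {ψ : (x : X) → ℝ → E → ℝ} {ψ' : (x₀ : X) → E × ℝ × E → ℝ}
    (h : ∀ x₀ x t p, (x, t) ∈ W → x ∈ (extChartAt I x₀).source →
      ψ x t p = ψ' x₀ (extChartAt I x₀ x, t, chartDeriv I x₀ x p))
    (hs : ∀ x₀, ContDiffOn ℝ ∞ (ψ' x₀) (familyDomain I W x₀)) :
    SmoothFunFamily I W ψ := fun _ hq₀ =>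
  contMDiffWithinAt_of_eq_comp_familyChart I hq₀ (hs _) fun _ hqW hq => h _ _ _ _ hqW hq

end Smoothness

/-! ### A family of maps in charts -/

section Flow

open Topology

variable {E : Type*} [NormedAddCommGroup E] [NormedSpace ℝ E]
  {H : Type*} [TopologicalSpace H] (I : ModelWithCorners ℝ E H)
  {X : Type*} [TopologicalSpace X] [ChartedSpace H X]
  {E' : Type*} [NormedAddCommGroup E'] [NormedSpace ℝ E']
  {H' : Type*} [TopologicalSpace H'] (J : ModelWithCorners ℝ E' H')
  {Y : Type*} [TopologicalSpace Y] [ChartedSpace H' Y]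

/-- A family of maps `𝓔(·, t)` in charts. -/
def flowRep (𝓔 : X × ℝ → Y) (x₀ : X) (y₀ : Y) (q : E × ℝ) : E' :=
  extChartAt J y₀ (𝓔 ((extChartAt I x₀).symm q.1, q.2))

/-- The metric induced by the map `𝓔(·, t)`. -/
def sliceMetric (g : FormField J (X := Y)) (𝓔 : X × ℝ → Y) (t : ℝ) : FormField I (X := X) :=
  firstForm I J g (fun x => 𝓔 (x, t))

/-- The coefficients in the chart centred at `x₀` of the metrics induced by the maps `𝓔(·, t)`. -/
def sliceCoeff (g : FormField J (X := Y)) (𝓔 : X × ℝ → Y) (x₀ : X) (q : E × ℝ) :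
    E →L[ℝ] E →L[ℝ] ℝ :=
  coordForm I (sliceMetric I J g 𝓔 q.2) x₀ q.1

/-- The domain of `flowRep` and `sliceCoeff`. -/
def sliceDomain (W : Set (X × ℝ)) (x₀ : X) : Set (E × ℝ) :=
  {q | q.1 ∈ (extChartAt I x₀).target ∧ ((extChartAt I x₀).symm q.1, q.2) ∈ W}

variable {I J} {W : Set (X × ℝ)} {𝓔 : X × ℝ → Y}

theorem mem_sliceDomain {x₀ x : X} {t : ℝ} (hx : x ∈ (extChartAt I x₀).source)
    (hxt : (x, t) ∈ W) : (extChartAt I x₀ x, t) ∈ sliceDomain I W x₀ := by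
  refine ⟨(extChartAt I x₀).map_source hx, ?_⟩
  change ((extChartAt I x₀).symm (extChartAt I x₀ x), t) ∈ W
  rwa [(extChartAt I x₀).left_inv hx]

theorem sliceDomain_subset (W : Set (X × ℝ)) (x₀ : X) :
    sliceDomain I W x₀ ⊆ range I ×ˢ (univ : Set ℝ) :=
  fun _ hq => ⟨extChartAt_target_subset_range x₀ hq.1, mem_univ _⟩

theorem continuousWithinAt_chartSymm_prod {x₀ : X} {q : E × ℝ}
    (hq : q.1 ∈ (extChartAt I x₀).target) :
    ContinuousWithinAt (fun q : E × ℝ => ((extChartAt I x₀).symm q.1, q.2))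
      (range I ×ˢ (univ : Set ℝ)) q := by
  refine ContinuousWithinAt.prodMk ?_ continuousWithinAt_snd
  exact (continuousAt_extChartAt_symm'' hq).continuousWithinAt.comp continuousWithinAt_fst
    (mapsTo_univ _ _)

theorem eventually_mem_target {x₀ : X} {q : E × ℝ} (hq : q.1 ∈ (extChartAt I x₀).target) :
    ∀ᶠ q' in 𝓝[range I ×ˢ (univ : Set ℝ)] q, q'.1 ∈ (extChartAt I x₀).target := by
  have h := continuousWithinAt_fst (s := range I ×ˢ (univ : Set ℝ)) (p := q)
  exact (h.tendsto_nhdsWithin fun q' hq' => hq'.1).eventually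
    (extChartAt_target_mem_nhdsWithin_of_mem hq)

theorem eventually_mem_sliceDomain (hW : IsOpen W) {x₀ : X} {q : E × ℝ}
    (hq : q ∈ sliceDomain I W x₀) :
    ∀ᶠ q' in 𝓝[range I ×ˢ (univ : Set ℝ)] q, q' ∈ sliceDomain I W x₀ := by
  filter_upwards [eventually_mem_target hq.1,
    (continuousWithinAt_chartSymm_prod hq.1).eventually (hW.mem_nhds hq.2)] with q' h1 h2
    using ⟨h1, h2⟩

theorem eventually_flow_mem_source (hW : IsOpen W) (h𝓔 : ContinuousOn 𝓔 W) {x₀ : X} {y₀ : Y}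
    {q : E × ℝ} (hq : q ∈ sliceDomain I W x₀)
    (hy : 𝓔 ((extChartAt I x₀).symm q.1, q.2) ∈ (extChartAt J y₀).source) :
    ∀ᶠ q' in 𝓝[range I ×ˢ (univ : Set ℝ)] q,
      𝓔 ((extChartAt I x₀).symm q'.1, q'.2) ∈ (extChartAt J y₀).source := by
  have h1 : ContinuousAt 𝓔 ((extChartAt I x₀).symm q.1, q.2) := h𝓔.continuousAt (hW.mem_nhds hq.2)
  have h2 := ContinuousAt.comp_continuousWithinAt (g := 𝓔)
    (f := fun q : E × ℝ => ((extChartAt I x₀).symm q.1, q.2)) h1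
    (continuousWithinAt_chartSymm_prod hq.1)
  exact h2.eventually ((isOpen_extChartAt_source y₀).mem_nhds hy)

theorem mdifferentiableAt_slice (hW : IsOpen W) (h𝓔 : ContMDiffOn (I.prod 𝓘(ℝ, ℝ)) J ∞ 𝓔 W)
    {x : X} {t : ℝ} (hxt : (x, t) ∈ W) : MDifferentiableAt I J (fun x => 𝓔 (x, t)) x := by
  have h3 : MDifferentiableAt (I.prod 𝓘(ℝ, ℝ)) J 𝓔 (x, t) :=
    (h𝓔.contMDiffAt (hW.mem_nhds hxt)).mdifferentiableAt (by simp)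
  exact h3.comp x (mdifferentiableAt_id.prodMk mdifferentiableAt_const)

theorem mdifferentiableAt_curve (hW : IsOpen W) (h𝓔 : ContMDiffOn (I.prod 𝓘(ℝ, ℝ)) J ∞ 𝓔 W)
    {x : X} {t : ℝ} (hxt : (x, t) ∈ W) : MDifferentiableAt 𝓘(ℝ, ℝ) J (fun t => 𝓔 (x, t)) t := by
  have h3 : MDifferentiableAt (I.prod 𝓘(ℝ, ℝ)) J 𝓔 (x, t) :=
    (h𝓔.contMDiffAt (hW.mem_nhds hxt)).mdifferentiableAt (by simp)
  exact h3.comp t (mdifferentiableAt_const.prodMk mdifferentiableAt_id)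

variable [IsManifold I ∞ X] [IsManifold J ∞ Y]

theorem contDiffWithinAt_flowRep (hW : IsOpen W)
    (h𝓔 : ContMDiffOn (I.prod 𝓘(ℝ, ℝ)) J ∞ 𝓔 W) {x₀ : X} {y₀ : Y} {q : E × ℝ}
    (hq : q ∈ sliceDomain I W x₀)
    (hy : 𝓔 ((extChartAt I x₀).symm q.1, q.2) ∈ (extChartAt J y₀).source) :
    ContDiffWithinAt ℝ ∞ (flowRep I J 𝓔 x₀ y₀) (range I ×ˢ (univ : Set ℝ)) q := by
  have h1 : ContMDiffWithinAt 𝓘(ℝ, E × ℝ) I ∞ (fun q : E × ℝ => (extChartAt I x₀).symm q.1)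
      (range I ×ˢ (univ : Set ℝ)) q := by
    refine ContMDiffWithinAt.comp (I' := 𝓘(ℝ, E)) (t := range I) q
      (g := (extChartAt I x₀).symm) (f := Prod.fst)
      (contMDiffWithinAt_extChartAt_symm_range x₀ hq.1)
      contDiff_fst.contMDiff.contMDiffAt.contMDiffWithinAt fun q' hq' => hq'.1
  have h2 : ContMDiffWithinAt 𝓘(ℝ, E × ℝ) 𝓘(ℝ, ℝ) ∞ (fun q : E × ℝ => q.2)
      (range I ×ˢ (univ : Set ℝ)) q := contDiff_snd.contMDiff.contMDiffAt.contMDiffWithinAt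
  have h3 : ContMDiffAt (I.prod 𝓘(ℝ, ℝ)) J ∞ 𝓔 ((extChartAt I x₀).symm q.1, q.2) :=
    h𝓔.contMDiffAt (hW.mem_nhds hq.2)
  have h4 : ContMDiffAt J 𝓘(ℝ, E') ∞ (extChartAt J y₀)
      (𝓔 ((extChartAt I x₀).symm q.1, q.2)) :=
    contMDiffAt_extChartAt' (by rwa [← extChartAt_source (I := J)])
  exact (h4.comp_contMDiffWithinAt q (h3.comp_contMDiffWithinAt q
    (h1.prodMk h2))).contDiffWithinAt

theorem fderivWithin_flowRep_inl (hW : IsOpen W)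
    (h𝓔 : ContMDiffOn (I.prod 𝓘(ℝ, ℝ)) J ∞ 𝓔 W) {x₀ : X} {y₀ : Y} {q : E × ℝ}
    (hq : q ∈ sliceDomain I W x₀)
    (hy : 𝓔 ((extChartAt I x₀).symm q.1, q.2) ∈ (extChartAt J y₀).source) :
    fderivWithin ℝ (extChartAt J y₀ ∘ (fun x => 𝓔 (x, q.2)) ∘ (extChartAt I x₀).symm) (range I) q.1
      = fderivWithin ℝ (flowRep I J 𝓔 x₀ y₀) (range I ×ˢ (univ : Set ℝ)) q
        ∘L ContinuousLinearMap.inl ℝ E ℝ := by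
  have hF := ((contDiffWithinAt_flowRep hW h𝓔 hq hy).differentiableWithinAt
    (by simp)).hasFDerivWithinAt
  have hm : MapsTo (fun z : E => (z, q.2)) (range I) (range I ×ˢ (univ : Set ℝ)) :=
    fun z hz => ⟨hz, mem_univ _⟩
  have hF' : HasFDerivWithinAt (flowRep I J 𝓔 x₀ y₀)
    (fderivWithin ℝ (flowRep I J 𝓔 x₀ y₀) (range I ×ˢ (univ : Set ℝ)) q)
    (range I ×ˢ (univ : Set ℝ)) (q.1, q.2) := hF
  have h := hF'.comp q.1 (hasFDerivAt_prodMk_left q.1 q.2).hasFDerivWithinAt hm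
  exact h.fderivWithin (I.uniqueDiffOn _ (extChartAt_target_subset_range x₀ hq.1))

theorem chartDeriv_velocity (hW : IsOpen W)
    (h𝓔 : ContMDiffOn (I.prod 𝓘(ℝ, ℝ)) J ∞ 𝓔 W) {x₀ x : X} {y₀ : Y} {t : ℝ} (hxt : (x, t) ∈ W)
    (hx : x ∈ (extChartAt I x₀).source) (hy : 𝓔 (x, t) ∈ (extChartAt J y₀).source) :
    chartDeriv J y₀ (𝓔 (x, t)) (velocity J (fun s => 𝓔 (x, s)) t)
      = fderivWithin ℝ (flowRep I J 𝓔 x₀ y₀) (range I ×ˢ (univ : Set ℝ)) (extChartAt I x₀ x, t)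
        (0, 1) := by
  have hinv := (extChartAt I x₀).left_inv hx
  have hy' : 𝓔 ((extChartAt I x₀).symm (extChartAt I x₀ x, t).1, t) ∈ (extChartAt J y₀).source := by
    simpa only [hinv] using hy
  have hF := ((contDiffWithinAt_flowRep hW h𝓔 (mem_sliceDomain hx hxt) hy').differentiableWithinAt
    (by simp)).hasFDerivWithinAt
  have hm : MapsTo (fun s : ℝ => (extChartAt I x₀ x, s)) univ (range I ×ˢ (univ : Set ℝ)) :=
    fun _ _ => ⟨extChartAt_target_subset_range x₀ ((extChartAt I x₀).map_source hx), mem_univ _⟩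
  have h := (hF.comp t (hasFDerivAt_prodMk_right _ t).hasFDerivWithinAt hm).fderivWithin
    uniqueDiffWithinAt_univ
  have h2 := fderivWithin_inCharts_chartDeriv 𝓘(ℝ, ℝ) J (φ := fun s => 𝓔 (x, s)) (x₀ := t) (x := t)
    (y₀ := y₀) (mem_extChartAt_source t) hy (mdifferentiableAt_curve hW h𝓔 hxt) (1 : ℝ)
  rw [chartDeriv_self] at h2
  refine h2.symm.trans ?_
  have h3 := DFunLike.congr_fun h (1 : ℝ)
  simp only [flowRep, Function.comp_def, hinv] at h3
  simpa [flowRep, Function.comp_def, chartAt_self_eq] using h3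

theorem chartDeriv_slice (hW : IsOpen W)
    (h𝓔 : ContMDiffOn (I.prod 𝓘(ℝ, ℝ)) J ∞ 𝓔 W) {x₀ x : X} {y₀ : Y} {t : ℝ} (hxt : (x, t) ∈ W)
    (hx : x ∈ (extChartAt I x₀).source) (hy : 𝓔 (x, t) ∈ (extChartAt J y₀).source) (v : E) :
    chartDeriv J y₀ (𝓔 (x, t)) (modelDeriv I J (fun x => 𝓔 (x, t)) x v)
      = fderivWithin ℝ (flowRep I J 𝓔 x₀ y₀) (range I ×ˢ (univ : Set ℝ)) (extChartAt I x₀ x, t)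
        (chartDeriv I x₀ x v, 0) := by
  have hinv := (extChartAt I x₀).left_inv hx
  have hy' : 𝓔 ((extChartAt I x₀).symm (extChartAt I x₀ x, t).1, t) ∈ (extChartAt J y₀).source := by
    simpa only [hinv] using hy
  have h := fderivWithin_flowRep_inl hW h𝓔 (mem_sliceDomain hx hxt) hy'
  rw [← fderivWithin_inCharts_chartDeriv I J (φ := fun x => 𝓔 (x, t)) hx hy
    (mdifferentiableAt_slice hW h𝓔 hxt)]
  exact DFunLike.congr_fun h _

theorem sliceCoeff_eq (g : FormField J (X := Y))
    (hW : IsOpen W) (h𝓔 : ContMDiffOn (I.prod 𝓘(ℝ, ℝ)) J ∞ 𝓔 W) {x₀ : X} {y₀ : Y} {q : E × ℝ}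
    (hq : q ∈ sliceDomain I W x₀)
    (hy : 𝓔 ((extChartAt I x₀).symm q.1, q.2) ∈ (extChartAt J y₀).source) :
    sliceCoeff I J g 𝓔 x₀ q = pullForm (coordForm J g y₀ (flowRep I J 𝓔 x₀ y₀ q))
      (fderivWithin ℝ (flowRep I J 𝓔 x₀ y₀) (range I ×ˢ (univ : Set ℝ)) q
        ∘L ContinuousLinearMap.inl ℝ E ℝ) := by
  rw [← fderivWithin_flowRep_inl hW h𝓔 hq hy]
  exact coordForm_firstForm I J g hq.1 hy (mdifferentiableAt_slice hW h𝓔 hq.2)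

theorem contDiffWithinAt_sliceCoeff [J.Boundaryless]
    {g : FormField J (X := Y)}
    (hg : IsSmoothForm J g)
    (hW : IsOpen W) (h𝓔 : ContMDiffOn (I.prod 𝓘(ℝ, ℝ)) J ∞ 𝓔 W) {x₀ : X} {q : E × ℝ}
    (hq : q ∈ sliceDomain I W x₀) :
    ContDiffWithinAt ℝ ∞ (sliceCoeff I J g 𝓔 x₀) (range I ×ˢ (univ : Set ℝ)) q := by
  set y₀ := 𝓔 ((extChartAt I x₀).symm q.1, q.2)
  have hy := mem_extChartAt_source (I := J) y₀
  have hF := contDiffWithinAt_flowRep hW h𝓔 (y₀ := y₀) hq hy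
  have hqs := sliceDomain_subset W x₀ hq
  have hs : UniqueDiffOn ℝ (range I ×ˢ (univ : Set ℝ)) := I.uniqueDiffOn.prod uniqueDiffOn_univ
  have hF' := hF.fderivWithin_right hs (m := ∞) (by simp) hqs
  have hG : ContDiffAt ℝ ∞ (coordForm J g y₀) (flowRep I J 𝓔 x₀ y₀ q) :=
    (contDiffOn_coordForm J hg y₀).contDiffAt (extChartAt_target_mem_nhds y₀)
  refine (contDiffWithinAt_pullForm (hG.comp_contDiffWithinAt q hF)
    (hF'.clm_comp contDiffWithinAt_const)).congr_of_eventuallyEq ?_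
    (sliceCoeff_eq g hW h𝓔 hq hy)
  filter_upwards [eventually_mem_sliceDomain hW hq,
    eventually_flow_mem_source hW h𝓔.continuousOn (y₀ := y₀) hq hy] with q' h1 h2
  exact sliceCoeff_eq g hW h𝓔 h1 h2

end Flow

/-! ### The Gauss lemma -/

section Gauss

open Topology

variable {E : Type*} [NormedAddCommGroup E] [NormedSpace ℝ E]
  {H : Type*} [TopologicalSpace H] {I : ModelWithCorners ℝ E H}
  {X : Type*} [TopologicalSpace X] [ChartedSpace H X]
  {E' : Type*} [NormedAddCommGroup E'] [NormedSpace ℝ E']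
  {H' : Type*} [TopologicalSpace H'] {J : ModelWithCorners ℝ E' H'}
  {Y : Type*} [TopologicalSpace Y] [ChartedSpace H' Y]
  {W : Set (X × ℝ)} {𝓔 : X × ℝ → Y} {g : FormField J (X := Y)}

theorem coordForm_christoffel [FiniteDimensional ℝ E'] [IsManifold J 1 Y] [J.Boundaryless] {y : Y}
    (hg : PosDefForm (FormField.model J g y)) (u v w : E') :
    coordForm J g y (extChartAt J y y) (christoffel J g y u v) w
      = koszul (fderiv ℝ (coordForm J g y) (extChartAt J y y)) u v w := by
  have hraise : christoffel J g y u v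
      = (FormField.model J g y).inverse (christoffelFirst J g y u v) := rfl
  rw [coordForm_self, hraise, hg.isInvertible.self_apply_inverse, christoffelFirst_apply, koszul,
    dCoord, J.range_eq_univ, fderivWithin_univ]

theorem contDiffAt_coordForm_center [IsManifold J ∞ Y] [J.Boundaryless] (hg : IsSmoothForm J g)
    (y : Y) : ContDiffAt ℝ ∞ (coordForm J g y) (extChartAt J y y) :=
  (contDiffOn_coordForm J hg y).contDiffAt (extChartAt_target_mem_nhds y)

variable (J) in
/-- The velocity of `𝓔(x, ·)`, as a vector of the model space. -/
def modelVelocity (𝓔 : X × ℝ → Y) (x : X) (t : ℝ) : E' := velocity J (fun s => 𝓔 (x, s)) t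

variable (I J) in
/-- The derivative of `𝓔`, as a map between model spaces. -/
def flowDeriv (𝓔 : X × ℝ → Y) (x : X) (t : ℝ) (V : E × ℝ) : E' :=
  modelDeriv I J (fun x => 𝓔 (x, t)) x V.1 + V.2 • modelVelocity J 𝓔 x t

variable (I J) in
/-- The coefficients of the metric induced by `𝓔`. -/
def flowCoeff (g : FormField J (X := Y)) (𝓔 : X × ℝ → Y) (x₀ : X) (y₀ : Y) (q : E × ℝ) :
    (E × ℝ) →L[ℝ] (E × ℝ) →L[ℝ] ℝ :=
  pullForm (coordForm J g y₀ (flowRep I J 𝓔 x₀ y₀ q))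
    (fderivWithin ℝ (flowRep I J 𝓔 x₀ y₀) (range I ×ˢ (univ : Set ℝ)) q)

theorem flowDeriv_eq_add (x : X) (t : ℝ) (V : E × ℝ) :
    flowDeriv I J 𝓔 x t V = flowDeriv I J 𝓔 x t (V.1, 0) + V.2 • flowDeriv I J 𝓔 x t (0, 1) := by
  simp [flowDeriv]

theorem flowDeriv_vertical (x : X) (t : ℝ) :
    flowDeriv I J 𝓔 x t (0, 1) = modelVelocity J 𝓔 x t := by
  simp [flowDeriv]

theorem flowDeriv_horizontal (x : X) (t : ℝ) (v : E) :
    flowDeriv I J 𝓔 x t (v, 0) = modelDeriv I J (fun x => 𝓔 (x, t)) x v := by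
  simp [flowDeriv]

theorem flowRep_center (x : X) (t : ℝ) :
    flowRep I J 𝓔 x (𝓔 (x, t)) (extChartAt I x x, t)
      = extChartAt J (𝓔 (x, t)) (𝓔 (x, t)) := by
  simp only [flowRep, (extChartAt I x).left_inv (mem_extChartAt_source x)]

theorem differentiableAt_coordForm_flowRep_center [IsManifold J ∞ Y] [J.Boundaryless]
    (hg : IsSmoothForm J g) (x : X) (t : ℝ) :
    DifferentiableAt ℝ (coordForm J g (𝓔 (x, t)))
      (flowRep I J 𝓔 x (𝓔 (x, t)) (extChartAt I x x, t)) := by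
  rw [flowRep_center]
  exact (contDiffAt_coordForm_center hg _).differentiableAt (by simp)

theorem flow_center_mem_source (x : X) (t : ℝ) :
    𝓔 ((extChartAt I x).symm (extChartAt I x x), t) ∈ (extChartAt J (𝓔 (x, t))).source := by
  rw [extChartAt_to_inv x]
  exact mem_extChartAt_source _

theorem eventually_curve_mem (hW : IsOpen W) (h𝓔 : ContMDiffOn (I.prod 𝓘(ℝ, ℝ)) J ∞ 𝓔 W)
    {x : X} {t : ℝ} (hxt : (x, t) ∈ W) :
    ∀ᶠ s in 𝓝 t, (x, s) ∈ W ∧ 𝓔 (x, s) ∈ (extChartAt J (𝓔 (x, t))).source := by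
  have hc : ContinuousAt (fun s => 𝓔 (x, s)) t :=
    (mdifferentiableAt_curve hW h𝓔 hxt).continuousAt
  exact ((by fun_prop : ContinuousAt (fun s : ℝ => (x, s)) t).eventually (hW.mem_nhds hxt)).and
    (hc.eventually ((isOpen_extChartAt_source _).mem_nhds (mem_extChartAt_source _)))

theorem hasDerivAt_vertical {V : Type*} [NormedAddCommGroup V] [NormedSpace ℝ V]
    {F : E × ℝ → V} {F' : E × ℝ →L[ℝ] V} {x : X} {t : ℝ}
    (hF : HasFDerivWithinAt F F' (range I ×ˢ (univ : Set ℝ)) (extChartAt I x x, t)) :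
    HasDerivAt (fun s => F (extChartAt I x x, s)) (F' (0, 1)) t := by
  have h := (hF.comp t (hasFDerivAt_prodMk_right _ t).hasFDerivWithinAt
    fun _ _ => ⟨mem_range_self _, mem_univ _⟩).hasFDerivAt Filter.univ_mem
  exact h.hasDerivAt.congr_deriv (by simp)

theorem flowDeriv_eq_mfderiv (hW : IsOpen W)
    (h𝓔 : ContMDiffOn (I.prod 𝓘(ℝ, ℝ)) J ∞ 𝓔 W) {x : X} {t : ℝ} (hxt : (x, t) ∈ W) (V : E × ℝ) :
    flowDeriv I J 𝓔 x t V = modelDeriv (I.prod 𝓘(ℝ, ℝ)) J 𝓔 (x, t) V := by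
  have hd : MDifferentiableAt (I.prod 𝓘(ℝ, ℝ)) J 𝓔 (x, t) :=
    (h𝓔.contMDiffAt (hW.mem_nhds hxt)).mdifferentiableAt (by simp)
  have h1 : modelDeriv (I.prod 𝓘(ℝ, ℝ)) J 𝓔 (x, t) V = modelDeriv I J (fun x => 𝓔 (x, t)) x V.1
      + modelDeriv 𝓘(ℝ, ℝ) J (fun t => 𝓔 (x, t)) t V.2 := mfderiv_prod_eq_add_apply hd
  have h2 : modelDeriv 𝓘(ℝ, ℝ) J (fun t => 𝓔 (x, t)) t V.2 = V.2 • modelVelocity J 𝓔 x t := by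
    change _ = V.2 • modelDeriv 𝓘(ℝ, ℝ) J (fun t => 𝓔 (x, t)) t 1
    rw [← map_smul, smul_eq_mul, mul_one]
  rw [h1, h2, flowDeriv]

variable {φ : X → Y} {N : (x : X) → TangentSpace J (φ x)}

theorem IsNormalExp.apply_zero (h𝓔 : IsNormalExp I J g φ N W 𝓔) (x : X) : 𝓔 (x, 0) = φ x :=
  congrArg (fun p : TangentBundle J Y => p.1) (h𝓔.initial x)

theorem IsNormalExp.modelVelocity_zero (h𝓔 : IsNormalExp I J g φ N W 𝓔) (x : X) :
    modelVelocity J 𝓔 x 0 = -(show E' from N x) :=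
  congrArg (fun p : TangentBundle J Y => (show E' from p.2)) (h𝓔.initial x)

theorem IsNormalExp.eq_of_hasDerivAt_zero (h𝓔 : IsNormalExp I J g φ N W 𝓔) {F : ℝ → ℝ} {x : X}
    (hF : ∀ t, (x, t) ∈ W → HasDerivAt F 0 t) {t : ℝ} (hxt : (x, t) ∈ W) : F t = F 0 :=
  (h𝓔.isOpen.preimage (by fun_prop : Continuous fun s : ℝ => (x, s))).is_const_of_deriv_eq_zero
    (h𝓔.ordConnected x).isPreconnected
    (fun s hs => (hF s hs).differentiableAt.differentiableWithinAt)
    (fun s hs => (hF s hs).deriv) hxt (h𝓔.zero_mem x)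

variable [IsManifold I ∞ X] [IsManifold J ∞ Y]

theorem chartDeriv_flowDeriv (hW : IsOpen W)
    (h𝓔 : ContMDiffOn (I.prod 𝓘(ℝ, ℝ)) J ∞ 𝓔 W) {x₀ x : X} {y₀ : Y} {t : ℝ} (hxt : (x, t) ∈ W)
    (hx : x ∈ (extChartAt I x₀).source) (hy : 𝓔 (x, t) ∈ (extChartAt J y₀).source) (V : E × ℝ) :
    chartDeriv J y₀ (𝓔 (x, t)) (flowDeriv I J 𝓔 x t V)
      = fderivWithin ℝ (flowRep I J 𝓔 x₀ y₀) (range I ×ˢ (univ : Set ℝ)) (extChartAt I x₀ x, t)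
        (chartDeriv I x₀ x V.1, V.2) := by
  have h1 := chartDeriv_slice hW h𝓔 hxt hx hy V.1
  have h2 : chartDeriv J y₀ (𝓔 (x, t)) (modelVelocity J 𝓔 x t) = _ :=
    chartDeriv_velocity hW h𝓔 hxt hx hy
  rw [flowDeriv, map_add, map_smul, h1, h2, ← map_smul, ← map_add]
  simp only [Prod.smul_mk, smul_zero, smul_eq_mul, mul_one, Prod.mk_add_mk, add_zero, zero_add]

theorem flowDeriv_eq_fderivWithin (hW : IsOpen W)
    (h𝓔 : ContMDiffOn (I.prod 𝓘(ℝ, ℝ)) J ∞ 𝓔 W) {x : X} {t : ℝ} (hxt : (x, t) ∈ W) (V : E × ℝ) :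
    fderivWithin ℝ (flowRep I J 𝓔 x (𝓔 (x, t))) (range I ×ˢ (univ : Set ℝ)) (extChartAt I x x, t) V
      = flowDeriv I J 𝓔 x t V := by
  have h := chartDeriv_flowDeriv hW h𝓔 hxt (mem_extChartAt_source x)
    (mem_extChartAt_source (I := J) (𝓔 (x, t))) V
  rw [chartDeriv_self, chartDeriv_self] at h
  exact h.symm

theorem flowCoeff_apply (hW : IsOpen W)
    (h𝓔 : ContMDiffOn (I.prod 𝓘(ℝ, ℝ)) J ∞ 𝓔 W) {x₀ x : X} {y₀ : Y} {t : ℝ} (hxt : (x, t) ∈ W)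
    (hx : x ∈ (extChartAt I x₀).source) (hy : 𝓔 (x, t) ∈ (extChartAt J y₀).source)
    (V V' : E × ℝ) :
    flowCoeff I J g 𝓔 x₀ y₀ (extChartAt I x₀ x, t) (chartDeriv I x₀ x V.1, V.2)
        (chartDeriv I x₀ x V'.1, V'.2)
      = FormField.model J g (𝓔 (x, t)) (flowDeriv I J 𝓔 x t V) (flowDeriv I J 𝓔 x t V') := by
  rw [flowCoeff, pullForm_apply, ← chartDeriv_flowDeriv hW h𝓔 hxt hx hy,
    ← chartDeriv_flowDeriv hW h𝓔 hxt hx hy, flowRep]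
  simp only [(extChartAt I x₀).left_inv hx]
  exact coordForm_chartDeriv J g hy _ _

theorem contDiffWithinAt_flowRep_center (hW : IsOpen W)
    (h𝓔 : ContMDiffOn (I.prod 𝓘(ℝ, ℝ)) J ∞ 𝓔 W) {x : X} {t : ℝ} (hxt : (x, t) ∈ W) :
    ContDiffWithinAt ℝ ∞ (flowRep I J 𝓔 x (𝓔 (x, t))) (range I ×ˢ (univ : Set ℝ))
      (extChartAt I x x, t) :=
  contDiffWithinAt_flowRep hW h𝓔 (mem_sliceDomain (mem_extChartAt_source x) hxt)
    (flow_center_mem_source x t)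

theorem differentiableWithinAt_fderivWithin_flowRep_center (hW : IsOpen W)
    (h𝓔 : ContMDiffOn (I.prod 𝓘(ℝ, ℝ)) J ∞ 𝓔 W) {x : X} {t : ℝ} (hxt : (x, t) ∈ W) :
    DifferentiableWithinAt ℝ
      (fderivWithin ℝ (flowRep I J 𝓔 x (𝓔 (x, t))) (range I ×ˢ (univ : Set ℝ)))
      (range I ×ˢ (univ : Set ℝ)) (extChartAt I x x, t) :=
  ((contDiffWithinAt_flowRep_center hW h𝓔 hxt).fderivWithin_right
    (I.uniqueDiffOn.prod uniqueDiffOn_univ) (m := 1) (by norm_cast)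
    ⟨mem_range_self _, mem_univ _⟩).differentiableWithinAt (by simp)

theorem geodesic_flowRep (hW : IsOpen W)
    (h𝓔 : ContMDiffOn (I.prod 𝓘(ℝ, ℝ)) J ∞ 𝓔 W) {x : X} {t : ℝ} (hxt : (x, t) ∈ W)
    (hgeo : covDerivAlong 𝓘(ℝ, ℝ) J g (fun s => 𝓔 (x, s)) (velocity J (fun s => 𝓔 (x, s))) t
      (1 : ℝ) = 0) :
    fderivWithin ℝ (fderivWithin ℝ (flowRep I J 𝓔 x (𝓔 (x, t))) (range I ×ˢ (univ : Set ℝ)))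
        (range I ×ˢ (univ : Set ℝ)) (extChartAt I x x, t) (0, 1) (0, 1)
      + christoffel J g (𝓔 (x, t)) (flowDeriv I J 𝓔 x t (0, 1)) (flowDeriv I J 𝓔 x t (0, 1))
      = 0 := by
  have hvelocity : (fun s => chartDeriv J (𝓔 (x, t)) (𝓔 (x, s)) (modelVelocity J 𝓔 x s)) =ᶠ[𝓝 t]
      fun s => fderivWithin ℝ (flowRep I J 𝓔 x (𝓔 (x, t))) (range I ×ˢ (univ : Set ℝ))
        (extChartAt I x x, s) (0, 1) := by
    filter_upwards [eventually_curve_mem hW h𝓔 hxt] with s hs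
    exact chartDeriv_velocity hW h𝓔 hs.1 (mem_extChartAt_source x) hs.2
  have hacceleration := ((hasDerivAt_vertical
    (differentiableWithinAt_fderivWithin_flowRep_center hW h𝓔 hxt).hasFDerivWithinAt).clm_apply
    (hasDerivAt_const t ((0 : E), (1 : ℝ)))).congr_of_eventuallyEq hvelocity
  have hgeo' : fderiv ℝ (fun s => chartDeriv J (𝓔 (x, t)) (𝓔 (x, s)) (modelVelocity J 𝓔 x s)) t 1
      + christoffel J g (𝓔 (x, t)) (modelVelocity J 𝓔 x t) (modelVelocity J 𝓔 x t) = 0 := by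
    rw [← mfderiv_eq_fderiv]
    exact hgeo
  rw [flowDeriv_vertical, ← hgeo', fderiv_apply_one_eq_deriv, hacceleration.deriv, map_zero,
    add_zero]

variable [J.Boundaryless]

theorem differentiableWithinAt_flowCoeff (hg : IsSmoothForm J g)
    (hW : IsOpen W) (h𝓔 : ContMDiffOn (I.prod 𝓘(ℝ, ℝ)) J ∞ 𝓔 W) {x : X} {t : ℝ}
    (hxt : (x, t) ∈ W) :
    DifferentiableWithinAt ℝ (flowCoeff I J g 𝓔 x (𝓔 (x, t))) (range I ×ˢ (univ : Set ℝ))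
      (extChartAt I x x, t) :=
  differentiableWithinAt_pullForm
    ((differentiableAt_coordForm_flowRep_center hg x t).comp_differentiableWithinAt _
      ((contDiffWithinAt_flowRep_center hW h𝓔 hxt).differentiableWithinAt (by simp)))
    (differentiableWithinAt_fderivWithin_flowRep_center hW h𝓔 hxt)

theorem hasDerivAt_flowCoeff (hg : IsSmoothForm J g)
    (hW : IsOpen W) (h𝓔 : ContMDiffOn (I.prod 𝓘(ℝ, ℝ)) J ∞ 𝓔 W) {x : X} {t : ℝ}
    (hxt : (x, t) ∈ W) (V V' : E × ℝ) :
    HasDerivAt (fun s => FormField.model J g (𝓔 (x, s)) (flowDeriv I J 𝓔 x s V)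
        (flowDeriv I J 𝓔 x s V'))
      (fderivWithin ℝ (flowCoeff I J g 𝓔 x (𝓔 (x, t))) (range I ×ˢ (univ : Set ℝ))
        (extChartAt I x x, t) (0, 1) V V') t := by
  have hderiv := ((hasDerivAt_vertical
    (differentiableWithinAt_flowCoeff hg hW h𝓔 hxt).hasFDerivWithinAt).clm_apply
    (hasDerivAt_const t V)).clm_apply (hasDerivAt_const t V')
  refine (hderiv.congr_of_eventuallyEq ?_).congr_deriv
    (by simp only [map_zero, add_zero])
  filter_upwards [eventually_curve_mem hW h𝓔 hxt] with s hs
  have h := flowCoeff_apply (g := g) hW h𝓔 hs.1 (mem_extChartAt_source x) hs.2 V V'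
  rw [chartDeriv_self] at h
  exact h.symm

variable [FiniteDimensional ℝ E']

theorem koszul_flowCoeff (hg : IsSmoothForm J g) (hpos : ∀ y, PosDefForm (FormField.model J g y))
    (hW : IsOpen W) (h𝓔 : ContMDiffOn (I.prod 𝓘(ℝ, ℝ)) J ∞ 𝓔 W) {x : X} {t : ℝ}
    (hxt : (x, t) ∈ W)
    (hgeo : covDerivAlong 𝓘(ℝ, ℝ) J g (fun s => 𝓔 (x, s)) (velocity J (fun s => 𝓔 (x, s))) t
      (1 : ℝ) = 0) (V : E × ℝ) :
    koszul (fderivWithin ℝ (flowCoeff I J g 𝓔 x (𝓔 (x, t))) (range I ×ˢ (univ : Set ℝ))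
      (extChartAt I x x, t)) (0, 1) (0, 1) V = 0 := by
  refine (koszul_induced (I.uniqueDiffOn.prod uniqueDiffOn_univ)
    (prod_univ_subset_closure_interior I.range_subset_closure_interior)
    ⟨mem_range_self _, mem_univ _⟩
    ((contDiffWithinAt_flowRep_center hW h𝓔 hxt).of_le (by norm_cast))
    (differentiableAt_coordForm_flowRep_center hg x t) ?_ (Γ := christoffel J g (𝓔 (x, t))) ?_
    (0, 1) (0, 1) V).trans ?_
  · rw [flowRep_center, coordForm_self]
    exact (hpos _).1
  · rw [flowRep_center]
    exact coordForm_christoffel (hpos _)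
  · rw [flowDeriv_eq_fderivWithin hW h𝓔 hxt, geodesic_flowRep hW h𝓔 hxt hgeo, map_zero, zero_apply]

theorem gauss_lemma_vertical_vertical (hg : IsSmoothForm J g)
    (hpos : ∀ y, PosDefForm (FormField.model J g y)) (hN : IsUnitNormal I J g φ N)
    (h𝓔 : IsNormalExp I J g φ N W 𝓔) {x : X} {t : ℝ} (hxt : (x, t) ∈ W) :
    FormField.model J g (𝓔 (x, t)) (flowDeriv I J 𝓔 x t (0, 1)) (flowDeriv I J 𝓔 x t (0, 1))
      = 1 := by
  rw [h𝓔.eq_of_hasDerivAt_zero (F := fun t => FormField.model J g (𝓔 (x, t))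
    (flowDeriv I J 𝓔 x t (0, 1)) (flowDeriv I J 𝓔 x t (0, 1))) (fun s hs => ?_) hxt]
  · let N' : X → E' := N
    have hvelocity : modelVelocity J 𝓔 x 0 = -N' x := h𝓔.modelVelocity_zero x
    have hunit : FormField.model J g (φ x) (N' x) (N' x) = 1 := hN.unit x
    rw [flowDeriv_vertical, hvelocity, h𝓔.apply_zero, map_neg, map_neg, neg_apply, neg_neg, hunit]
  · have hkoszul := koszul_flowCoeff hg hpos h𝓔.isOpen h𝓔.smooth hs (h𝓔.geodesic x s hs) (0, 1)
    rw [koszul] at hkoszul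
    exact (hasDerivAt_flowCoeff hg h𝓔.isOpen h𝓔.smooth hs (0, 1) (0, 1)).congr_deriv
      (by linarith)

theorem fderivWithin_flowCoeff_vertical_vertical (hg : IsSmoothForm J g)
    (hpos : ∀ y, PosDefForm (FormField.model J g y)) (hN : IsUnitNormal I J g φ N)
    (h𝓔 : IsNormalExp I J g φ N W 𝓔) {x : X} {t : ℝ} (hxt : (x, t) ∈ W) (V : E × ℝ) :
    fderivWithin ℝ (flowCoeff I J g 𝓔 x (𝓔 (x, t))) (range I ×ˢ (univ : Set ℝ))
      (extChartAt I x x, t) V (0, 1) (0, 1) = 0 := by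
  have hq := mem_sliceDomain (mem_extChartAt_source (I := I) x) hxt
  have hqs := sliceDomain_subset W x hq
  have hone : (fun q => flowCoeff I J g 𝓔 x (𝓔 (x, t)) q (0, 1) (0, 1))
      =ᶠ[𝓝[range I ×ˢ (univ : Set ℝ)] (extChartAt I x x, t)] fun _ => 1 := by
    filter_upwards [eventually_mem_sliceDomain h𝓔.isOpen hq,
      eventually_flow_mem_source h𝓔.isOpen h𝓔.smooth.continuousOn hq
        (flow_center_mem_source (J := J) x t)] with q hqD hqy
    have h := flowCoeff_apply (g := g) h𝓔.isOpen h𝓔.smooth hqD.2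
      ((extChartAt I x).map_target hqD.1) hqy (0, 1) (0, 1)
    rwa [(extChartAt I x).right_inv hqD.1, gauss_lemma_vertical_vertical hg hpos hN h𝓔 hqD.2,
      map_zero] at h
  rw [← fderivWithin_apply_apply (I.uniqueDiffOn.prod uniqueDiffOn_univ _ hqs)
    (differentiableWithinAt_flowCoeff hg h𝓔.isOpen h𝓔.smooth hxt),
    hone.fderivWithin_eq (hone.self_of_nhdsWithin hqs), fderivWithin_fun_const]
  rfl

theorem gauss_lemma_vertical_horizontal (hg : IsSmoothForm J g)
    (hpos : ∀ y, PosDefForm (FormField.model J g y)) (hN : IsUnitNormal I J g φ N)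
    (h𝓔 : IsNormalExp I J g φ N W 𝓔) {x : X} {t : ℝ} (hxt : (x, t) ∈ W) (v : E) :
    FormField.model J g (𝓔 (x, t)) (flowDeriv I J 𝓔 x t (0, 1)) (flowDeriv I J 𝓔 x t (v, 0))
      = 0 := by
  rw [h𝓔.eq_of_hasDerivAt_zero (F := fun t => FormField.model J g (𝓔 (x, t))
    (flowDeriv I J 𝓔 x t (0, 1)) (flowDeriv I J 𝓔 x t (v, 0))) (fun s hs => ?_) hxt]
  · let N' : X → E' := N
    have hvelocity : modelVelocity J 𝓔 x 0 = -N' x := h𝓔.modelVelocity_zero x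
    have hnormal : FormField.model J g (φ x) (N' x) (modelDeriv I J (fun x => φ x) x v) = 0 :=
      hN.normal x v
    simp only [flowDeriv_vertical, flowDeriv_horizontal, hvelocity, h𝓔.apply_zero, map_neg,
      neg_apply, hnormal, neg_zero]
  · have hkoszul := koszul_flowCoeff hg hpos h𝓔.isOpen h𝓔.smooth hs (h𝓔.geodesic x s hs) (v, 0)
    rw [koszul, fderivWithin_flowCoeff_vertical_vertical hg hpos hN h𝓔 hs] at hkoszul
    exact (hasDerivAt_flowCoeff hg h𝓔.isOpen h𝓔.smooth hs (0, 1) (v, 0)).congr_deriv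
      (by linarith)

theorem gauss_lemma (hg : IsSmoothForm J g)
    (hpos : ∀ y, PosDefForm (FormField.model J g y)) (hN : IsUnitNormal I J g φ N)
    (h𝓔 : IsNormalExp I J g φ N W 𝓔) {x : X} {t : ℝ} (hxt : (x, t) ∈ W) (V V' : E × ℝ) :
    FormField.model J g (𝓔 (x, t)) (flowDeriv I J 𝓔 x t V) (flowDeriv I J 𝓔 x t V')
      = FormField.model I (sliceMetric I J g 𝓔 t) x V.1 V'.1 + V.2 * V'.2 := by
  have hslice : FormField.model J g (𝓔 (x, t)) (flowDeriv I J 𝓔 x t (V.1, 0))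
      (flowDeriv I J 𝓔 x t (V'.1, 0)) = FormField.model I (sliceMetric I J g 𝓔 t) x V.1 V'.1 := by
    simp only [flowDeriv_horizontal]
    rfl
  rw [flowDeriv_eq_add x t V, flowDeriv_eq_add x t V', ← hslice]
  simp only [map_add, map_smul, add_apply, smul_apply, smul_eq_mul,
    gauss_lemma_vertical_vertical hg hpos hN h𝓔 hxt,
    gauss_lemma_vertical_horizontal hg hpos hN h𝓔 hxt,
    (hpos _).1 (flowDeriv I J 𝓔 x t (V.1, 0)) (flowDeriv I J 𝓔 x t (0, 1))]
  ring

end Gauss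

/-! ### Graphs and their unit normal -/

section Graph

open Topology

variable {E : Type*} [NormedAddCommGroup E] [NormedSpace ℝ E]
  {H : Type*} [TopologicalSpace H] {I : ModelWithCorners ℝ E H}
  {X : Type*} [TopologicalSpace X] [ChartedSpace H X]
  {E' : Type*} [NormedAddCommGroup E'] [NormedSpace ℝ E']
  {H' : Type*} [TopologicalSpace H'] {J : ModelWithCorners ℝ E' H'}
  {Y : Type*} [TopologicalSpace Y] [ChartedSpace H' Y]
  {W : Set (X × ℝ)} {𝓔 : X × ℝ → Y} {g : FormField J (X := Y)} {f : X → ℝ}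

theorem fderivWithin_comp_chart_chartDeriv [IsManifold I 1 X] {A : X → E'} {x₀ x : X}
    (hx : x ∈ (extChartAt I x₀).source) (hA : MDifferentiableAt I 𝓘(ℝ, E') A x) (v : E) :
    fderivWithin ℝ (A ∘ (extChartAt I x₀).symm) (range I) (extChartAt I x₀ x)
        (chartDeriv I x₀ x v)
      = modelDeriv I 𝓘(ℝ, E') A x v := by
  rw [fderivWithin_comp_chart I hx hA, chartDerivSymm_chartDeriv I hx]

theorem modelDeriv_eq_fderivWithin [IsManifold I 1 X] {A : X → E'} {x : X}
    (hA : MDifferentiableAt I 𝓘(ℝ, E') A x) :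
    modelDeriv I 𝓘(ℝ, E') A x
      = fderivWithin ℝ (A ∘ (extChartAt I x).symm) (range I) (extChartAt I x x) := by
  ext v
  have h := fderivWithin_comp_chart_chartDeriv (mem_extChartAt_source x) hA v
  rw [chartDeriv_self] at h
  exact h.symm

theorem modelDeriv_eq_fderivWithin_inCharts [IsManifold I 1 X] [IsManifold J 1 Y] {φ : X → Y}
    {x : X} (hφ : MDifferentiableAt I J φ x) :
    modelDeriv I J φ x = fderivWithin ℝ (extChartAt J (φ x) ∘ φ ∘ (extChartAt I x).symm) (range I)
      (extChartAt I x x) := by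
  ext v
  have h := fderivWithin_inCharts_chartDeriv I J (mem_extChartAt_source x)
    (mem_extChartAt_source (I := J) (φ x)) hφ v
  rw [chartDeriv_self, chartDeriv_self] at h
  exact h.symm

theorem contDiffWithinAt_comp_chart_symm [IsManifold I ∞ X] {A : X → E'}
    (hA : ContMDiff I 𝓘(ℝ, E') ∞ A) {x₀ : X} {z : E} (hz : z ∈ (extChartAt I x₀).target) :
    ContDiffWithinAt ℝ ∞ (A ∘ (extChartAt I x₀).symm) (range I) z :=
  ((hA _).comp_contMDiffWithinAt z
    (contMDiffWithinAt_extChartAt_symm_range x₀ hz)).contDiffWithinAt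

theorem modelDeriv_graph (hW : IsOpen W) (h𝓔 : ContMDiffOn (I.prod 𝓘(ℝ, ℝ)) J ∞ 𝓔 W) {x : X}
    (hf : MDifferentiableAt I 𝓘(ℝ, ℝ) f x) (hx : (x, f x) ∈ W) (v : E) :
    modelDeriv I J (graph 𝓔 f) x v
      = flowDeriv I J 𝓔 x (f x) (v, modelDeriv I 𝓘(ℝ, ℝ) f x v) := by
  have hd : MDifferentiableAt (I.prod 𝓘(ℝ, ℝ)) J 𝓔 (x, f x) :=
    (h𝓔.contMDiffAt (hW.mem_nhds hx)).mdifferentiableAt (by simp)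
  have hchain : modelDeriv I J (graph 𝓔 f) x
      = (modelDeriv (I.prod 𝓘(ℝ, ℝ)) J 𝓔 (x, f x)) ∘L
        modelDeriv I (I.prod 𝓘(ℝ, ℝ)) (fun x => (x, f x)) x :=
    mfderiv_comp x hd (mdifferentiableAt_id.prodMk hf)
  have hprod : modelDeriv I (I.prod 𝓘(ℝ, ℝ)) (fun x => (x, f x)) x
      = (modelDeriv I I id x).prod (modelDeriv I 𝓘(ℝ, ℝ) f x) :=
    mfderiv_prodMk mdifferentiableAt_id hf
  rw [hchain, hprod, flowDeriv_eq_mfderiv hW h𝓔 hx, modelDeriv_id]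
  rfl

theorem contMDiff_graph (hW : IsOpen W) (h𝓔 : ContMDiffOn (I.prod 𝓘(ℝ, ℝ)) J ∞ 𝓔 W)
    (hf : ContMDiff I 𝓘(ℝ, ℝ) ∞ f) (hx : ∀ x, (x, f x) ∈ W) :
    ContMDiff I J ∞ (graph 𝓔 f) := fun x =>
  (h𝓔.contMDiffAt (hW.mem_nhds (hx x))).comp x (contMDiffAt_id.prodMk (hf x))

section Immersion

variable (hW : IsOpen W) (h𝓔 : ContMDiffOn (I.prod 𝓘(ℝ, ℝ)) J ∞ 𝓔 W)
  (hinj : ∀ q ∈ W, Function.Injective (mfderiv (I.prod 𝓘(ℝ, ℝ)) J 𝓔 q))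

include hW h𝓔 hinj

theorem flowDeriv_injective {x : X} {t : ℝ} (hxt : (x, t) ∈ W) :
    Function.Injective (flowDeriv I J 𝓔 x t) := by
  rw [funext (flowDeriv_eq_mfderiv hW h𝓔 hxt)]
  exact hinj _ hxt

theorem flowDeriv_surjective [FiniteDimensional ℝ E] [FiniteDimensional ℝ E']
    (hdim : Module.finrank ℝ E' = Module.finrank ℝ E + 1) {x : X} {t : ℝ} (hxt : (x, t) ∈ W) :
    Function.Surjective (flowDeriv I J 𝓔 x t) := by
  have h := flowDeriv_injective hW h𝓔 hinj hxt
  rw [funext (flowDeriv_eq_mfderiv hW h𝓔 hxt)] at h ⊢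
  exact (LinearMap.injective_iff_surjective_of_finrank_eq_finrank
    (f := (modelDeriv (I.prod 𝓘(ℝ, ℝ)) J 𝓔 (x, t) : E × ℝ →ₗ[ℝ] E')) (by simp [hdim])).1 h

theorem isSmoothImmersion_graph (hf : ContMDiff I 𝓘(ℝ, ℝ) ∞ f) (hx : ∀ x, (x, f x) ∈ W) :
    IsSmoothImmersion I J (graph 𝓔 f) := by
  refine ⟨contMDiff_graph hW h𝓔 hf hx, fun x => ?_⟩
  suffices h : Function.Injective (modelDeriv I J (graph 𝓔 f) x) from h
  intro v w h
  have hfx : MDifferentiableAt I 𝓘(ℝ, ℝ) f x := (hf x).mdifferentiableAt (by simp)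
  rw [modelDeriv_graph hW h𝓔 hfx (hx x), modelDeriv_graph hW h𝓔 hfx (hx x)] at h
  exact congrArg Prod.fst (flowDeriv_injective hW h𝓔 hinj (hx x) h)

theorem posDefForm_sliceMetric (hpos : ∀ y, PosDefForm (FormField.model J g y)) {x : X} {t : ℝ}
    (hxt : (x, t) ∈ W) : PosDefForm (FormField.model I (sliceMetric I J g 𝓔 t) x) := by
  refine (hpos (𝓔 (x, t))).pullForm (L := modelDeriv I J (fun x => 𝓔 (x, t)) x) fun v w hvw => ?_
  rw [← flowDeriv_horizontal, ← flowDeriv_horizontal] at hvw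
  exact congrArg Prod.fst (flowDeriv_injective hW h𝓔 hinj hxt hvw)

theorem posDefForm_sliceCoeff [IsManifold I 1 X] (hpos : ∀ y, PosDefForm (FormField.model J g y))
    {x₀ : X} {q : E × ℝ} (hq : q ∈ sliceDomain I W x₀) :
    PosDefForm (sliceCoeff I J g 𝓔 x₀ q) := by
  rw [sliceCoeff, coordForm_eq]
  refine (posDefForm_sliceMetric hW h𝓔 hinj hpos hq.2).pullForm ?_
  exact (show Function.LeftInverse (chartDeriv I x₀ ((extChartAt I x₀).symm q.1)) _ from
    chartDeriv_chartDerivSymm I hq.1).injective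

end Immersion

theorem apply_gradient [FiniteDimensional ℝ E] {h : FormField I (X := X)} {x : X}
    (hh : PosDefForm (FormField.model I h x)) (f : X → ℝ) :
    FormField.model I h x (gradient I h f x) = modelDeriv I 𝓘(ℝ, ℝ) f x :=
  hh.isInvertible.self_apply_inverse (modelDeriv I 𝓘(ℝ, ℝ) f x)

variable (I J) in
/-- The gradient of `f` at `x` with respect to the metric of the slice `t = f x`. -/
def sliceGradient (g : FormField J (X := Y)) (𝓔 : X × ℝ → Y) (f : X → ℝ) (x : X) : E :=
  gradient I (sliceMetric I J g 𝓔 (f x)) f x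

variable (I J) in
/-- The ratio `√(1 + |∇f|²)` of the volume elements of the graph of `f` and of the slice
`t = f x`, the gradient and its norm being taken in that slice. -/
def tiltFactor (g : FormField J (X := Y)) (𝓔 : X × ℝ → Y) (f : X → ℝ) (x : X) : ℝ :=
  √(1 + modelDeriv I 𝓘(ℝ, ℝ) f x (sliceGradient I J g 𝓔 f x))

variable (I J) in
/-- The downward unit normal of the graph of `f`. -/
def graphNormal (g : FormField J (X := Y)) (𝓔 : X × ℝ → Y) (f : X → ℝ) (x : X) : E' :=
  flowDeriv I J 𝓔 x (f x)
    ((tiltFactor I J g 𝓔 f x)⁻¹ • (sliceGradient I J g 𝓔 f x, (-1 : ℝ)))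

section Tilt

variable [FiniteDimensional ℝ E] {x : X}
  (hx : PosDefForm (FormField.model I (sliceMetric I J g 𝓔 (f x)) x))

include hx

theorem modelDeriv_sliceGradient_nonneg :
    0 ≤ modelDeriv I 𝓘(ℝ, ℝ) f x (sliceGradient I J g 𝓔 f x) := by
  rw [← apply_gradient hx f]
  exact hx.nonneg _

theorem tiltFactor_pos : 0 < tiltFactor I J g 𝓔 f x :=
  Real.sqrt_pos.2 (by linarith [modelDeriv_sliceGradient_nonneg hx])

theorem tiltFactor_mul_self : tiltFactor I J g 𝓔 f x * tiltFactor I J g 𝓔 f x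
    = 1 + modelDeriv I 𝓘(ℝ, ℝ) f x (sliceGradient I J g 𝓔 f x) :=
  Real.mul_self_sqrt (by linarith [modelDeriv_sliceGradient_nonneg hx])

end Tilt

theorem eq_smul_inverse_of_unit_normal [FiniteDimensional ℝ E] {B : E →L[ℝ] E →L[ℝ] ℝ}
    (hB : PosDefForm B) {ℓ : E →L[ℝ] ℝ} {u : E} {β : ℝ} (hnormal : ∀ w, B u w + β * ℓ w = 0)
    (hunit : B u u + β * β = 1) (hβ : β < 0) :
    (u, β) = (√(1 + ℓ (B.inverse ℓ)))⁻¹ • (B.inverse ℓ, (-1 : ℝ)) := by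
  have hu : u = (-β) • B.inverse ℓ := by
    rw [← map_smul]
    refine hB.eq_inverse fun w => ?_
    rw [smul_apply, smul_eq_mul]
    linarith [hnormal w]
  have hℓu : ℓ u = -β * ℓ (B.inverse ℓ) := by
    conv_lhs => rw [hu]
    rw [map_smul, smul_eq_mul]
  have hsq : 1 + ℓ (B.inverse ℓ) = ((-β)⁻¹) ^ 2 := by
    have h := hnormal u
    rw [hℓu] at h
    rw [inv_pow, neg_sq, sq]
    exact eq_inv_of_mul_eq_one_left (by linarith)
  have hsqrt : (√(1 + ℓ (B.inverse ℓ)))⁻¹ = -β := by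
    rw [hsq, Real.sqrt_sq (by rw [inv_nonneg]; linarith), inv_inv]
  rw [hsqrt, Prod.smul_mk, ← hu, smul_eq_mul, mul_neg_one, neg_neg]

variable [IsManifold I ∞ X]

section Smooth

variable (I J) in
/-- The vector field `sliceGradient` in the chart centred at `x₀`. -/
def coordGradient (g : FormField J (X := Y)) (𝓔 : X × ℝ → Y) (f : X → ℝ) (x₀ : X) (z : E) : E :=
  (sliceCoeff I J g 𝓔 x₀ (z, f ((extChartAt I x₀).symm z))).inverse
    (fderivWithin ℝ (f ∘ (extChartAt I x₀).symm) (range I) z)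

variable (I) in
theorem contDiffWithinAt_comp_graph {V : Type*} [NormedAddCommGroup V] [NormedSpace ℝ V]
    {F : E × ℝ → V} (hf : ContMDiff I 𝓘(ℝ, ℝ) ∞ f) {x₀ : X} {z : E}
    (hz : z ∈ (extChartAt I x₀).target)
    (hF : ContDiffWithinAt ℝ ∞ F (range I ×ˢ (univ : Set ℝ))
      (z, f ((extChartAt I x₀).symm z))) :
    ContDiffWithinAt ℝ ∞ (fun z => F (z, f ((extChartAt I x₀).symm z))) (range I) z :=
  ContDiffWithinAt.comp z hF (contDiffWithinAt_id.prodMk (contDiffWithinAt_comp_chart_symm hf hz))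
    fun _ hz => ⟨hz, mem_univ _⟩

theorem contDiffWithinAt_fderivWithin_comp_chart_symm (hf : ContMDiff I 𝓘(ℝ, ℝ) ∞ f) {x₀ : X}
    {z : E} (hz : z ∈ (extChartAt I x₀).target) :
    ContDiffWithinAt ℝ ∞ (fderivWithin ℝ (f ∘ (extChartAt I x₀).symm) (range I)) (range I) z :=
  (contDiffWithinAt_comp_chart_symm hf hz).fderivWithin_right I.uniqueDiffOn (by simp)
    (extChartAt_target_subset_range x₀ hz)

variable (hW : IsOpen W) (h𝓔 : ContMDiffOn (I.prod 𝓘(ℝ, ℝ)) J ∞ 𝓔 W)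
  (hinj : ∀ q ∈ W, Function.Injective (mfderiv (I.prod 𝓘(ℝ, ℝ)) J 𝓔 q))
  (hpos : ∀ y, PosDefForm (FormField.model J g y)) [FiniteDimensional ℝ E]

include hW h𝓔 hinj hpos

theorem coordGradient_extChartAt {x₀ x : X} (hx : x ∈ (extChartAt I x₀).source)
    (hf : MDifferentiableAt I 𝓘(ℝ, ℝ) f x) (hfx : (x, f x) ∈ W) :
    coordGradient I J g 𝓔 f x₀ (extChartAt I x₀ x)
      = chartDeriv I x₀ x (sliceGradient I J g 𝓔 f x) := by
  have hB := posDefForm_sliceCoeff hW h𝓔 hinj hpos (mem_sliceDomain hx hfx)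
  rw [coordGradient, (extChartAt I x₀).left_inv hx]
  refine (hB.eq_inverse fun w => ?_).symm
  obtain ⟨w, rfl⟩ := (chartDeriv_bijective I hx).2 w
  rw [fderivWithin_comp_chart_chartDeriv hx hf,
    ← apply_gradient (posDefForm_sliceMetric hW h𝓔 hinj hpos hfx)]
  exact coordForm_chartDeriv I (sliceMetric I J g 𝓔 (f x)) hx _ _

variable [IsManifold J ∞ Y]

theorem chartDeriv_graphNormal {x₀ x : X} {y₀ : Y} (hx : x ∈ (extChartAt I x₀).source)
    (hy : graph 𝓔 f x ∈ (extChartAt J y₀).source) (hf : MDifferentiableAt I 𝓘(ℝ, ℝ) f x)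
    (hfx : (x, f x) ∈ W) :
    chartDeriv J y₀ (graph 𝓔 f x) (graphNormal I J g 𝓔 f x)
      = fderivWithin ℝ (flowRep I J 𝓔 x₀ y₀) (range I ×ˢ (univ : Set ℝ)) (extChartAt I x₀ x, f x)
        ((√(1 + fderivWithin ℝ (f ∘ (extChartAt I x₀).symm) (range I) (extChartAt I x₀ x)
            (coordGradient I J g 𝓔 f x₀ (extChartAt I x₀ x))))⁻¹ •
          (coordGradient I J g 𝓔 f x₀ (extChartAt I x₀ x), (-1 : ℝ))) := by
  refine (chartDeriv_flowDeriv hW h𝓔 hfx hx hy _).trans ?_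
  rw [coordGradient_extChartAt hW h𝓔 hinj hpos hx hf hfx,
    fderivWithin_comp_chart_chartDeriv hx hf, ← tiltFactor, Prod.smul_mk, Prod.smul_mk, map_smul]

variable [J.Boundaryless] (hg : IsSmoothForm J g) (hf : ContMDiff I 𝓘(ℝ, ℝ) ∞ f)
  (hx : ∀ x, (x, f x) ∈ W)

include hg hf hx

theorem contDiffWithinAt_coordGradient {x₀ : X} {z : E} (hz : z ∈ (extChartAt I x₀).target) :
    ContDiffWithinAt ℝ ∞ (coordGradient I J g 𝓔 f x₀) (range I) z := by
  have hq : (z, f ((extChartAt I x₀).symm z)) ∈ sliceDomain I W x₀ := ⟨hz, hx _⟩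
  exact ((posDefForm_sliceCoeff hW h𝓔 hinj hpos hq).contDiffWithinAt_inverse
    (B := fun z => sliceCoeff I J g 𝓔 x₀ (z, f ((extChartAt I x₀).symm z)))
    (contDiffWithinAt_comp_graph I hf hz (contDiffWithinAt_sliceCoeff hg hW h𝓔 hq))).clm_apply
    (contDiffWithinAt_fderivWithin_comp_chart_symm hf hz)

theorem contDiffWithinAt_inv_coord_tiltFactor {x₀ : X} {z : E}
    (hz : z ∈ (extChartAt I x₀).target) :
    ContDiffWithinAt ℝ ∞ (fun z => (√(1 + fderivWithin ℝ (f ∘ (extChartAt I x₀).symm) (range I) z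
      (coordGradient I J g 𝓔 f x₀ z)))⁻¹) (range I) z := by
  have hB := posDefForm_sliceCoeff hW h𝓔 hinj hpos
    (show (z, f ((extChartAt I x₀).symm z)) ∈ sliceDomain I W x₀ from ⟨hz, hx _⟩)
  have hone : 0 < 1 + fderivWithin ℝ (f ∘ (extChartAt I x₀).symm) (range I) z
      (coordGradient I J g 𝓔 f x₀ z) := by
    have h := hB.nonneg (coordGradient I J g 𝓔 f x₀ z)
    rw [coordGradient, hB.isInvertible.self_apply_inverse, ← coordGradient] at h
    linarith
  have hsmooth := (contDiffWithinAt_fderivWithin_comp_chart_symm hf hz).clm_apply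
    (contDiffWithinAt_coordGradient hW h𝓔 hinj hpos hg hf hx hz)
  exact ((contDiffWithinAt_const.add hsmooth).sqrt hone.ne').inv (Real.sqrt_pos.2 hone).ne'

theorem contMDiff_graphNormal : ContMDiff I J.tangent ∞
    (fun x => (⟨graph 𝓔 f x, graphNormal (E' := E') I J g 𝓔 f x⟩ : TangentBundle J Y)) := by
  intro x₀
  have hφ := contMDiff_graph hW h𝓔 hf hx
  refine contMDiffAt_totalSpace.2 ⟨hφ x₀, ?_⟩
  set y₀ := graph 𝓔 f x₀
  have hsrc := mem_extChartAt_source (I := I) x₀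
  have htgt := (extChartAt I x₀).map_source hsrc
  have hq : (extChartAt I x₀ x₀, f ((extChartAt I x₀).symm (extChartAt I x₀ x₀)))
      ∈ sliceDomain I W x₀ := ⟨htgt, hx _⟩
  have hy : 𝓔 ((extChartAt I x₀).symm (extChartAt I x₀ x₀),
      f ((extChartAt I x₀).symm (extChartAt I x₀ x₀))) ∈ (extChartAt J y₀).source := by
    rw [(extChartAt I x₀).left_inv hsrc]
    exact mem_extChartAt_source y₀
  have hF := (contDiffWithinAt_flowRep hW h𝓔 hq hy).fderivWithin_right
    (I.uniqueDiffOn.prod uniqueDiffOn_univ) (m := ∞) (by simp) (sliceDomain_subset W x₀ hq)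
  have hcoord := (contDiffWithinAt_comp_graph I hf htgt hF).clm_apply
    ((contDiffWithinAt_inv_coord_tiltFactor hW h𝓔 hinj hpos hg hf hx htgt).smul
      ((contDiffWithinAt_coordGradient hW h𝓔 hinj hpos hg hf hx htgt).prodMk
        (contDiffWithinAt_const (c := (-1 : ℝ)))))
  have hcomp := hcoord.contMDiffWithinAt.comp (I := I) x₀ (f := extChartAt I x₀) (s := univ)
    contMDiffAt_extChartAt.contMDiffWithinAt fun _ _ => mem_range_self _
  rw [contMDiffWithinAt_univ] at hcomp
  refine hcomp.congr_of_eventuallyEq ?_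
  filter_upwards [(isOpen_extChartAt_source (I := I) x₀).mem_nhds hsrc,
    hφ.continuous.continuousAt.eventually ((isOpen_extChartAt_source (I := J) y₀).mem_nhds
      (mem_extChartAt_source (I := J) y₀))] with x h1 h2
  refine (trivializationAt_tangent J h2 _).trans ((chartDeriv_graphNormal hW h𝓔 hinj hpos h1 h2
    ((hf x).mdifferentiableAt (by simp)) (hx x)).trans ?_)
  simp only [Function.comp_apply, Pi.smul_apply', (extChartAt I x₀).left_inv h1]

end Smooth

section Fermi

variable [IsManifold J ∞ Y] [J.Boundaryless] [FiniteDimensional ℝ E'] (hg : IsSmoothForm J g)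
  (hpos : ∀ y, PosDefForm (FormField.model J g y)) {φ : X → Y}
  {N : (x : X) → TangentSpace J (φ x)} (hN : IsUnitNormal I J g φ N)
  (h𝓔 : IsNormalExp I J g φ N W 𝓔)

include hg hpos hN h𝓔

theorem firstForm_graph {x : X} (hf : MDifferentiableAt I 𝓘(ℝ, ℝ) f x) (hx : (x, f x) ∈ W) :
    FormField.model I (firstForm I J g (graph 𝓔 f)) x
      = FormField.model I (sliceMetric I J g 𝓔 (f x)) x
        + (modelDeriv I 𝓘(ℝ, ℝ) f x).smulRight (modelDeriv I 𝓘(ℝ, ℝ) f x) := by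
  ext v w
  have h := gauss_lemma hg hpos hN h𝓔 hx (v, modelDeriv I 𝓘(ℝ, ℝ) f x v)
    (w, modelDeriv I 𝓘(ℝ, ℝ) f x w)
  rwa [← modelDeriv_graph h𝓔.isOpen h𝓔.smooth hf hx,
    ← modelDeriv_graph h𝓔.isOpen h𝓔.smooth hf hx] at h

variable [FiniteDimensional ℝ E]

theorem eq_graphNormal (hdim : Module.finrank ℝ E' = Module.finrank ℝ E + 1) {x : X}
    (hf : MDifferentiableAt I 𝓘(ℝ, ℝ) f x) (hx : (x, f x) ∈ W) {ν : E'}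
    (hunit : FormField.model J g (𝓔 (x, f x)) ν ν = 1)
    (hnormal : ∀ v, FormField.model J g (𝓔 (x, f x)) ν (modelDeriv I J (graph 𝓔 f) x v) = 0)
    (hdown : FormField.model J g (𝓔 (x, f x)) ν (modelVelocity J 𝓔 x (f x)) < 0) :
    ν = graphNormal I J g 𝓔 f x := by
  obtain ⟨⟨u, β⟩, rfl⟩ :=
    flowDeriv_surjective h𝓔.isOpen h𝓔.smooth h𝓔.immersive hdim hx ν
  simp only [modelDeriv_graph h𝓔.isOpen h𝓔.smooth hf hx, ← flowDeriv_vertical (I := I),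
    gauss_lemma hg hpos hN h𝓔 hx] at hunit hnormal hdown
  refine congrArg _ (eq_smul_inverse_of_unit_normal
    (posDefForm_sliceMetric h𝓔.isOpen h𝓔.smooth h𝓔.immersive hpos hx) hnormal hunit ?_)
  simpa using hdown

theorem graphNormal_unit {x : X} (hx : (x, f x) ∈ W) :
    FormField.model J g (𝓔 (x, f x)) (graphNormal I J g 𝓔 f x) (graphNormal I J g 𝓔 f x) = 1 := by
  have hB := posDefForm_sliceMetric h𝓔.isOpen h𝓔.smooth h𝓔.immersive hpos hx
  have hne := (tiltFactor_pos hB).ne'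
  rw [graphNormal, gauss_lemma hg hpos hN h𝓔 hx]
  simp only [Prod.smul_mk, map_smul, smul_apply, smul_eq_mul]
  rw [sliceGradient, apply_gradient hB, ← sliceGradient]
  field_simp
  linarith [tiltFactor_mul_self hB]

theorem graphNormal_normal {x : X} (hf : MDifferentiableAt I 𝓘(ℝ, ℝ) f x) (hx : (x, f x) ∈ W)
    (v : E) :
    FormField.model J g (𝓔 (x, f x)) (graphNormal I J g 𝓔 f x)
      (modelDeriv I J (graph 𝓔 f) x v) = 0 := by
  have hB := posDefForm_sliceMetric h𝓔.isOpen h𝓔.smooth h𝓔.immersive hpos hx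
  rw [modelDeriv_graph h𝓔.isOpen h𝓔.smooth hf hx, graphNormal, gauss_lemma hg hpos hN h𝓔 hx]
  simp only [Prod.smul_mk, map_smul, smul_apply, smul_eq_mul]
  rw [sliceGradient, apply_gradient hB]
  ring

theorem graphNormal_downward {x : X} (hx : (x, f x) ∈ W) :
    FormField.model J g (𝓔 (x, f x)) (graphNormal I J g 𝓔 f x) (modelVelocity J 𝓔 x (f x)) < 0 := by
  have hB := posDefForm_sliceMetric h𝓔.isOpen h𝓔.smooth h𝓔.immersive hpos hx
  rw [← flowDeriv_vertical (I := I), graphNormal, gauss_lemma hg hpos hN h𝓔 hx]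
  simp only [Prod.smul_mk, map_zero, smul_eq_mul, mul_one, zero_add, mul_neg, Left.neg_neg_iff]
  exact inv_pos.2 (tiltFactor_pos hB)

theorem isDownwardNormal_graphNormal (hf : ContMDiff I 𝓘(ℝ, ℝ) ∞ f) (hx : ∀ x, (x, f x) ∈ W) :
    IsDownwardNormal I J g 𝓔 f (graphNormal I J g 𝓔 f) where
  smooth := contMDiff_graphNormal h𝓔.isOpen h𝓔.smooth h𝓔.immersive hpos hg hf hx
  unit x := graphNormal_unit hg hpos hN h𝓔 (hx x)
  normal x := graphNormal_normal hg hpos hN h𝓔 ((hf x).mdifferentiableAt (by simp)) (hx x)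
  downward x := graphNormal_downward hg hpos hN h𝓔 (hx x)

end Fermi

end Graph

/-! ### The second fundamental form of a graph -/

section GraphCurvature

open Topology

variable {E : Type*} [NormedAddCommGroup E] [NormedSpace ℝ E]
  {H : Type*} [TopologicalSpace H] {I : ModelWithCorners ℝ E H}
  {X : Type*} [TopologicalSpace X] [ChartedSpace H X]
  {E' : Type*} [NormedAddCommGroup E'] [NormedSpace ℝ E']
  {H' : Type*} [TopologicalSpace H'] {J : ModelWithCorners ℝ E' H'}
  {Y : Type*} [TopologicalSpace Y] [ChartedSpace H' Y]
  {W : Set (X × ℝ)} {𝓔 : X × ℝ → Y} {g : FormField J (X := Y)}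

variable (J) in
/-- A vector field `ν` along `φ`, read in the chart of the target centred at `φ x₀`. -/
def coordAlong (φ : X → Y) (ν : X → E') (x₀ x : X) : E' := chartDeriv J (φ x₀) (φ x) (ν x)

variable (I J) in
/-- The form `Ψ` in the chart centred at `x₀`, at `r = (x, t, p)`. -/
def graphTensor (g : FormField J (X := Y)) (𝓔 : X × ℝ → Y) (x₀ : X) (r : E × ℝ × E) :
    E →L[ℝ] E →L[ℝ] ℝ :=
  let Q := sliceCoeff I J g 𝓔 x₀
  let DQ := fderivWithin ℝ Q (range I ×ˢ (univ : Set ℝ))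
  graphForm (Q (r.1, 0)) (Q (r.1, r.2.1)) (DQ (r.1, 0) ∘L ContinuousLinearMap.inl ℝ E ℝ)
    (DQ (r.1, r.2.1) ∘L ContinuousLinearMap.inl ℝ E ℝ) (DQ (r.1, r.2.1) (0, 1)) r.2.2

variable (I J) in
/-- The function `ψ` in the chart centred at `x₀`, at `r = (x, t, p)`. -/
def graphScale (g : FormField J (X := Y)) (𝓔 : X × ℝ → Y) (x₀ : X) (r : E × ℝ × E) : ℝ :=
  graphFactor (sliceCoeff I J g 𝓔 x₀ (r.1, 0)) (sliceCoeff I J g 𝓔 x₀ (r.1, r.2.1)) r.2.2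

variable (I J) in
/-- The form `Ψ(x, t, p)` of the proposition. -/
def graphTensorAt (g : FormField J (X := Y)) (𝓔 : X × ℝ → Y) (x : X) (t : ℝ) (p : E) :
    E →L[ℝ] E →L[ℝ] ℝ :=
  graphTensor I J g 𝓔 x (extChartAt I x x, t, p)

variable (I J) in
/-- The function `ψ(x, t, p)` of the proposition. -/
def graphScaleAt (g : FormField J (X := Y)) (𝓔 : X × ℝ → Y) (x : X) (t : ℝ) (p : E) : ℝ :=
  graphScale I J g 𝓔 x (extChartAt I x x, t, p)

theorem sliceCoeff_center [IsManifold I 1 X] (g : FormField J (X := Y)) (x : X) (t : ℝ) :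
    sliceCoeff I J g 𝓔 x (extChartAt I x x, t)
      = FormField.model I (sliceMetric I J g 𝓔 t) x :=
  coordForm_self I _ x

theorem hessian_apply [FiniteDimensional ℝ E] {h : FormField I (X := X)} {x : X}
    (hh : PosDefForm (FormField.model I h x)) (f : X → ℝ) (v w : E) :
    hessian I h f x v w
      = fderivWithin ℝ (fderivWithin ℝ (f ∘ (extChartAt I x).symm) (range I)) (range I)
          (extChartAt I x x) v w - koszul (dCoord I h x) v w (gradient I h f x) := by
  have hdef : hessian I h f x v w
      = fderivWithin ℝ (fderivWithin ℝ (f ∘ (extChartAt I x).symm) (range I)) (range I)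
          (extChartAt I x x) v w
        - modelDeriv I 𝓘(ℝ, ℝ) f x
          ((FormField.model I h x).inverse (christoffelFirst I h x v w)) := rfl
  have hkoszul : christoffelFirst I h x v w
      ((FormField.model I h x).inverse (modelDeriv I 𝓘(ℝ, ℝ) f x))
      = koszul (dCoord I h x) v w (gradient I h f x) := christoffelFirst_apply I h x v w _
  rw [hdef, hh.inverse_symm, hkoszul]

theorem shift_gradient [FiniteDimensional ℝ E] {x : X} {f : X → ℝ}
    (hx : PosDefForm (FormField.model I (sliceMetric I J g 𝓔 0) x)) :
    shift (FormField.model I (sliceMetric I J g 𝓔 0) x)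
        (FormField.model I (sliceMetric I J g 𝓔 (f x)) x)
        (gradient I (sliceMetric I J g 𝓔 0) f x)
      = sliceGradient I J g 𝓔 f x :=
  congrArg (FormField.model I (sliceMetric I J g 𝓔 (f x)) x).inverse (apply_gradient hx f)

variable [IsManifold J ∞ Y]

theorem mdifferentiableAt_coordAlong {φ : X → Y} {ν : X → E'}
    (hν : ContMDiff I J.tangent ∞ (fun x => (⟨φ x, ν x⟩ : TangentBundle J Y))) (x : X) :
    MDifferentiableAt I 𝓘(ℝ, E') (coordAlong J φ ν x) x := by
  obtain ⟨hφ, hcoord⟩ := contMDiffAt_totalSpace.1 (hν x)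
  refine (hcoord.mdifferentiableAt (by simp)).congr_of_eventuallyEq ?_
  filter_upwards [hφ.continuousAt.eventually
    ((isOpen_extChartAt_source (I := J) (φ x)).mem_nhds (mem_extChartAt_source (φ x)))] with x' hx'
  exact (trivializationAt_tangent J hx' (ν x')).symm

variable [IsManifold I ∞ X]

theorem secondForm_apply {φ : X → Y} {ν : X → E'} {x : X} (hφ : MDifferentiableAt I J φ x)
    (hν : ContMDiff I J.tangent ∞ (fun x => (⟨φ x, ν x⟩ : TangentBundle J Y))) (v w : E) :
    secondForm I J g φ ν x v w
      = FormField.model J g (φ x)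
        (fderivWithin ℝ (coordAlong J φ ν x ∘ (extChartAt I x).symm) (range I)
            (extChartAt I x x) v
          + christoffel J g (φ x) (fderivWithin ℝ (extChartAt J (φ x) ∘ φ ∘ (extChartAt I x).symm)
            (range I) (extChartAt I x x) v) (ν x))
        (fderivWithin ℝ (extChartAt J (φ x) ∘ φ ∘ (extChartAt I x).symm)
          (range I) (extChartAt I x x) w) := by
  rw [← modelDeriv_eq_fderivWithin (mdifferentiableAt_coordAlong hν x),
    ← modelDeriv_eq_fderivWithin_inCharts hφ]
  rfl

theorem eventually_coordAlong_normal {φ : X → Y} (hφ : ContMDiff I J ∞ φ) {ν : X → E'}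
    (hν : ∀ x v, FormField.model J g (φ x) (ν x) (modelDeriv I J φ x v) = 0) (x : X) :
    ∀ᶠ z in 𝓝[range I] (extChartAt I x x), ∀ w,
      coordForm J g (φ x) (extChartAt J (φ x) (φ ((extChartAt I x).symm z)))
        ((coordAlong J φ ν x ∘ (extChartAt I x).symm) z)
        (fderivWithin ℝ (extChartAt J (φ x) ∘ φ ∘ (extChartAt I x).symm) (range I) z w) = 0 := by
  have hcont : ContinuousWithinAt (fun z => φ ((extChartAt I x).symm z)) (range I)
      (extChartAt I x x) :=
    hφ.continuous.continuousAt.comp_continuousWithinAt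
      (continuousAt_extChartAt_symm x).continuousWithinAt
  have hmem : φ ((extChartAt I x).symm (extChartAt I x x)) ∈ (extChartAt J (φ x)).source := by
    rw [extChartAt_to_inv x]
    exact mem_extChartAt_source _
  filter_upwards [extChartAt_target_mem_nhdsWithin x,
    hcont.eventually ((isOpen_extChartAt_source _).mem_nhds hmem)] with z hz hφz w
  have hderiv := fderivWithin_inCharts I J (φ := φ) ((extChartAt I x).map_target hz) hφz
    ((hφ _).mdifferentiableAt (by simp)) w
  rw [(extChartAt I x).right_inv hz] at hderiv
  rw [hderiv]
  exact (coordForm_chartDeriv J g hφz _ _).trans (hν _ _)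

variable [J.Boundaryless]

theorem dCoord_sliceMetric (hg : IsSmoothForm J g) (hW : IsOpen W)
    (h𝓔 : ContMDiffOn (I.prod 𝓘(ℝ, ℝ)) J ∞ 𝓔 W) {x : X} {t : ℝ} (hxt : (x, t) ∈ W) :
    dCoord I (sliceMetric I J g 𝓔 t) x
      = fderivWithin ℝ (sliceCoeff I J g 𝓔 x) (range I ×ˢ (univ : Set ℝ)) (extChartAt I x x, t)
        ∘L ContinuousLinearMap.inl ℝ E ℝ := by
  have hQ := ((contDiffWithinAt_sliceCoeff hg hW h𝓔
    (mem_sliceDomain (mem_extChartAt_source (I := I) x) hxt)).differentiableWithinAt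
      (by simp)).hasFDerivWithinAt
  have hmaps : MapsTo (fun z : E => (z, t)) (range I) (range I ×ˢ (univ : Set ℝ)) :=
    fun _ hz => ⟨hz, mem_univ _⟩
  exact (hQ.comp (extChartAt I x x) (hasFDerivAt_prodMk_left _ t).hasFDerivWithinAt
    hmaps).fderivWithin (I.uniqueDiffOn _ (mem_range_self _))

theorem hessian_add_graphTensorAt [FiniteDimensional ℝ E] (hg : IsSmoothForm J g) (hW : IsOpen W)
    (h𝓔 : ContMDiffOn (I.prod 𝓘(ℝ, ℝ)) J ∞ 𝓔 W) {x : X} (h₀ : (x, 0) ∈ W)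
    (hB₀ : PosDefForm (FormField.model I (sliceMetric I J g 𝓔 0) x)) (f : X → ℝ) (v w : E) :
    let DQ := fderivWithin ℝ (sliceCoeff I J g 𝓔 x) (range I ×ˢ (univ : Set ℝ))
      (extChartAt I x x, f x)
    let p := sliceGradient I J g 𝓔 f x
    hessian I (sliceMetric I J g 𝓔 0) f x v w
        + graphTensorAt I J g 𝓔 x (f x) (gradient I (sliceMetric I J g 𝓔 0) f x) v w
      = fderivWithin ℝ (fderivWithin ℝ (f ∘ (extChartAt I x).symm) (range I)) (range I)
          (extChartAt I x x) v w
        - koszul (DQ ∘L ContinuousLinearMap.inl ℝ E ℝ) v w p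
        - (DQ (0, 1) v w + modelDeriv I 𝓘(ℝ, ℝ) f x v * DQ (0, 1) w p
          + modelDeriv I 𝓘(ℝ, ℝ) f x w * DQ (0, 1) v p) / 2 := by
  intro DQ p
  unfold graphTensorAt graphTensor
  rw [hessian_apply hB₀, graphForm_apply, dCoord_sliceMetric hg hW h𝓔 h₀]
  simp only [sliceCoeff_center, shift_gradient hB₀, apply_gradient hB₀]
  ring

variable [FiniteDimensional ℝ E'] (hg : IsSmoothForm J g)
  (hpos : ∀ y, PosDefForm (FormField.model J g y)) {φ : X → Y}
  {N : (x : X) → TangentSpace J (φ x)} (hN : IsUnitNormal I J g φ N)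
  (h𝓔 : IsNormalExp I J g φ N W 𝓔)

include hg hpos hN h𝓔

theorem eventually_flowCoeff_eq_fermi {x : X} {t : ℝ} (hxt : (x, t) ∈ W) :
    ∀ᶠ q in 𝓝[range I ×ˢ (univ : Set ℝ)] (extChartAt I x x, t), ∀ V V' : E × ℝ,
      flowCoeff I J g 𝓔 x (𝓔 (x, t)) q V V' = sliceCoeff I J g 𝓔 x q V.1 V'.1 + V.2 * V'.2 := by
  have hq := mem_sliceDomain (mem_extChartAt_source (I := I) x) hxt
  filter_upwards [eventually_mem_sliceDomain h𝓔.isOpen hq,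
    eventually_flow_mem_source h𝓔.isOpen h𝓔.smooth.continuousOn hq
      (flow_center_mem_source (J := J) x t)] with q hmem hsource V V'
  have h := flowCoeff_apply (g := g) h𝓔.isOpen h𝓔.smooth hmem.2
    ((extChartAt I x).map_target hmem.1) hsource
    (chartDerivSymm I x q.1 V.1, V.2) (chartDerivSymm I x q.1 V'.1, V'.2)
  rw [gauss_lemma hg hpos hN h𝓔 hmem.2] at h
  simp only [chartDeriv_chartDerivSymm I hmem.1, (extChartAt I x).right_inv hmem.1] at h
  exact h

variable [FiniteDimensional ℝ E] {f : X → ℝ}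

theorem secondForm_graph (hdim : Module.finrank ℝ E' = Module.finrank ℝ E + 1)
    (hf : ContMDiff I 𝓘(ℝ, ℝ) ∞ f) (hx : ∀ x, (x, f x) ∈ W) {ν : X → E'}
    (hν : IsDownwardNormal I J g 𝓔 f ν) (x : X) (v w : E) :
    secondForm I J g (graph 𝓔 f) ν x v w
      = (tiltFactor I J g 𝓔 f x)⁻¹ *
        (hessian I (sliceMetric I J g 𝓔 0) f x v w
          + graphTensorAt I J g 𝓔 x (f x) (gradient I (sliceMetric I J g 𝓔 0) f x) v w) := by
  have hfx : MDifferentiableAt I 𝓘(ℝ, ℝ) f x := (hf x).mdifferentiableAt (by simp)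
  have hφ := contMDiff_graph h𝓔.isOpen h𝓔.smooth hf hx
  have hfa : (f ∘ (extChartAt I x).symm) (extChartAt I x x) = f x :=
    congrArg f (extChartAt_to_inv x)
  have hNa : (coordAlong J (graph 𝓔 f) ν x ∘ (extChartAt I x).symm) (extChartAt I x x) = ν x := by
    simp only [Function.comp_apply, extChartAt_to_inv, coordAlong, chartDeriv_self]
    rfl
  have hνx := eq_graphNormal hg hpos hN h𝓔 hdim hfx (hx x) (hν.unit x) (hν.normal x)
    (hν.downward x)
  rw [graphNormal, ← flowDeriv_eq_fderivWithin h𝓔.isOpen h𝓔.smooth (hx x), ← hNa] at hνx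
  have hfermi := eventually_flowCoeff_eq_fermi hg hpos hN h𝓔 (hx x)
  have hcenter := flowRep_center (I := I) (J := J) (𝓔 := 𝓔) x (f x)
  have hF := (contDiffWithinAt_flowRep_center h𝓔.isOpen h𝓔.smooth (hx x)).of_le
    (m := 2) (by norm_cast)
  have hG := differentiableAt_coordForm_flowRep_center (I := I) (𝓔 := 𝓔) hg x (f x)
  have hQ := (contDiffWithinAt_sliceCoeff hg h𝓔.isOpen h𝓔.smooth
    (mem_sliceDomain (mem_extChartAt_source (I := I) x) (hx x))).differentiableWithinAt
      (n := ∞) (by simp)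
  have hΓ := coordForm_christoffel (g := g) (hpos (𝓔 (x, f x)))
  rw [← hcenter] at hΓ
  have key := secondForm_fermi I.uniqueDiffOn I.range_subset_closure_interior
    (a := extChartAt I x x) (mem_range_self _) (f := f ∘ (extChartAt I x).symm)
    (F := flowRep I J 𝓔 x (𝓔 (x, f x))) (G := coordForm J g (𝓔 (x, f x)))
    (Q := sliceCoeff I J g 𝓔 x) (Γ := christoffel J g (𝓔 (x, f x)))
    ((contDiffWithinAt_comp_chart_symm hf (mem_extChartAt_target x)).of_le (by norm_cast))
    (by rwa [hfa]) (by rwa [hfa]) (Filter.Eventually.of_forall fun y v w => (hpos _).1 _ _)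
    (by rwa [hfa]) (by rwa [hfa]) (by rwa [hfa])
    (differentiableWithinAt_comp_chart I (mem_extChartAt_source x)
      (mdifferentiableAt_coordAlong hν.smooth x))
    (eventually_coordAlong_normal hφ hν.normal x) (by rwa [hfa]) v w
  rw [hfa, hcenter, coordForm_self, hNa] at key
  rw [secondForm_apply ((hφ x).mdifferentiableAt (by simp)) hν.smooth v w,
    hessian_add_graphTensorAt hg h𝓔.isOpen h𝓔.smooth (h𝓔.zero_mem x)
      (posDefForm_sliceMetric h𝓔.isOpen h𝓔.smooth h𝓔.immersive hpos (h𝓔.zero_mem x)),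
    modelDeriv_eq_fderivWithin hfx]
  exact key

end GraphCurvature

/-! ### Dependence of the graph tensor on the base point -/

section ChartChange

open Topology

theorem fderivWithin_pullForm_fderivWithin {E E' : Type*}
    [NormedAddCommGroup E] [NormedSpace ℝ E] [NormedAddCommGroup E'] [NormedSpace ℝ E']
    {D : Set E} {D' : Set E'} (hD : UniqueDiffOn ℝ D) {τ : E → E'} {a : E} (ha : a ∈ D)
    (hτ : ContDiffWithinAt ℝ 2 τ D a) (hm : MapsTo τ D D') {t : ℝ}
    {Q : E' × ℝ → E' →L[ℝ] E' →L[ℝ] ℝ}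
    (hQ : DifferentiableWithinAt ℝ Q (D' ×ˢ univ) (τ a, t)) (u : E × ℝ) (v w : E) :
    fderivWithin ℝ (fun q : E × ℝ => pullForm (Q (τ q.1, q.2)) (fderivWithin ℝ τ D q.1))
        (D ×ˢ univ) (a, t) u v w
      = fderivWithin ℝ Q (D' ×ˢ univ) (τ a, t) (fderivWithin ℝ τ D a u.1, u.2)
          (fderivWithin ℝ τ D a v) (fderivWithin ℝ τ D a w)
        + Q (τ a, t) (fderivWithin ℝ (fderivWithin ℝ τ D) D a u.1 v) (fderivWithin ℝ τ D a w)
        + Q (τ a, t) (fderivWithin ℝ τ D a v)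
          (fderivWithin ℝ (fderivWithin ℝ τ D) D a u.1 w) := by
  have hfst : HasFDerivWithinAt (Prod.fst : E × ℝ → E) (ContinuousLinearMap.fst ℝ E ℝ)
      (D ×ˢ univ) (a, t) := hasFDerivAt_fst.hasFDerivWithinAt
  have hfst_maps : MapsTo (Prod.fst : E × ℝ → E) (D ×ˢ univ) D := fun _ hq => hq.1
  have hτ_deriv := (hτ.differentiableWithinAt (by simp)).hasFDerivWithinAt.comp (a, t) hfst
    hfst_maps
  have hτ_deriv₂ := (hasFDerivWithinAt_fderivWithin hD ha hτ).comp (a, t) hfst hfst_maps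
  have hmaps : MapsTo (fun q : E × ℝ => (τ q.1, q.2)) (D ×ˢ univ) (D' ×ˢ univ) :=
    fun _ hq => ⟨hm hq.1, mem_univ _⟩
  have hQ_deriv := hQ.hasFDerivWithinAt.comp (a, t)
    (hτ_deriv.prodMk hasFDerivAt_snd.hasFDerivWithinAt) hmaps
  exact fderivWithin_pullForm ((hD.prod uniqueDiffOn_univ) _ ⟨ha, mem_univ _⟩) hQ_deriv hτ_deriv₂
    u v w

variable {E : Type*} [NormedAddCommGroup E] [NormedSpace ℝ E]
  {H : Type*} [TopologicalSpace H] {I : ModelWithCorners ℝ E H}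
  {X : Type*} [TopologicalSpace X] [ChartedSpace H X] [IsManifold I ∞ X]
  {E' : Type*} [NormedAddCommGroup E'] [NormedSpace ℝ E']
  {H' : Type*} [TopologicalSpace H'] {J : ModelWithCorners ℝ E' H'}
  {Y : Type*} [TopologicalSpace Y] [ChartedSpace H' Y]
  {W : Set (X × ℝ)} {𝓔 : X × ℝ → Y} {g : FormField J (X := Y)}

variable (I) in
/-- The second derivative at `x` of the transition map from the chart centred at `x` to the chart
centred at `x₀`. -/
def transitionHessian (x₀ x : X) : E →L[ℝ] E →L[ℝ] E :=
  fderivWithin ℝ (fderivWithin ℝ (extChartAt I x₀ ∘ (extChartAt I x).symm) (range I)) (range I)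
    (extChartAt I x x)

theorem contDiffWithinAt_transition {x₀ x : X} (hx : x ∈ (extChartAt I x₀).source) :
    ContDiffWithinAt ℝ ∞ (extChartAt I x₀ ∘ (extChartAt I x).symm) (range I)
      (extChartAt I x x) :=
  contDiffWithinAt_ext_coord_change x₀ x <| by
    rw [PartialEquiv.trans_source, PartialEquiv.symm_source]
    exact ⟨mem_extChartAt_target x, by rwa [mem_preimage, extChartAt_to_inv]⟩

theorem transitionHessian_symm {x₀ x : X} (hx : x ∈ (extChartAt I x₀).source) (v w : E) :
    transitionHessian I x₀ x v w = transitionHessian I x₀ x w v :=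
  (contDiffWithinAt_transition hx).isSymmSndFDerivWithinAt (by simp; norm_cast) I.uniqueDiffOn
    (I.range_subset_closure_interior (mem_range_self _)) (mem_range_self _) v w

theorem sliceCoeff_change (g : FormField J (X := Y)) (𝓔 : X × ℝ → Y) {x₀ x : X}
    (hx : x ∈ (extChartAt I x₀).source) (t : ℝ) :
    sliceCoeff I J g 𝓔 x (extChartAt I x x, t)
      = pullForm (sliceCoeff I J g 𝓔 x₀ (extChartAt I x₀ x, t)) (chartDeriv I x₀ x) := by
  have h := coordForm_change I (sliceMetric I J g 𝓔 t) (x₀ := x₀) (x₁ := x)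
    (mem_extChartAt_target x) (by rwa [extChartAt_to_inv])
  rw [fderivWithin_chart_change I hx, extChartAt_to_inv] at h
  exact h

theorem eventually_sliceCoeff_change (g : FormField J (X := Y)) (𝓔 : X × ℝ → Y) {x₀ x : X}
    (hx : x ∈ (extChartAt I x₀).source) (t : ℝ) :
    ∀ᶠ q in 𝓝[range I ×ˢ (univ : Set ℝ)] (extChartAt I x x, t),
      sliceCoeff I J g 𝓔 x q
        = pullForm (sliceCoeff I J g 𝓔 x₀
            ((extChartAt I x₀ ∘ (extChartAt I x).symm) q.1, q.2))
          (fderivWithin ℝ (extChartAt I x₀ ∘ (extChartAt I x).symm) (range I) q.1) := by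
  have htarget : (extChartAt I x x, t).1 ∈ (extChartAt I x).target := mem_extChartAt_target x
  have hsource : (extChartAt I x).symm (extChartAt I x x, t).1 ∈ (extChartAt I x₀).source := by
    rwa [extChartAt_to_inv]
  filter_upwards [eventually_mem_target htarget,
    (continuousWithinAt_chartSymm_prod htarget).fst.eventually
      ((isOpen_extChartAt_source x₀).mem_nhds hsource)] with q hq hq₀
  exact coordForm_change I (sliceMetric I J g 𝓔 q.2) hq hq₀

section Smooth

variable [IsManifold J ∞ Y] [J.Boundaryless] (hg : IsSmoothForm J g) (hW : IsOpen W)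
  (h𝓔 : ContMDiffOn (I.prod 𝓘(ℝ, ℝ)) J ∞ 𝓔 W)

include hg hW h𝓔

theorem fderivWithin_sliceCoeff_change {x₀ x : X} {t : ℝ} (hx : x ∈ (extChartAt I x₀).source)
    (hxt : (x, t) ∈ W) (u : E × ℝ) (v w : E) :
    fderivWithin ℝ (sliceCoeff I J g 𝓔 x) (range I ×ˢ (univ : Set ℝ)) (extChartAt I x x, t) u v w
      = fderivWithin ℝ (sliceCoeff I J g 𝓔 x₀) (range I ×ˢ (univ : Set ℝ))
          (extChartAt I x₀ x, t) (chartDeriv I x₀ x u.1, u.2) (chartDeriv I x₀ x v)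
          (chartDeriv I x₀ x w)
        + sliceCoeff I J g 𝓔 x₀ (extChartAt I x₀ x, t) (transitionHessian I x₀ x u.1 v)
          (chartDeriv I x₀ x w)
        + sliceCoeff I J g 𝓔 x₀ (extChartAt I x₀ x, t) (chartDeriv I x₀ x v)
          (transitionHessian I x₀ x u.1 w) := by
  have hcenter : (extChartAt I x₀ ∘ (extChartAt I x).symm) (extChartAt I x x) = extChartAt I x₀ x :=
    congrArg (extChartAt I x₀) (extChartAt_to_inv x)
  have hQ := (contDiffWithinAt_sliceCoeff hg hW h𝓔 (mem_sliceDomain hx hxt)).differentiableWithinAt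
    (n := ∞) (by simp)
  rw [← hcenter] at hQ
  have hchange := eventually_sliceCoeff_change (J := J) g 𝓔 hx t
  rw [Filter.EventuallyEq.fderivWithin_eq hchange
      (hchange.self_of_nhdsWithin ⟨mem_range_self _, mem_univ _⟩),
    fderivWithin_pullForm_fderivWithin (D' := range I) I.uniqueDiffOn
      (a := extChartAt I x x) (mem_range_self _)
      ((contDiffWithinAt_transition hx).of_le (by norm_cast)) (fun z _ => mem_range_self _) hQ,
    hcenter, fderivWithin_chart_change I hx]
  rfl

theorem contDiffOn_sliceCoeff_comp {x₀ : X} {Z : Type*} [NormedAddCommGroup Z] [NormedSpace ℝ Z]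
    {s : Set Z} {φ : Z → E × ℝ} (hφ : ContDiffOn ℝ ∞ φ s) (hs : MapsTo φ s (sliceDomain I W x₀)) :
    ContDiffOn ℝ ∞ (fun z => sliceCoeff I J g 𝓔 x₀ (φ z)) s := fun z hz =>
  (contDiffWithinAt_sliceCoeff hg hW h𝓔 (hs hz)).comp z (hφ z hz)
    (hs.mono_right (sliceDomain_subset W x₀))

theorem contDiffOn_fderivWithin_sliceCoeff_comp {x₀ : X} {Z : Type*} [NormedAddCommGroup Z]
    [NormedSpace ℝ Z] {s : Set Z} {φ : Z → E × ℝ} (hφ : ContDiffOn ℝ ∞ φ s)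
    (hs : MapsTo φ s (sliceDomain I W x₀)) :
    ContDiffOn ℝ ∞ (fun z => fderivWithin ℝ (sliceCoeff I J g 𝓔 x₀)
      (range I ×ˢ (univ : Set ℝ)) (φ z)) s := fun z hz =>
  ((contDiffWithinAt_sliceCoeff hg hW h𝓔 (hs hz)).fderivWithin_right
    (I.uniqueDiffOn.prod uniqueDiffOn_univ) (m := ∞) (by simp)
    (sliceDomain_subset W x₀ (hs hz))).comp z (hφ z hz) (hs.mono_right (sliceDomain_subset W x₀))

end Smooth

variable [FiniteDimensional ℝ E] (hpos : ∀ y, PosDefForm (FormField.model J g y))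
  (hW : IsOpen W) (h𝓔 : ContMDiffOn (I.prod 𝓘(ℝ, ℝ)) J ∞ 𝓔 W)
  (hinj : ∀ q ∈ W, Function.Injective (mfderiv (I.prod 𝓘(ℝ, ℝ)) J 𝓔 q)) (h₀ : ∀ x, (x, 0) ∈ W)

include hpos hW h𝓔 hinj h₀

theorem graphScaleAt_eq_graphScale {x₀ x : X} {t : ℝ} (hx : x ∈ (extChartAt I x₀).source)
    (hxt : (x, t) ∈ W) (p : E) :
    graphScaleAt I J g 𝓔 x t p
      = graphScale I J g 𝓔 x₀ (extChartAt I x₀ x, t, chartDeriv I x₀ x p) := by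
  simp only [graphScaleAt, graphScale, sliceCoeff_change g 𝓔 hx]
  exact graphFactor_pull (posDefForm_sliceCoeff hW h𝓔 hinj hpos (mem_sliceDomain hx (h₀ x)))
    (posDefForm_sliceCoeff hW h𝓔 hinj hpos (mem_sliceDomain hx hxt)) (chartDeriv_bijective I hx) p

variable [IsManifold J ∞ Y] [J.Boundaryless] (hg : IsSmoothForm J g)

include hg

theorem graphTensorAt_eq_pullForm {x₀ x : X} {t : ℝ} (hx : x ∈ (extChartAt I x₀).source)
    (hxt : (x, t) ∈ W) (p : E) :
    graphTensorAt I J g 𝓔 x t p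
      = pullForm (graphTensor I J g 𝓔 x₀ (extChartAt I x₀ x, t, chartDeriv I x₀ x p))
        (chartDeriv I x₀ x) := by
  have htime : fderivWithin ℝ (sliceCoeff I J g 𝓔 x) (range I ×ˢ (univ : Set ℝ))
      (extChartAt I x x, t) (0, 1)
      = pullForm (fderivWithin ℝ (sliceCoeff I J g 𝓔 x₀) (range I ×ˢ (univ : Set ℝ))
        (extChartAt I x₀ x, t) (0, 1)) (chartDeriv I x₀ x) := by
    ext v w
    rw [fderivWithin_sliceCoeff_change hg hW h𝓔 hx hxt, pullForm_apply]
    simp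
  simp only [graphTensorAt, graphTensor, htime, sliceCoeff_change g 𝓔 hx]
  exact graphForm_pull (posDefForm_sliceCoeff hW h𝓔 hinj hpos (mem_sliceDomain hx (h₀ x)))
    (posDefForm_sliceCoeff hW h𝓔 hinj hpos (mem_sliceDomain hx hxt)) (chartDeriv_bijective I hx)
    (transitionHessian_symm hx)
    (fun u v w => fderivWithin_sliceCoeff_change hg hW h𝓔 hx (h₀ x) (u, 0) v w)
    (fun u v w => fderivWithin_sliceCoeff_change hg hW h𝓔 hx hxt (u, 0) v w) p

theorem contDiffOn_graphTensor (x₀ : X) :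
    ContDiffOn ℝ ∞ (graphTensor I J g 𝓔 x₀) (familyDomain I W x₀) := by
  have hm₀ : MapsTo (fun r : E × ℝ × E => (r.1, (0 : ℝ))) (familyDomain I W x₀)
    (sliceDomain I W x₀) := fun r hr => ⟨hr.1, h₀ _⟩
  have hm : MapsTo (fun r : E × ℝ × E => (r.1, r.2.1)) (familyDomain I W x₀)
    (sliceDomain I W x₀) := fun r hr => hr
  have hDQ₀ := contDiffOn_fderivWithin_sliceCoeff_comp hg hW h𝓔 (by fun_prop) hm₀
  have hDQ := contDiffOn_fderivWithin_sliceCoeff_comp hg hW h𝓔 (by fun_prop) hm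
  exact contDiffOn_graphForm (contDiffOn_sliceCoeff_comp hg hW h𝓔 (by fun_prop) hm₀)
    (contDiffOn_sliceCoeff_comp hg hW h𝓔 (by fun_prop) hm) (hDQ₀.clm_comp contDiffOn_const)
    (hDQ.clm_comp contDiffOn_const) (hDQ.clm_apply contDiffOn_const)
    (fun r hr => posDefForm_sliceCoeff hW h𝓔 hinj hpos (hm hr)) (by fun_prop)

theorem contDiffOn_graphScale (x₀ : X) :
    ContDiffOn ℝ ∞ (graphScale I J g 𝓔 x₀) (familyDomain I W x₀) := by
  have hm₀ : MapsTo (fun r : E × ℝ × E => (r.1, (0 : ℝ))) (familyDomain I W x₀)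
    (sliceDomain I W x₀) := fun r hr => ⟨hr.1, h₀ _⟩
  have hm : MapsTo (fun r : E × ℝ × E => (r.1, r.2.1)) (familyDomain I W x₀)
    (sliceDomain I W x₀) := fun r hr => hr
  exact contDiffOn_graphFactor (contDiffOn_sliceCoeff_comp hg hW h𝓔 (by fun_prop) hm₀)
    (contDiffOn_sliceCoeff_comp hg hW h𝓔 (by fun_prop) hm)
    (fun r hr => posDefForm_sliceCoeff hW h𝓔 hinj hpos (hm₀ hr))
    (fun r hr => posDefForm_sliceCoeff hW h𝓔 hinj hpos (hm hr)) (by fun_prop)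

theorem smoothFormFamily_graphTensorAt : SmoothFormFamily I W (graphTensorAt I J g 𝓔) :=
  smoothFormFamily_of_local I
    (fun _ _ _ p hxt hx => graphTensorAt_eq_pullForm hpos hW h𝓔 hinj h₀ hg hx hxt p)
    (contDiffOn_graphTensor hpos hW h𝓔 hinj h₀ hg)

theorem smoothFunFamily_graphScaleAt : SmoothFunFamily I W (graphScaleAt I J g 𝓔) :=
  smoothFunFamily_of_local I
    (fun _ _ _ p hxt hx => graphScaleAt_eq_graphScale hpos hW h𝓔 hinj h₀ hx hxt p)
    (contDiffOn_graphScale hpos hW h𝓔 hinj h₀ hg)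

end ChartChange

/-! ### The remainder of the graph tensor -/

section Remainder

open Topology

theorem dslope_pullForm {V W : Type*} [NormedAddCommGroup V] [NormedSpace ℝ V]
    [NormedAddCommGroup W] [NormedSpace ℝ W] (L : V →L[ℝ] W) {B : ℝ → W →L[ℝ] W →L[ℝ] ℝ} {a b : ℝ}
    (hB : DifferentiableAt ℝ B a) :
    dslope (fun t => pullForm (B t) L) a b = pullForm (dslope B a b) L :=
  let T : (W →L[ℝ] W →L[ℝ] ℝ) →L[ℝ] (V →L[ℝ] V →L[ℝ] ℝ) :=
    (ContinuousLinearMap.compL ℝ V (W →L[ℝ] ℝ) (V →L[ℝ] ℝ) (L.precomp ℝ)) ∘L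
      ((ContinuousLinearMap.compL ℝ V W (W →L[ℝ] ℝ)).flip L)
  T.dslope_comp B a b fun _ => hB

variable {E : Type*} [NormedAddCommGroup E] [NormedSpace ℝ E]
  {H : Type*} [TopologicalSpace H] {I : ModelWithCorners ℝ E H}
  {X : Type*} [TopologicalSpace X] [ChartedSpace H X]
  {E' : Type*} [NormedAddCommGroup E'] [NormedSpace ℝ E']
  {H' : Type*} [TopologicalSpace H'] {J : ModelWithCorners ℝ E' H'}
  {Y : Type*} [TopologicalSpace Y] [ChartedSpace H' Y]
  {W : Set (X × ℝ)} {𝓔 : X × ℝ → Y} {g : FormField J (X := Y)}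

variable (I J) in
/-- The form `Ψ₀` in the chart centred at `x₀`, at `r = (x, t, p)`. -/
def graphRemainder (g : FormField J (X := Y)) (𝓔 : X × ℝ → Y) (x₀ : X) (r : E × ℝ × E) :
    E →L[ℝ] E →L[ℝ] ℝ :=
  dslope (fun t => graphTensor I J g 𝓔 x₀ (r.1, t, r.2.2)) 0 r.2.1

variable (I J) in
/-- The form `Ψ₀(x, t, p)` of the proposition. -/
def graphRemainderAt (g : FormField J (X := Y)) (𝓔 : X × ℝ → Y) (x : X) (t : ℝ) (p : E) :
    E →L[ℝ] E →L[ℝ] ℝ :=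
  graphRemainder I J g 𝓔 x (extChartAt I x x, t, p)

theorem graphTensorAt_eq_add_graphRemainderAt (g : FormField J (X := Y)) (𝓔 : X × ℝ → Y) (x : X)
    (t : ℝ) (p : E) :
    graphTensorAt I J g 𝓔 x t p
      = graphTensorAt I J g 𝓔 x 0 p + t • graphRemainderAt I J g 𝓔 x t p := by
  have h := sub_smul_dslope (fun t => graphTensorAt I J g 𝓔 x t p) 0 t
  rw [sub_zero] at h
  exact (add_eq_of_eq_sub' h).symm

theorem eventually_mem_familyDomain (hW : IsOpen W) {x₀ : X} {r : E × ℝ × E}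
    (hr : r ∈ familyDomain I W x₀) :
    ∀ᶠ q in 𝓝[(range I ×ˢ univ) ×ˢ univ] ((r.1, r.2.2), r.2.1),
      (q.1.1, q.2, q.1.2) ∈ familyDomain I W x₀ := by
  have hproj : ContinuousWithinAt (fun q : (E × E) × ℝ => (q.1.1, q.2))
      ((range I ×ˢ univ) ×ˢ univ) ((r.1, r.2.2), r.2.1) := by fun_prop
  have hmaps : MapsTo (fun q : (E × E) × ℝ => (q.1.1, q.2)) ((range I ×ˢ univ) ×ˢ univ)
      (range I ×ˢ univ) := fun q hq => ⟨hq.1.1, mem_univ _⟩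
  exact (hproj.tendsto_nhdsWithin hmaps).eventually
    (eventually_mem_sliceDomain hW (q := (r.1, r.2.1)) hr)

variable [IsManifold I ∞ X] [IsManifold J ∞ Y] [J.Boundaryless] [FiniteDimensional ℝ E]
  (hpos : ∀ y, PosDefForm (FormField.model J g y)) (hW : IsOpen W)
  (h𝓔 : ContMDiffOn (I.prod 𝓘(ℝ, ℝ)) J ∞ 𝓔 W)
  (hinj : ∀ q ∈ W, Function.Injective (mfderiv (I.prod 𝓘(ℝ, ℝ)) J 𝓔 q)) (h₀ : ∀ x, (x, 0) ∈ W)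
  (hg : IsSmoothForm J g)

include hpos hW h𝓔 hinj h₀ hg

theorem contDiffOn_graphRemainder (x₀ : X) :
    ContDiffOn ℝ ∞ (graphRemainder I J g 𝓔 x₀) (familyDomain I W x₀) := by
  let D : Set ((E × E) × ℝ) := (fun q => (q.1.1, q.2, q.1.2)) ⁻¹' familyDomain I W x₀
  have hF : ContDiffOn ℝ ∞ (fun q : (E × E) × ℝ => graphTensor I J g 𝓔 x₀ (q.1.1, q.2, q.1.2)) D :=
    (contDiffOn_graphTensor hpos hW h𝓔 hinj h₀ hg x₀).comp
      (f := fun q : (E × E) × ℝ => (q.1.1, q.2, q.1.2)) (by fun_prop) fun q hq => hq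
  have hdslope := contDiffOn_dslope_zero_of_relOpen (I.convex_range.prod convex_univ)
    (I.uniqueDiffOn.prod uniqueDiffOn_univ)
    (fun q (hq : q ∈ D) => (⟨⟨extChartAt_target_subset_range x₀ hq.1, mem_univ _⟩, mem_univ _⟩ :
      q ∈ (range I ×ˢ univ) ×ˢ univ))
    (fun q hq => eventually_mem_familyDomain hW (r := (q.1.1, q.2, q.1.2)) hq)
    (fun q (hq : q ∈ D) => show (q.1, (0 : ℝ)) ∈ D from ⟨hq.1, h₀ _⟩) hF
  exact hdslope.comp (f := fun r : E × ℝ × E => ((r.1, r.2.2), r.2.1)) (by fun_prop) fun r hr => hr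

theorem graphRemainderAt_eq_pullForm {x₀ x : X} {t : ℝ} (hx : x ∈ (extChartAt I x₀).source)
    (hxt : (x, t) ∈ W) (p : E) :
    graphRemainderAt I J g 𝓔 x t p
      = pullForm (graphRemainder I J g 𝓔 x₀ (extChartAt I x₀ x, t, chartDeriv I x₀ x p))
        (chartDeriv I x₀ x) := by
  let Ψ₀ : ℝ → E →L[ℝ] E →L[ℝ] ℝ :=
    fun s => graphTensor I J g 𝓔 x₀ (extChartAt I x₀ x, s, chartDeriv I x₀ x p)
  have hfibre : {s : ℝ | (x, s) ∈ W} ∈ 𝓝 0 := (hW.preimage (by fun_prop)).mem_nhds (h₀ x)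
  have hdiff : DifferentiableAt ℝ Ψ₀ 0 :=
    (((contDiffOn_graphTensor hpos hW h𝓔 hinj h₀ hg x₀).comp
      (f := fun s : ℝ => (extChartAt I x₀ x, s, chartDeriv I x₀ x p)) (by fun_prop)
      fun s hs => mem_sliceDomain hx hs).contDiffAt hfibre).differentiableAt (by simp)
  have hchange : ∀ s, (x, s) ∈ W →
      graphTensorAt I J g 𝓔 x s p = pullForm (Ψ₀ s) (chartDeriv I x₀ x) := fun s hs =>
    graphTensorAt_eq_pullForm hpos hW h𝓔 hinj h₀ hg hx hs p
  calc graphRemainderAt I J g 𝓔 x t p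
      = dslope (fun s => pullForm (Ψ₀ s) (chartDeriv I x₀ x)) 0 t := by
        change dslope (fun s => graphTensorAt I J g 𝓔 x s p) 0 t = _
        rcases eq_or_ne t 0 with rfl | ht
        · simp only [dslope_same]
          exact Filter.EventuallyEq.deriv_eq (Filter.mem_of_superset hfibre hchange)
        · simp only [dslope_of_ne _ ht, slope_def_module, hchange t hxt, hchange 0 (h₀ x)]
    _ = pullForm (dslope Ψ₀ 0 t) (chartDeriv I x₀ x) := dslope_pullForm _ hdiff

theorem smoothFormFamily_graphRemainderAt : SmoothFormFamily I W (graphRemainderAt I J g 𝓔) :=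
  smoothFormFamily_of_local I
    (fun _ _ _ p hxt hx => graphRemainderAt_eq_pullForm hpos hW h𝓔 hinj h₀ hg hx hxt p)
    (contDiffOn_graphRemainder hpos hW h𝓔 hinj h₀ hg)

end Remainder

/-! ### The Gaussian curvature of graphs -/

section Algebra

variable {E : Type*} [NormedAddCommGroup E] [NormedSpace ℝ E]

theorem koszul_comm {D : E →L[ℝ] E →L[ℝ] E →L[ℝ] ℝ} (hD : ∀ u v w, D u v w = D u w v)
    (v w p : E) : koszul D v w p = koszul D w v p := by
  simp only [koszul]
  rw [hD p v w]
  ring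

theorem graphForm_symm {B₀ B B' : E →L[ℝ] E →L[ℝ] ℝ} {D₀ D : E →L[ℝ] E →L[ℝ] E →L[ℝ] ℝ}
    (hD₀ : ∀ u v w, D₀ u v w = D₀ u w v) (hD : ∀ u v w, D u v w = D u w v)
    (hB' : ∀ v w, B' v w = B' w v) (p v w : E) :
    graphForm B₀ B D₀ D B' p v w = graphForm B₀ B D₀ D B' p w v := by
  rw [graphForm_apply, graphForm_apply, koszul_comm hD₀ v w, koszul_comm hD v w, hB' v w]
  ring

theorem PosDefForm.convex_sqrt_apply_self_le {B : E →L[ℝ] E →L[ℝ] ℝ} (hB : PosDefForm B) (R : ℝ) :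
    Convex ℝ {p | √(B p p) ≤ R} := by
  simpa using (convexOn_sqrt_apply_self hB.isSymm hB.nonneg).convex_le R

theorem graphForm_self_eq_add [FiniteDimensional ℝ E] {B B' : E →L[ℝ] E →L[ℝ] ℝ}
    (hB : PosDefForm B) (hB' : ∀ v w, B' v w = B' w v) (D : E →L[ℝ] E →L[ℝ] E →L[ℝ] ℝ)
    (p v w : E) :
    graphForm B B D D B' p v w = graphForm B B D D B' 0 v w
      + B p v * graphForm B B D D B' 0 p w + B p w * graphForm B B D D B' 0 p v := by
  simp only [graphForm_self hB, map_zero, zero_apply, mul_zero, add_zero]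
  rw [hB' v p, hB' w p]
  ring

variable [FiniteDimensional ℝ E] [Nontrivial E]

theorem graphFactor_pow {B₀ B : E →L[ℝ] E →L[ℝ] ℝ} (hB₀ : PosDefForm B₀) (hB : PosDefForm B)
    (p : E) :
    graphFactor B₀ B p ^ Module.finrank ℝ E
      = (B₀.inverse ∘L B).det * (1 + B₀ p (shift B₀ B p)) *
        √(1 + B₀ p (shift B₀ B p)) ^ Module.finrank ℝ E := by
  have hq : 0 < 1 + B₀ p (shift B₀ B p) := by linarith [apply_shift_nonneg (B₀ := B₀) hB p]
  have hn : (Module.finrank ℝ E : ℝ) ≠ 0 := by exact_mod_cast Module.finrank_pos.ne'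
  have hexponent : ((Module.finrank ℝ E + 2) / (2 * Module.finrank ℝ E) : ℝ) * Module.finrank ℝ E
      = 1 + 1 / 2 * Module.finrank ℝ E := by
    field_simp
    ring
  rw [graphFactor, mul_pow, one_div, Real.rpow_inv_natCast_pow (det_inverse_comp_pos hB₀ hB).le
    Module.finrank_pos.ne', ← Real.rpow_mul_natCast hq.le, hexponent, Real.rpow_add hq,
    Real.rpow_one, Real.rpow_mul_natCast hq.le, ← Real.sqrt_eq_rpow, mul_assoc]

theorem det_inverse_add_smulRight_comp_smul {B₀ B : E →L[ℝ] E →L[ℝ] ℝ} (hB₀ : PosDefForm B₀)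
    (hB : PosDefForm B) (p : E) (C : E →L[ℝ] E →L[ℝ] ℝ) :
    ((B + (B₀ p).smulRight (B₀ p)).inverse ∘L ((√(1 + B₀ p (shift B₀ B p)))⁻¹ • C)).det
      = (graphFactor B₀ B p ^ Module.finrank ℝ E)⁻¹ * (B₀.inverse ∘L C).det := by
  have hq : 0 < 1 + B₀ p (shift B₀ B p) := by linarith [apply_shift_nonneg (B₀ := B₀) hB p]
  have := (Real.sqrt_pos.2 hq).ne'
  have hdet := (det_inverse_comp_pos hB₀ hB).ne'
  rw [det_inverse_comp_smul, graphFactor_pow hB₀ hB,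
    ← det_inverse_add_smulRight_comp (A := B₀) (C := C) hB (B₀ p), ← shift, inv_pow]
  field_simp

end Algebra

section Curvature

variable {E : Type*} [NormedAddCommGroup E] [NormedSpace ℝ E]
  {H : Type*} [TopologicalSpace H] {I : ModelWithCorners ℝ E H}
  {X : Type*} [TopologicalSpace X] [ChartedSpace H X]
  {E' : Type*} [NormedAddCommGroup E'] [NormedSpace ℝ E']
  {H' : Type*} [TopologicalSpace H'] {J : ModelWithCorners ℝ E' H'}
  {Y : Type*} [TopologicalSpace Y] [ChartedSpace H' Y]
  {W : Set (X × ℝ)} {𝓔 : X × ℝ → Y} {g : FormField J (X := Y)}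

theorem posDefForm_inner [IsManifold J 1 Y]
    (g : Bundle.ContMDiffRiemannianMetric J ∞ E' (fun y : Y => TangentSpace J y)) (y : Y) :
    PosDefForm (FormField.model J g.inner y) :=
  ⟨fun v w => g.symm y v w, fun v hv => g.pos y v hv⟩

theorem convex_sqrt_firstForm_le (hpos : ∀ y, PosDefForm (FormField.model J g y)) {φ : X → Y}
    (hφ : IsSmoothImmersion I J φ) (x : X) (R : ℝ) :
    Convex ℝ {p | √(FormField.model I (firstForm I J g φ) x p p) ≤ R} :=
  have h : PosDefForm (FormField.model I (firstForm I J g φ) x) :=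
    (hpos (φ x)).pullForm (hφ.injective x)
  h.convex_sqrt_apply_self_le R

theorem IsNormalExp.zero_slice {φ : X → Y}
    {N : (x : X) → TangentSpace J (φ x)} (h𝓔 : IsNormalExp I J g φ N W 𝓔) :
    (fun x => 𝓔 (x, 0)) = φ :=
  funext h𝓔.apply_zero

theorem IsNormalExp.sliceMetric_zero {φ : X → Y}
    {N : (x : X) → TangentSpace J (φ x)} (h𝓔 : IsNormalExp I J g φ N W 𝓔) :
    sliceMetric I J g 𝓔 0 = firstForm I J g φ := by
  rw [sliceMetric, h𝓔.zero_slice]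

theorem IsUnitNormal.isDownwardNormal_zero [IsManifold J ∞ Y]
    {N : (x : X) → TangentSpace J (𝓔 (x, 0))} (hN : IsUnitNormal I J g (fun x => 𝓔 (x, 0)) N)
    (h𝓔 : IsNormalExp I J g (fun x => 𝓔 (x, 0)) N W 𝓔) :
    IsDownwardNormal I J g 𝓔 (fun _ => 0) N := by
  refine ⟨hN, fun x => ?_⟩
  have hunit : FormField.model J g (𝓔 (x, 0)) (N x) (N x) = 1 := hN.unit x
  change FormField.model J g (𝓔 (x, 0)) (show E' from N x) (modelVelocity J 𝓔 x 0) < 0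
  rw [h𝓔.modelVelocity_zero, map_neg, Left.neg_neg_iff]
  exact hunit ▸ one_pos

variable [IsManifold I ∞ X]

theorem graphScaleAt_eq (g : FormField J (X := Y)) (𝓔 : X × ℝ → Y) (x : X) (t : ℝ) (p : E) :
    graphScaleAt I J g 𝓔 x t p
      = graphFactor (FormField.model I (sliceMetric I J g 𝓔 0) x)
        (FormField.model I (sliceMetric I J g 𝓔 t) x) p := by
  rw [graphScaleAt, graphScale, sliceCoeff_center, sliceCoeff_center]

section Scale

variable [FiniteDimensional ℝ E] (hW : IsOpen W)
  (h𝓔 : ContMDiffOn (I.prod 𝓘(ℝ, ℝ)) J ∞ 𝓔 W)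
  (hinj : ∀ q ∈ W, Function.Injective (mfderiv (I.prod 𝓘(ℝ, ℝ)) J 𝓔 q))
  (hpos : ∀ y, PosDefForm (FormField.model J g y)) {x : X} (h₀ : (x, 0) ∈ W) {t : ℝ}
  (hxt : (x, t) ∈ W)

include hW h𝓔 hinj hpos h₀ hxt

theorem graphScaleAt_pos (p : E) : 0 < graphScaleAt I J g 𝓔 x t p := by
  rw [graphScaleAt_eq]
  exact graphFactor_pos (posDefForm_sliceMetric hW h𝓔 hinj hpos h₀)
    (posDefForm_sliceMetric hW h𝓔 hinj hpos hxt) p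

theorem convexOn_graphScaleAt [Nontrivial E] : ConvexOn ℝ univ (graphScaleAt I J g 𝓔 x t) := by
  rw [funext (graphScaleAt_eq g 𝓔 x t)]
  exact convexOn_graphFactor (posDefForm_sliceMetric hW h𝓔 hinj hpos h₀)
    (posDefForm_sliceMetric hW h𝓔 hinj hpos hxt)

end Scale

variable [IsManifold J ∞ Y] [J.Boundaryless] (hg : IsSmoothForm J g)
  (hpos : ∀ y, PosDefForm (FormField.model J g y)) {φ : X → Y}
  {N : (x : X) → TangentSpace J (φ x)}

include hg hpos

theorem fderivWithin_sliceCoeff_symm (hW : IsOpen W)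
    (h𝓔 : ContMDiffOn (I.prod 𝓘(ℝ, ℝ)) J ∞ 𝓔 W) {x : X} {t : ℝ} (hxt : (x, t) ∈ W)
    (u : E × ℝ) (v w : E) :
    fderivWithin ℝ (sliceCoeff I J g 𝓔 x) (range I ×ˢ (univ : Set ℝ)) (extChartAt I x x, t) u v w
      = fderivWithin ℝ (sliceCoeff I J g 𝓔 x) (range I ×ˢ (univ : Set ℝ)) (extChartAt I x x, t)
          u w v := by
  have hq := mem_sliceDomain (mem_extChartAt_source (I := I) x) hxt
  have hu := (I.uniqueDiffOn.prod uniqueDiffOn_univ) _ (sliceDomain_subset W x hq)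
  have hQ := (contDiffWithinAt_sliceCoeff hg hW h𝓔 hq).differentiableWithinAt (n := ∞) (by simp)
  rw [← fderivWithin_apply_apply hu hQ, ← fderivWithin_apply_apply hu hQ]
  congr 2
  funext q
  exact (hpos _).1 _ _

theorem graphTensorAt_symm (hW : IsOpen W) (h𝓔 : ContMDiffOn (I.prod 𝓘(ℝ, ℝ)) J ∞ 𝓔 W) {x : X}
    (h₀ : (x, 0) ∈ W) {t : ℝ} (hxt : (x, t) ∈ W) (p v w : E) :
    graphTensorAt I J g 𝓔 x t p v w = graphTensorAt I J g 𝓔 x t p w v :=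
  graphForm_symm (fun u => fderivWithin_sliceCoeff_symm hg hpos hW h𝓔 h₀ (u, 0))
    (fun u => fderivWithin_sliceCoeff_symm hg hpos hW h𝓔 hxt (u, 0))
    (fderivWithin_sliceCoeff_symm hg hpos hW h𝓔 hxt (0, 1)) p v w

variable [FiniteDimensional ℝ E] [FiniteDimensional ℝ E']
  (hdim : Module.finrank ℝ E' = Module.finrank ℝ E + 1)
  (hN : IsUnitNormal I J g φ N) (h𝓔 : IsNormalExp I J g φ N W 𝓔)

include hdim hN h𝓔

theorem secondForm_eq_graphTensorAt_zero (x : X) :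
    FormField.model I (secondForm I J g φ N) x = graphTensorAt I J g 𝓔 x 0 0 := by
  obtain rfl := h𝓔.zero_slice
  ext v w
  have hB := posDefForm_sliceMetric h𝓔.isOpen h𝓔.smooth h𝓔.immersive hpos (h𝓔.zero_mem x)
  have hderiv : modelDeriv I 𝓘(ℝ, ℝ) (fun _ : X => (0 : ℝ)) x = 0 := mfderiv_const
  have hgrad : gradient I (sliceMetric I J g 𝓔 0) (fun _ => 0) x = (0 : E) := by
    change (FormField.model I (sliceMetric I J g 𝓔 0) x).inverse
      (modelDeriv I 𝓘(ℝ, ℝ) (fun _ : X => (0 : ℝ)) x) = 0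
    rw [hderiv, map_zero]
  refine (secondForm_graph hg hpos hN h𝓔 hdim (f := fun _ => 0) contMDiff_const h𝓔.zero_mem
    (hN.isDownwardNormal_zero h𝓔) x v w).trans ?_
  rw [hessian_apply hB, hgrad, tiltFactor, hderiv]
  simp [koszul, Function.comp_def]

theorem graphTensorAt_zero (x : X) (p v w : E) :
    graphTensorAt I J g 𝓔 x 0 p v w
      = FormField.model I (secondForm I J g φ N) x v w
        + FormField.model I (firstForm I J g φ) x p v
          * FormField.model I (secondForm I J g φ N) x p w
        + FormField.model I (firstForm I J g φ) x p w
          * FormField.model I (secondForm I J g φ N) x p v := by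
  have hB := posDefForm_sliceCoeff h𝓔.isOpen h𝓔.smooth h𝓔.immersive hpos
    (mem_sliceDomain (mem_extChartAt_source (I := I) x) (h𝓔.zero_mem x))
  rw [secondForm_eq_graphTensorAt_zero hg hpos hdim hN h𝓔, ← h𝓔.sliceMetric_zero,
    ← sliceCoeff_center]
  exact graphForm_self_eq_add hB (fderivWithin_sliceCoeff_symm hg hpos h𝓔.isOpen h𝓔.smooth
    (h𝓔.zero_mem x) (0, 1)) _ p v w

theorem graphTensorAt_apply (x : X) (t : ℝ) (p v w : E) :
    graphTensorAt I J g 𝓔 x t p v w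
      = FormField.model I (secondForm I J g φ N) x v w
        + FormField.model I (firstForm I J g φ) x p v
          * FormField.model I (secondForm I J g φ N) x p w
        + FormField.model I (firstForm I J g φ) x p w
          * FormField.model I (secondForm I J g φ N) x p v
        + t * graphRemainderAt I J g 𝓔 x t p v w := by
  rw [graphTensorAt_eq_add_graphRemainderAt, add_apply, add_apply,
    graphTensorAt_zero hg hpos hdim hN h𝓔]
  rfl

variable {f : X → ℝ} (hf : ContMDiff I 𝓘(ℝ, ℝ) ∞ f) (hx : ∀ x, (x, f x) ∈ W) {ν : X → E'}
  (hν : IsDownwardNormal I J g 𝓔 f ν)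

include hf hx hν

theorem secondForm_graph_eq_smul (x : X) :
    FormField.model I (secondForm I J g (graph 𝓔 f) ν) x
      = (tiltFactor I J g 𝓔 f x)⁻¹ • (FormField.model I (hessian I (sliceMetric I J g 𝓔 0) f) x
          + graphTensorAt I J g 𝓔 x (f x) (gradient I (sliceMetric I J g 𝓔 0) f x)) := by
  ext v w
  exact secondForm_graph hg hpos hN h𝓔 hdim hf hx hν x v w

theorem posDefForm_secondForm_graph_iff (x : X) :
    PosDefForm (FormField.model I (secondForm I J g (graph 𝓔 f) ν) x)
      ↔ PosDefForm (FormField.model I (hessian I (sliceMetric I J g 𝓔 0) f) x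
          + graphTensorAt I J g 𝓔 x (f x) (gradient I (sliceMetric I J g 𝓔 0) f x)) := by
  rw [secondForm_graph_eq_smul hg hpos hdim hN h𝓔 hf hx hν]
  exact posDefForm_smul_iff (inv_pos.2 (tiltFactor_pos
    (posDefForm_sliceMetric h𝓔.isOpen h𝓔.smooth h𝓔.immersive hpos (hx x))))

theorem det_shapeOperator_graph [Nontrivial E] (x : X) :
    (shapeOperator I J g (graph 𝓔 f) ν x).det
      = (graphScaleAt I J g 𝓔 x (f x) (gradient I (sliceMetric I J g 𝓔 0) f x)
          ^ Module.finrank ℝ E)⁻¹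
        * (toEndo I (sliceMetric I J g 𝓔 0) x
          (FormField.model I (hessian I (sliceMetric I J g 𝓔 0) f) x
            + graphTensorAt I J g 𝓔 x (f x) (gradient I (sliceMetric I J g 𝓔 0) f x))).det := by
  have hB := fun t => posDefForm_sliceMetric h𝓔.isOpen h𝓔.smooth h𝓔.immersive hpos (x := x) (t := t)
  have hB₀ := hB 0 (h𝓔.zero_mem x)
  have hdet := det_inverse_add_smulRight_comp_smul hB₀ (hB (f x) (hx x))
    (gradient I (sliceMetric I J g 𝓔 0) f x)
    (FormField.model I (hessian I (sliceMetric I J g 𝓔 0) f) x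
      + graphTensorAt I J g 𝓔 x (f x) (gradient I (sliceMetric I J g 𝓔 0) f x))
  rw [shift_gradient hB₀, apply_gradient hB₀, ← tiltFactor] at hdet
  have hscale := graphScaleAt_eq (I := I) (J := J) g 𝓔 x (f x)
    (gradient I (sliceMetric I J g 𝓔 0) f x)
  have hfirst := firstForm_graph hg hpos hN h𝓔 ((hf x).mdifferentiableAt (by simp)) (hx x)
  rw [← hfirst, ← secondForm_graph_eq_smul hg hpos hdim hN h𝓔 hf hx hν, ← hscale] at hdet
  exact hdet

end Curvature

theorem rpow_one_div_of_eq_inv_pow_mul {n : ℕ} (hn : n ≠ 0) {c d e : ℝ} (hc : 0 < c)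
    (h : d = (c ^ n)⁻¹ * e) : d ^ ((1 : ℝ) / n) = c⁻¹ * e ^ ((1 : ℝ) / n) := by
  rw [h, mul_rpow_of_pos (inv_pos.2 (pow_pos hc n)), Real.inv_rpow (pow_pos hc n).le, one_div,
    Real.pow_rpow_inv_natCast hc.le hn]

end GaussGraph

end

open GaussGraph in
theorem proposition3p1_general
    {n : ℕ} [NeZero n]
    {E : Type*} [NormedAddCommGroup E] [NormedSpace ℝ E] (hE : Module.finrank ℝ E = n)
    {E' : Type*} [NormedAddCommGroup E'] [NormedSpace ℝ E'] (hE' : Module.finrank ℝ E' = n + 1)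
    {H : Type*} [TopologicalSpace H] (I : ModelWithCorners ℝ E H)
    {H' : Type*} [TopologicalSpace H'] (J : ModelWithCorners ℝ E' H') [J.Boundaryless]
    {M : Type*} [TopologicalSpace M] [ChartedSpace H' M] [IsManifold J ∞ M]
    (g : ContMDiffRiemannianMetric J ∞ E' (fun y : M => TangentSpace J y))
    {S : Type*} [TopologicalSpace S] [ChartedSpace H S] [IsManifold I ∞ S]
    (i : S → M) (N₀ : (x : S) → TangentSpace J (i x)) (hN₀ : IsUnitNormal I J g.inner i N₀)
    (W : Set (S × ℝ)) (𝓔 : S × ℝ → M) (h𝓔 : IsNormalExp I J g.inner i N₀ W 𝓔)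
    (g₀ A₀ : FormField I (X := S)) (hg₀ : g₀ = firstForm I J g.inner i)
    (hA₀ : A₀ = secondForm I J g.inner i N₀) :
    ∃ (ψ : (x : S) → ℝ → TangentSpace I x → ℝ)
      (Ψ Ψ₀ : (x : S) → ℝ → TangentSpace I x →
        (TangentSpace I x →L[ℝ] TangentSpace I x →L[ℝ] ℝ)),
      SmoothFunFamily I W ψ ∧ SmoothFormFamily I W Ψ ∧ SmoothFormFamily I W Ψ₀ ∧
      (∀ x t, (x, t) ∈ W → ∀ p, 0 < ψ x t p) ∧
      (∀ x t, (x, t) ∈ W → ConvexOn ℝ univ (ψ x t)) ∧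
      (∀ x t, (x, t) ∈ W → ∀ p v w, Ψ x t p v w = Ψ x t p w v) ∧
      (∀ x t, (x, t) ∈ W → ∀ p v w,
        Ψ x t p v w = A₀ x v w + g₀ x p v * A₀ x p w + g₀ x p w * A₀ x p v
          + t * Ψ₀ x t p v w) ∧
      ∀ f : S → ℝ, ContMDiff I 𝓘(ℝ, ℝ) ∞ f → (∀ x, (x, f x) ∈ W) →
        IsSmoothImmersion I J (graph 𝓔 f) ∧
        (∃ ν, IsDownwardNormal I J g.inner 𝓔 f ν) ∧
        ∀ ν, IsDownwardNormal I J g.inner 𝓔 f ν →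
          (∀ x, ∀ B, B = hessian I g₀ f x + Ψ x (f x) (gradient I g₀ f x) →
            (shapeOperator I J g.inner (graph 𝓔 f) ν x).det
              = (ψ x (f x) (gradient I g₀ f x) ^ n)⁻¹ * (toEndo I g₀ x B).det ∧
            (shapeOperator I J g.inner (graph 𝓔 f) ν x).det ^ ((1 : ℝ) / n)
              = (ψ x (f x) (gradient I g₀ f x))⁻¹ * (toEndo I g₀ x B).det ^ ((1 : ℝ) / n) ∧
            (PosDefForm (secondForm I J g.inner (graph 𝓔 f) ν x) ↔ PosDefForm B)) ∧
          (IsConvexHypersurface I J g.inner (graph 𝓔 f) ν ↔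
            ∀ x, PosDefForm (hessian I g₀ f x + Ψ x (f x) (gradient I g₀ f x))) := by
  have : FiniteDimensional ℝ E := .of_finrank_pos (hE ▸ NeZero.pos n)
  have : FiniteDimensional ℝ E' := .of_finrank_pos (hE' ▸ n.succ_pos)
  have : Nontrivial E := Module.nontrivial_of_finrank_pos (R := ℝ) (hE ▸ NeZero.pos n)
  subst hE hA₀
  obtain rfl : g₀ = sliceMetric I J g.inner 𝓔 0 := hg₀.trans h𝓔.sliceMetric_zero.symm
  have hg := g.contMDiff
  have hpos := posDefForm_inner g
  have ⟨hW, h₀, _, hs, _, _, hinj⟩ := h𝓔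
  have hψ x t (hxt : (x, t) ∈ W) := graphScaleAt_pos hW hs hinj hpos (h₀ x) hxt
  refine ⟨graphScaleAt I J g.inner 𝓔, graphTensorAt I J g.inner 𝓔, graphRemainderAt I J g.inner 𝓔,
    smoothFunFamily_graphScaleAt hpos hW hs hinj h₀ hg,
    smoothFormFamily_graphTensorAt hpos hW hs hinj h₀ hg,
    smoothFormFamily_graphRemainderAt hpos hW hs hinj h₀ hg, hψ,
    fun x t hxt => convexOn_graphScaleAt hW hs hinj hpos (h₀ x) hxt,
    fun x t hxt => graphTensorAt_symm hg hpos hW hs (h₀ x) hxt,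
    fun x t _ => hg₀ ▸ graphTensorAt_apply hg hpos hE' hN₀ h𝓔 x t,
    fun f hf hx => ⟨isSmoothImmersion_graph hW hs hinj hf hx,
      ⟨_, isDownwardNormal_graphNormal hg hpos hN₀ h𝓔 hf hx⟩, fun ν hν => ?_⟩⟩
  have hiff := posDefForm_secondForm_graph_iff hg hpos hE' hN₀ h𝓔 hf hx hν
  refine ⟨fun x B hB => ?_, forall_congr' hiff⟩
  have hdet := det_shapeOperator_graph hg hpos hE' hN₀ h𝓔 hf hx hν x
  subst hB
  exact ⟨hdet, rpow_one_div_of_eq_inv_pow_mul (NeZero.ne _) (hψ x (f x) (hx x) _) hdet, hiff x⟩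

theorem proposition3p1
    {n : ℕ} [NeZero n]
    {M : Type*} [TopologicalSpace M] [T2Space M]
    [ChartedSpace (EuclideanSpace ℝ (Fin (n + 1))) M] [IsManifold (𝓡 (n + 1)) ∞ M]
    (g : ContMDiffRiemannianMetric (𝓡 (n + 1)) ∞ (EuclideanSpace ℝ (Fin (n + 1)))
      (fun y : M => TangentSpace (𝓡 (n + 1)) y))
    {S : Type*} [TopologicalSpace S] [T2Space S] [CompactSpace S]
    [ChartedSpace (EuclideanHalfSpace n) S] [IsManifold (𝓡∂ n) ∞ S]
    (i : S → M) (hi : GaussGraph.IsSmoothImmersion (𝓡∂ n) (𝓡 (n + 1)) i)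
    (N₀ : (x : S) → TangentSpace (𝓡 (n + 1)) (i x))
    (hN₀ : GaussGraph.IsUnitNormal (𝓡∂ n) (𝓡 (n + 1)) g.inner i N₀)
    (W : Set (S × ℝ)) (𝓔 : S × ℝ → M)
    (h𝓔 : GaussGraph.IsNormalExp (𝓡∂ n) (𝓡 (n + 1)) g.inner i N₀ W 𝓔)
    (g₀ A₀ : GaussGraph.FormField (𝓡∂ n) (X := S))
    (hg₀ : g₀ = GaussGraph.firstForm (𝓡∂ n) (𝓡 (n + 1)) g.inner i)
    (hA₀ : A₀ = GaussGraph.secondForm (𝓡∂ n) (𝓡 (n + 1)) g.inner i N₀) :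
    ∃ (ψ : (x : S) → ℝ → TangentSpace (𝓡∂ n) x → ℝ)
      (Ψ Ψ₀ : (x : S) → ℝ → TangentSpace (𝓡∂ n) x →
        (TangentSpace (𝓡∂ n) x →L[ℝ] TangentSpace (𝓡∂ n) x →L[ℝ] ℝ)),
      GaussGraph.SmoothFunFamily (𝓡∂ n) W ψ ∧
      GaussGraph.SmoothFormFamily (𝓡∂ n) W Ψ ∧
      GaussGraph.SmoothFormFamily (𝓡∂ n) W Ψ₀ ∧
      -- `ψ` is positive, and convex in `p` for `‖p‖ ≤ R` and `t` close to `0`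
      (∀ x t, (x, t) ∈ W → ∀ p, 0 < ψ x t p) ∧
      (∀ R : ℝ, 0 < R → ∃ ε : ℝ, 0 < ε ∧ ∀ x t, (x, t) ∈ W → |t| < ε →
        ConvexOn ℝ {p | √(g₀ x p p) ≤ R} (ψ x t)) ∧
      -- `Ψ` is symmetric and has the stated expansion in `t`
      (∀ x t, (x, t) ∈ W → ∀ p v w, Ψ x t p v w = Ψ x t p w v) ∧
      (∀ x t, (x, t) ∈ W → ∀ p v w,
        Ψ x t p v w = A₀ x v w + g₀ x p v * A₀ x p w + g₀ x p w * A₀ x p v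
          + t * Ψ₀ x t p v w) ∧
      -- the curvature of graphs
      ∀ f : S → ℝ, ContMDiff (𝓡∂ n) 𝓘(ℝ, ℝ) ∞ f → (∀ x, (x, f x) ∈ W) →
        GaussGraph.IsSmoothImmersion (𝓡∂ n) (𝓡 (n + 1)) (GaussGraph.graph 𝓔 f) ∧
        (∃ ν, GaussGraph.IsDownwardNormal (𝓡∂ n) (𝓡 (n + 1)) g.inner 𝓔 f ν) ∧
        ∀ ν, GaussGraph.IsDownwardNormal (𝓡∂ n) (𝓡 (n + 1)) g.inner 𝓔 f ν →
          (∀ x, ∀ B, B = GaussGraph.hessian (𝓡∂ n) g₀ f x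
              + Ψ x (f x) (GaussGraph.gradient (𝓡∂ n) g₀ f x) →
            (GaussGraph.shapeOperator (𝓡∂ n) (𝓡 (n + 1)) g.inner
                (GaussGraph.graph 𝓔 f) ν x).det
              = (ψ x (f x) (GaussGraph.gradient (𝓡∂ n) g₀ f x) ^ n)⁻¹
                * (GaussGraph.toEndo (𝓡∂ n) g₀ x B).det ∧
            GaussGraph.gaussCurvature (𝓡∂ n) (𝓡 (n + 1)) g.inner
                (GaussGraph.graph 𝓔 f) ν x
              = (ψ x (f x) (GaussGraph.gradient (𝓡∂ n) g₀ f x))⁻¹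
                * (GaussGraph.toEndo (𝓡∂ n) g₀ x B).det ^ ((1 : ℝ) / n) ∧
            (GaussGraph.PosDefForm (GaussGraph.secondForm (𝓡∂ n) (𝓡 (n + 1)) g.inner
                (GaussGraph.graph 𝓔 f) ν x) ↔ GaussGraph.PosDefForm B)) ∧
          (GaussGraph.IsConvexHypersurface (𝓡∂ n) (𝓡 (n + 1)) g.inner
              (GaussGraph.graph 𝓔 f) ν ↔
            ∀ x, GaussGraph.PosDefForm (GaussGraph.hessian (𝓡∂ n) g₀ f x
              + Ψ x (f x) (GaussGraph.gradient (𝓡∂ n) g₀ f x))) := by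
  obtain ⟨ψ, Ψ, Ψ₀, hψ, hΨ, hΨ₀, hpos, hconv, h⟩ := proposition3p1_general (n := n) (by simp)
    (by simp) (𝓡∂ n) (𝓡 (n + 1)) g i N₀ hN₀ W 𝓔 h𝓔 g₀ A₀ hg₀ hA₀
  exact ⟨ψ, Ψ, Ψ₀, hψ, hΨ, hΨ₀, hpos, fun R _ => ⟨1, one_pos, fun x t hxt _ =>
    (hconv x t hxt).subset (subset_univ _) (hg₀ ▸ GaussGraph.convex_sqrt_firstForm_le
      (GaussGraph.posDefForm_inner g) hi x R)⟩, h⟩
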